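/- **Definitions ($d=1$).** Let $0<\hbar\le 1$. For $j\in\mathbf N=\{0,1,2,\dots\}$ let $h_j$ be the semiclassical Hermite functions, i.e. the $L^2(\mathbf R)$-normalized solutions of $-\hbar^2h_j''+x^2h_j=(2j+1)\hbar\,h_j$, and write $\langle j'|A|j\rangle=(h_{j'},Ah_j)_{L^2(\mathbf R)}$. If $A$ is a Hilbert–Schmidt operator on $L^2(\mathbf R)$ with integral kernel $r\in L^2(\mathbf R^2)$, its Wigner function is $$W_\hbar[A](x,\xi)=\frac1{2\pi}\int_{\mathbf R}e^{-i\xi y}\,r\big(x+\tfrac12\hbar y,\;x-\tfrac12\hbar y\big)\,dy\in L^2(\mathbf R^2)$$ (Fourier–Plancherel transform in $y$ for almost every $x$). For a function $a$ on $\mathbf R^2\simeq\mathbf C$, $z=(x,\xi)\simeq x+i\xi$, and $k\in\mathbf Z$ put $a_k(z)=\int_0^{2\pi}a(e^{i\theta}z)e^{ik\theta}\,d\theta$, and for $M,K\ge0$, $N\in\mathbf N$ put $$\|a\|_{M,K,N}=\sup_{k\in\mathbf Z}\ \sup_{z\in\mathbf R^2}\ \sup_{p+q\le N}(|z|^2+1)^M(|k|+1)^K\big|(\sqrt\hbar\,\partial_x)^p(\sqrt\hbar\,\partial_\xi)^q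 a_k(z)\big|,$$ with the convention $\|a\|_{M,K,N}=+\infty$ if some $a_k$ is not of class $C^N$. **Proposition 6.1.** For every real $\mu\ge0$ and every integer $n\ge1$ there is a constant $D_{\mu,n}>0$, depending only on $\mu$ and $n$, such that for all $0<\hbar\le1$, all real $M,\alpha\ge0$, $\varepsilon>0$ and $\tau\ge\alpha+1$, every Hilbert–Schmidt operator $A$ on $L^2(\mathbf R)$ and all $j,j'\in\mathbf N$, $$|\langle j'|A|j\rangle|\le\frac{D_{\mu,n}\;2\pi\hbar\;\|W_\hbar[A]\|_{M,1+\varepsilon+\tau,n}}{\big(|j'-j|+\tfrac12\big)^{\min(1+\alpha+\varepsilon,\,1+\varepsilon+\tau)}\;\big((j+\tfrac12)\hbar+\tfrac12\big)^{\min\left(\frac{\tau-\alpha-1}2,\;\mu-\frac32,\;M,\;\frac{n-1}2\right)}} .$$ The norm may be computed with any representative of $W_\hbar[A]$. -/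

import Mathlib

open MeasureTheory FourierTransform
open scoped ENNReal

namespace HermiteWigner

noncomputable section

/-- The Hilbert space `L²(ℝ; ℂ)`. -/
abbrev L2R : Type := Lp ℂ 2 (volume : Measure ℝ)

/-- Hilbert–Schmidt operators: `∑ ‖A e‖² < ∞` over an orthonormal (Hilbert) basis. -/
def IsHilbertSchmidt (A : L2R →L[ℂ] L2R) : Prop :=
  ∃ (s : Set L2R) (b : HilbertBasis s ℂ L2R), Summable fun i => ‖A (b i)‖ ^ 2

/-- `r ∈ L²(ℝ²)` is an integral kernel of `A`: `(A f)(x) = ∫ r(x, y) f(y) dy`. -/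
def IsIntegralKernel (A : L2R →L[ℂ] L2R) (r : ℝ × ℝ → ℂ) : Prop :=
  MemLp r 2 volume ∧ ∀ f : L2R, A f =ᵐ[volume] fun x => ∫ y, r (x, y) * f y

/-- `a ∈ L²(ℝ²)` is (a representative of) the Wigner function of `A` at scale `hbar`,
`a(x, ξ) = (2π)⁻¹ ∫ exp(-i ξ y) r(x + hbar y / 2, x - hbar y / 2) dy`, where `r` is the integral
kernel of `A`. As `r` is only square integrable, the integral in `y` is the Fourier–Plancherel
transform on `L²(ℝ)`, for almost every `x`. Mathlib's transform `𝓕` has the phase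
`exp(-2π i η y)`, so it is evaluated at `η = ξ / (2π)`. -/
def IsWignerFunction (hbar : ℝ) (A : L2R →L[ℂ] L2R) (a : ℝ × ℝ → ℂ) : Prop :=
  MemLp a 2 volume ∧ ∃ r : ℝ × ℝ → ℂ, IsIntegralKernel A r ∧
    ∀ᵐ x : ℝ, ∃ hr : MemLp (fun y : ℝ => r (x + hbar * y / 2, x - hbar * y / 2)) 2 volume,
      ∀ᵐ ξ : ℝ, a (x, ξ) =
        (1 / (2 * Real.pi) : ℂ) * (𝓕 (hr.toLp) : L2R) (ξ / (2 * Real.pi))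

/-- The rotation `z ↦ e^{iθ} z` of the phase plane, with `z = (x, ξ)` read as `x + iξ`. -/
def rot (θ : ℝ) (z : ℝ × ℝ) : ℝ × ℝ :=
  (z.1 * Real.cos θ - z.2 * Real.sin θ, z.1 * Real.sin θ + z.2 * Real.cos θ)

/-- The Fourier coefficients `a_k(z) = ∫₀^{2π} a(e^{iθ} z) e^{ikθ} dθ`. -/
def angularCoeff (a : ℝ × ℝ → ℂ) (k : ℤ) (z : ℝ × ℝ) : ℂ :=
  ∫ θ in (0 : ℝ)..(2 * Real.pi), a (rot θ z) * Complex.exp (Complex.I * k * θ)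

/-- The mixed partial derivative `∂_x^p ∂_ξ^q f`. -/
def mixedPartial (p q : ℕ) (f : ℝ × ℝ → ℂ) (z : ℝ × ℝ) : ℂ :=
  iteratedDeriv p (fun x => iteratedDeriv q (fun ξ => f (x, ξ)) z.2) z.1

open Classical in
/-- The norm `‖a‖_{M,K,N}`, the supremum over `k ∈ ℤ`, `z ∈ ℝ²` and `p + q ≤ N` of
`(|z|² + 1)^M (|k| + 1)^K |(√hbar ∂_x)^p (√hbar ∂_ξ)^q a_k(z)|`; it is `∞` when some `a_k` is not
`N` times continuously differentiable. -/
def symbolNorm (hbar M K : ℝ) (N : ℕ) (a : ℝ × ℝ → ℂ) : ℝ≥0∞ :=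
  if ∀ k : ℤ, ContDiff ℝ N (angularCoeff a k) then
    ⨆ (k : ℤ) (z : ℝ × ℝ) (p : ℕ) (q : ℕ) (_ : p + q ≤ N),
      ENNReal.ofReal
          ((z.1 ^ 2 + z.2 ^ 2 + 1) ^ M * (|(k : ℝ)| + 1) ^ K * Real.sqrt hbar ^ (p + q)) *
        ‖mixedPartial p q (angularCoeff a k) z‖ₑ
  else ⊤

/-- The semiclassical Hermite function of index `j`, i.e. the `L²`-normalized solution
`h_j(x) = (π hbar)^{-1/4} (j!)^{-1/2} He_j(√(2/hbar) x) exp(-x²/(2 hbar))` of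
`-hbar² h'' + x² h = (2j+1) hbar h`; `He_j` is the probabilists' Hermite polynomial. -/
def hermiteFun (hbar : ℝ) (j : ℕ) (x : ℝ) : ℂ :=
  (((Real.pi * hbar) ^ (-(1 / 4) : ℝ) / Real.sqrt (j.factorial : ℝ) *
    (Polynomial.aeval (Real.sqrt (2 / hbar) * x) (Polynomial.hermite j) : ℝ) *
    Real.exp (-(x ^ 2) / (2 * hbar)) : ℝ) : ℂ)

theorem memLp_pow_mul_gaussian {c : ℝ} (hc : 0 < c) (n : ℕ) :
    MemLp (fun x : ℝ => x ^ n * Real.exp (-c * x ^ 2)) 2 volume := by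
  rw [memLp_two_iff_integrable_sq (by fun_prop)]
  have h := integrable_rpow_mul_exp_neg_mul_sq (b := 2 * c) (by positivity)
    (s := ((2 * n : ℕ) : ℝ)) (by
      have : (0 : ℝ) ≤ ((2 * n : ℕ) : ℝ) := Nat.cast_nonneg _
      linarith)
  refine h.congr (Filter.Eventually.of_forall fun x => ?_)
  simp only [Real.rpow_natCast]
  rw [mul_pow, ← pow_mul, mul_comm n 2, ← Real.exp_nat_mul]
  congr 2
  push_cast
  ring

theorem memLp_polynomial_mul_gaussian {c : ℝ} (hc : 0 < c) (p : Polynomial ℝ) :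
    MemLp (fun x : ℝ => p.eval x * Real.exp (-c * x ^ 2)) 2 volume := by
  induction p using Polynomial.induction_on' with
  | add p q hp hq =>
    refine (hp.add hq).ae_eq (Filter.Eventually.of_forall fun x => ?_)
    simp [add_mul]
  | monomial n t =>
    refine ((memLp_pow_mul_gaussian hc n).const_mul t).ae_eq
      (Filter.Eventually.of_forall fun x => ?_)
    simp [mul_assoc]

theorem memLp_hermiteFun {hbar : ℝ} (h : 0 < hbar) (j : ℕ) :
    MemLp (hermiteFun hbar j) 2 volume := by
  have hc : 0 < 1 / (2 * hbar) := by positivity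
  have key := ((memLp_polynomial_mul_gaussian hc
    (((Polynomial.hermite j).map (Int.castRingHom ℝ)).comp
      (Polynomial.C (Real.sqrt (2 / hbar)) * Polynomial.X))).const_mul
    ((Real.pi * hbar) ^ (-(1 / 4) : ℝ) / Real.sqrt (j.factorial : ℝ))).ofReal (K := ℂ)
  refine key.ae_eq (Filter.Eventually.of_forall fun x => ?_)
  simp only [hermiteFun, Polynomial.eval_comp, Polynomial.eval_mul, Polynomial.eval_C,
    Polynomial.eval_X, Polynomial.eval_map, Polynomial.aeval_def]
  have e : -(1 / (2 * hbar)) * x ^ 2 = -(x ^ 2) / (2 * hbar) := by ring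
  rw [e, mul_assoc]
  rfl

/-- The Hermite function `h_j` as an element of `L²(ℝ; ℂ)`. -/
def hermiteL2 {hbar : ℝ} (h : 0 < hbar) (j : ℕ) : L2R :=
  (memLp_hermiteFun h j).toLp (hermiteFun hbar j)

end

end HermiteWigner

/-! By Parseval in `y`, a matrix element of `A` between Hermite functions is the integral of its
Wigner function `a` against the cross-Wigner function of `h_j` and `h_{j'}`, rescaled by `√ħ`. Under
rotations the latter acquires the phase `e^{ikθ}` with `k = j' - j`, so averaging over angles leaves
only the coefficient `a_k` (`integral_mul_eq_integral_angularCoeff`), whose norm already supplies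
`(|k|+1)^{-(1+ε+τ)}`. What remains is `exists_norm_integral_crossWigner_le`: if `g` has angular mode
`k` and `n` derivatives bounded by `K (1+ħ|z|²)^{-E}` with `0 ≤ E ≤ (n-1)/2`, its pairing with the
cross-Wigner function is `O(K (|k|+1) L^{-E})`, where `L = 1 + ħ(j+j'+1)`. The lost factor `|k|+1`
is paid for by `τ ≥ α+1`.

For `j' ≥ j` the cross-Wigner function is `z^k Q(|z|²) e^{-|z|²}` with `Q` a multiple of a Laguerre
polynomial (`exists_laguerreForm`); the other case follows by conjugation. It is an eigenfunction of
`|z|² - Δ/4` with eigenvalue `N = j+j'+1`. Moving `1 + ħ(|z|² - Δ/4)` onto `g` gains a factor `L` at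
the price of one power of `1+ħ|z|²` and two derivatives; iterating this gives the decay
(`LaguerreForm.exists_norm_integral_le`). For exponents at most one, `g` is first divided by
`1+ħ|z|²+L`.

The heart is the base case: one bounded derivative and no decay must give `O(|k|+1)` uniformly in
`N` (`RadialPair.norm_integral_le`). Size alone yields only `√N`, because in the variable `s = |z|²`
an `L²` mass of order one is spread over a length of order `N`. Oscillation is exploited as follows.
The radial profile solves `s(sw')' = (k²/4 - s(N-s))w`, so away from the turning point `s = N` the
function `w` is, up to the centrifugal term, the derivative of `v = sw'` divided by `-(N-s)`. The
quotient is regularised at the Airy scale `|N-s| ~ N^{1/3}` by means of a weight `ψ`, and one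
integration by parts leaves remainders controlled by `∫ψw² = O(N^{-1/4})` and `∫ψ⁴w² = O(N^{-2/3})`.
These are the sizes predicted by WKB, but they are derived from virial identities, without
asymptotics of Laguerre functions (`integral_turnWeight_le`, `integral_turnWeight_pow_four_le`). If
`k² ≥ N` the size bound suffices, since `√N ≤ k`; and the singularity `k²/(4s)` is harmless because
a function of nonzero mode vanishes at the origin. -/

namespace HermiteWigner

open Set Filter Topology

/-! ### Calculus on the half-line: polynomial growth against exponential decay -/

/-- Polynomial growth on the positive half-line. -/
def PolyBdd (f : ℝ → ℝ) : Prop := ∃ (a : ℝ) (n : ℕ), ∀ s > 0, |f s| ≤ a * (1 + s) ^ n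

theorem PolyBdd.mul {f g : ℝ → ℝ} (hf : PolyBdd f) (hg : PolyBdd g) :
    PolyBdd fun s => f s * g s := by
  obtain ⟨a, n, hf⟩ := hf
  obtain ⟨b, m, hg⟩ := hg
  refine ⟨a * b, n + m, fun s hs => ?_⟩
  rw [abs_mul]
  calc |f s| * |g s| ≤ (a * (1 + s) ^ n) * (b * (1 + s) ^ m) :=
        mul_le_mul (hf s hs) (hg s hs) (abs_nonneg _) ((abs_nonneg _).trans (hf s hs))
    _ = _ := by ring

theorem PolyBdd.add {f g : ℝ → ℝ} (hf : PolyBdd f) (hg : PolyBdd g) :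
    PolyBdd fun s => f s + g s := by
  obtain ⟨a, n, hf⟩ := hf
  obtain ⟨b, m, hg⟩ := hg
  refine ⟨a + b, n + m, fun s hs => ?_⟩
  have h1 : (1 + s) ^ n ≤ (1 + s) ^ (n + m) := pow_le_pow_right₀ (by linarith) (by omega)
  have h2 : (1 + s) ^ m ≤ (1 + s) ^ (n + m) := pow_le_pow_right₀ (by linarith) (by omega)
  have ha : 0 ≤ a := nonneg_of_mul_nonneg_left ((abs_nonneg _).trans (hf s hs)) (by positivity)
  have hb : 0 ≤ b := nonneg_of_mul_nonneg_left ((abs_nonneg _).trans (hg s hs)) (by positivity)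
  calc |f s + g s| ≤ |f s| + |g s| := abs_add_le _ _
    _ ≤ a * (1 + s) ^ n + b * (1 + s) ^ m := add_le_add (hf s hs) (hg s hs)
    _ ≤ a * (1 + s) ^ (n + m) + b * (1 + s) ^ (n + m) := by gcongr
    _ = _ := by ring

theorem PolyBdd.of_le {f g : ℝ → ℝ} (hg : PolyBdd g) (h : ∀ s > 0, |f s| ≤ |g s|) :
    PolyBdd f := by
  obtain ⟨a, n, hg⟩ := hg
  exact ⟨a, n, fun s hs => (h s hs).trans (hg s hs)⟩

theorem polyBdd_const (c : ℝ) : PolyBdd fun _ => c :=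
  ⟨|c|, 0, fun s _ => by simp⟩

theorem polyBdd_id : PolyBdd fun s => s :=
  ⟨1, 1, fun s hs => by rw [abs_of_pos hs]; linarith⟩

theorem PolyBdd.neg {f : ℝ → ℝ} (hf : PolyBdd f) : PolyBdd fun s => -f s :=
  hf.of_le fun s _ => by simp

theorem PolyBdd.sub {f g : ℝ → ℝ} (hf : PolyBdd f) (hg : PolyBdd g) :
    PolyBdd fun s => f s - g s := by
  simpa [sub_eq_add_neg] using hf.add hg.neg

theorem PolyBdd.pow {f : ℝ → ℝ} (hf : PolyBdd f) (n : ℕ) : PolyBdd fun s => f s ^ n := by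
  induction n with
  | zero => simpa using polyBdd_const 1
  | succ n ih => simpa [pow_succ] using ih.mul hf

theorem one_add_pow_mul_exp_le (n : ℕ) {c : ℝ} (hc : 0 < c) :
    ∃ K : ℝ, 0 < K ∧ ∀ s ≥ 0, (1 + s) ^ n * Real.exp (-(c * s)) ≤ K := by
  refine ⟨n.factorial / c ^ n * Real.exp c, by positivity, fun s hs => ?_⟩
  have h := Real.pow_div_factorial_le_exp (c * (1 + s)) (by positivity) n
  have h2 : (1 + s) ^ n ≤ n.factorial / c ^ n * Real.exp (c * (1 + s)) := by
    rw [div_le_iff₀ (by positivity), mul_pow] at h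
    rw [div_mul_eq_mul_div, le_div_iff₀ (by positivity)]
    linarith
  calc (1 + s) ^ n * Real.exp (-(c * s))
      ≤ n.factorial / c ^ n * Real.exp (c * (1 + s)) * Real.exp (-(c * s)) := by gcongr
    _ = _ := by rw [mul_assoc, ← Real.exp_add]; ring_nf

/-- Half of the exponential absorbs the polynomial; the other half is kept for integrability and for
boundary terms. -/
theorem PolyBdd.mul_exp_le {f : ℝ → ℝ} (hf : PolyBdd f) :
    ∃ K : ℝ, 0 < K ∧ ∀ s > 0, |f s| * Real.exp (-s) ≤ K * Real.exp (-s / 2) := by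
  obtain ⟨a, n, hf⟩ := hf
  obtain ⟨K, hK, hb⟩ := one_add_pow_mul_exp_le n (c := 1 / 2) (by norm_num)
  refine ⟨(|a| + 1) * K, by positivity, fun s hs => ?_⟩
  have e : Real.exp (-s) = Real.exp (-(1 / 2 * s)) * Real.exp (-s / 2) := by
    rw [← Real.exp_add]; ring_nf
  rw [e, ← mul_assoc]
  refine mul_le_mul_of_nonneg_right ?_ (Real.exp_pos _).le
  calc |f s| * Real.exp (-(1 / 2 * s)) ≤ a * (1 + s) ^ n * Real.exp (-(1 / 2 * s)) := by
        gcongr; exact hf s hs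
    _ ≤ (|a| + 1) * ((1 + s) ^ n * Real.exp (-(1 / 2 * s))) := by
        rw [mul_assoc]; gcongr; linarith [le_abs_self a]
    _ ≤ _ := by gcongr; exact hb s hs.le

theorem integrableOn_exp_neg_half : IntegrableOn (fun s : ℝ => Real.exp (-s / 2)) (Ioi 0) := by
  have := integrableOn_exp_mul_Ioi (a := -(1 / 2)) (by norm_num) 0
  refine this.congr_fun (fun s _ => ?_) measurableSet_Ioi
  simp only
  ring_nf

theorem integrableOn_of_norm_le_exp {E : Type*} [NormedAddCommGroup E]
    {f : ℝ → E} (hf : ContinuousOn f (Ioi 0)) {K : ℝ}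
    (hb : ∀ s > 0, ‖f s‖ ≤ K * Real.exp (-s / 2)) : IntegrableOn f (Ioi 0) := by
  refine (integrableOn_exp_neg_half.const_mul K).mono'
    (hf.aestronglyMeasurable measurableSet_Ioi) ?_
  filter_upwards [ae_restrict_mem measurableSet_Ioi] with s hs using hb s hs

/-- The integral over the half-line of the derivative of a function vanishing at both ends. -/
theorem integral_Ioi_deriv_eq_zero {E : Type*} [NormedAddCommGroup E] [NormedSpace ℝ E]
    [CompleteSpace E] {f f' : ℝ → E}
    (hd : ∀ s > 0, HasDerivAt f (f' s) s) (hi : IntegrableOn f' (Ioi 0)) {K : ℝ}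
    (hb : ∀ s > 0, ‖f s‖ ≤ K * Real.sqrt s * Real.exp (-s / 2)) :
    ∫ s in Ioi 0, f' s = 0 := by
  -- Nothing is known about `f` at `0`. Extending by zero gives a function that is continuous at
  -- `0`, thanks to the factor `√s` in the bound.
  set g : ℝ → E := fun s => if 0 < s then f s else 0 with hg
  have hgb : ∀ s, ‖g s‖ ≤ K * Real.sqrt s * Real.exp (-s / 2) := by
    intro s
    by_cases h : 0 < s
    · simpa [hg, h] using hb s h
    · simp [hg, h, Real.sqrt_eq_zero_of_nonpos (not_lt.1 h)]
  have hgd : ∀ s ∈ Ioi (0 : ℝ), HasDerivAt g (f' s) s := by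
    intro s hs
    refine (hd s hs).congr_of_eventuallyEq ?_
    filter_upwards [Ioi_mem_nhds hs] with t ht
    simp [hg, mem_Ioi.1 ht]
  have h0 : g 0 = 0 := by simp [hg]
  have hcont : ContinuousWithinAt g (Ici 0) 0 := by
    refine ContinuousAt.continuousWithinAt ?_
    rw [ContinuousAt, h0]
    refine squeeze_zero_norm hgb ?_
    have : Continuous fun s : ℝ => K * Real.sqrt s * Real.exp (-s / 2) := by fun_prop
    simpa using this.tendsto 0
  have htop : Tendsto g atTop (𝓝 0) := by
    refine squeeze_zero_norm' (a := fun s => |K| * (s * Real.exp (-(1 / 2 * s)))) ?_ ?_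
    · filter_upwards [eventually_ge_atTop 1] with s hs
      refine (hgb s).trans ?_
      have h1 : Real.sqrt s ≤ s := by
        rw [Real.sqrt_le_left (by linarith)]; nlinarith
      have e : -s / 2 = -(1 / 2 * s) := by ring
      rw [e, mul_assoc]
      gcongr
      exact le_abs_self K
    · have h1 := ((Real.tendsto_pow_mul_exp_neg_atTop_nhds_zero 1).comp
        (tendsto_id.const_mul_atTop (show (0 : ℝ) < 1 / 2 by norm_num))).const_mul (|K| * 2)
      rw [mul_zero] at h1
      refine h1.congr fun s => ?_
      simp only [Function.comp, id, pow_one]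
      ring
  have := integral_Ioi_of_hasDerivAt_of_tendsto hcont hgd hi htop
  rw [this, h0, sub_zero]

/-! ### Radial eigenfunctions: energy and virial identities -/

/-- The radial profile `w` of an eigenfunction with angular momentum `k` and energy `N` of the
two-dimensional oscillator, as a function of `s = |z|²`, together with `v = s w'`. -/
structure RadialPair (k N : ℝ) (w v : ℝ → ℝ) : Prop where
  k_nonneg : 0 ≤ k
  one_le : 1 ≤ N
  hasDerivAt_w : ∀ s > 0, HasDerivAt w (v s / s) s
  hasDerivAt_v : ∀ s > 0, HasDerivAt v ((k ^ 2 / (4 * s) - (N - s)) * w s) s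
  bound : ∃ C : ℝ, 0 < C ∧ ∀ s > 0, |w s| ≤ C * Real.exp (-s / 2) ∧
    |v s| ≤ C * Real.sqrt s * Real.exp (-s / 2) ∧ k * |w s| ≤ C * Real.sqrt s * Real.exp (-s / 2)
  integral_sq_le : ∫ s in Ioi 0, w s ^ 2 ≤ 2

namespace RadialPair

variable {k N : ℝ} {w v : ℝ → ℝ}

theorem continuousOn_w (h : RadialPair k N w v) : ContinuousOn w (Ioi 0) :=
  fun s hs => (h.hasDerivAt_w s hs).continuousAt.continuousWithinAt

theorem continuousOn_v (h : RadialPair k N w v) : ContinuousOn v (Ioi 0) :=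
  fun s hs => (h.hasDerivAt_v s hs).continuousAt.continuousWithinAt

theorem exp_half_mul (s : ℝ) : Real.exp (-s / 2) * Real.exp (-s / 2) = Real.exp (-s) := by
  rw [← Real.exp_add]; ring_nf

/-- A quadratic expression `η F` with `|F| ≤ C exp(-s)` and `η` of polynomial growth is
integrable. -/
theorem integrableOn_of_exp {η F : ℝ → ℝ} (hη : PolyBdd η) (hc : ContinuousOn η (Ioi 0))
    (hF : ContinuousOn F (Ioi 0)) {C : ℝ} (hC : 0 < C)
    (hb : ∀ s > 0, |F s| ≤ C * Real.exp (-s)) : IntegrableOn (fun s => η s * F s) (Ioi 0) := by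
  obtain ⟨K, hK, hKb⟩ := hη.mul_exp_le
  refine integrableOn_of_norm_le_exp (K := C * K) (hc.mul hF) fun s hs => ?_
  rw [Real.norm_eq_abs, abs_mul]
  calc |η s| * |F s| ≤ |η s| * (C * Real.exp (-s)) := by gcongr; exact hb s hs
    _ = C * (|η s| * Real.exp (-s)) := by ring
    _ ≤ C * (K * Real.exp (-s / 2)) := mul_le_mul_of_nonneg_left (hKb s hs) hC.le
    _ = _ := by ring

/-- One constant for all quadratic expressions in the identities below: it gives integrability, and
the powers of `s` make the boundary terms vanish at the origin. -/
theorem bound_sq (h : RadialPair k N w v) : ∃ C : ℝ, 0 < C ∧ ∀ s > 0,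
    |w s ^ 2| ≤ C * Real.exp (-s) ∧ |w s * v s| ≤ C * Real.sqrt s * Real.exp (-s) ∧
    |v s ^ 2| ≤ C * s * Real.exp (-s) ∧ |v s ^ 2 / s| ≤ C * Real.exp (-s) ∧
    |k ^ 2 / (4 * s) * w s ^ 2| ≤ C * Real.exp (-s) ∧
    |k ^ 2 * w s ^ 2| ≤ C * s * Real.exp (-s) := by
  obtain ⟨C, hC, hb⟩ := h.bound
  refine ⟨C ^ 2, by positivity, fun s hs => ?_⟩
  obtain ⟨h1, h2, h3⟩ := hb s hs
  have e := exp_half_mul s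
  have es : Real.sqrt s * Real.sqrt s = s := Real.mul_self_sqrt hs.le
  have hw : w s ^ 2 ≤ C ^ 2 * Real.exp (-s) := by
    calc w s ^ 2 = |w s| ^ 2 := (sq_abs _).symm
      _ ≤ (C * Real.exp (-s / 2)) ^ 2 := by gcongr
      _ = _ := by rw [← e]; ring
  have hv : v s ^ 2 ≤ C ^ 2 * s * Real.exp (-s) := by
    calc v s ^ 2 = |v s| ^ 2 := (sq_abs _).symm
      _ ≤ (C * Real.sqrt s * Real.exp (-s / 2)) ^ 2 := by gcongr
      _ = C ^ 2 * (Real.sqrt s * Real.sqrt s) * (Real.exp (-s / 2) * Real.exp (-s / 2)) := by ring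
      _ = _ := by rw [e, es]
  have hkw : k ^ 2 * w s ^ 2 ≤ C ^ 2 * s * Real.exp (-s) := by
    calc k ^ 2 * w s ^ 2 = (k * |w s|) ^ 2 := by rw [mul_pow, sq_abs]
      _ ≤ (C * Real.sqrt s * Real.exp (-s / 2)) ^ 2 := by
          have := h.k_nonneg
          gcongr
      _ = C ^ 2 * (Real.sqrt s * Real.sqrt s) * (Real.exp (-s / 2) * Real.exp (-s / 2)) := by ring
      _ = _ := by rw [e, es]
  refine ⟨?_, ?_, ?_, ?_, ?_, ?_⟩
  · rwa [abs_of_nonneg (sq_nonneg _)]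
  · rw [abs_mul]
    calc |w s| * |v s| ≤ (C * Real.exp (-s / 2)) * (C * Real.sqrt s * Real.exp (-s / 2)) := by
          gcongr
      _ = C ^ 2 * Real.sqrt s * (Real.exp (-s / 2) * Real.exp (-s / 2)) := by ring
      _ = _ := by rw [e]
  · rwa [abs_of_nonneg (sq_nonneg _)]
  · rw [abs_of_nonneg (by positivity), div_le_iff₀ hs]
    linarith
  · rw [abs_of_nonneg (by positivity), div_mul_eq_mul_div, div_le_iff₀ (by positivity)]
    have : 0 ≤ C ^ 2 * s * Real.exp (-s) := by positivity
    linarith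
  · rwa [abs_of_nonneg (by positivity)]

variable (h : RadialPair k N w v)
include h

theorem integrableOn_w_sq {η : ℝ → ℝ} (hη : PolyBdd η) (hc : ContinuousOn η (Ioi 0)) :
    IntegrableOn (fun s => η s * w s ^ 2) (Ioi 0) := by
  obtain ⟨C, hC, hb⟩ := h.bound_sq
  exact integrableOn_of_exp hη hc (h.continuousOn_w.pow 2) hC fun s hs => (hb s hs).1

theorem integrableOn_v_sq {η : ℝ → ℝ} (hη : PolyBdd η) (hc : ContinuousOn η (Ioi 0)) :
    IntegrableOn (fun s => η s * (v s ^ 2 / s)) (Ioi 0) := by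
  obtain ⟨C, hC, hb⟩ := h.bound_sq
  exact integrableOn_of_exp hη hc ((h.continuousOn_v.pow 2).div continuousOn_id
    fun s hs => (ne_of_gt hs)) hC fun s hs => (hb s hs).2.2.2.1

theorem integrableOn_k_sq {η : ℝ → ℝ} (hη : PolyBdd η) (hc : ContinuousOn η (Ioi 0)) :
    IntegrableOn (fun s => η s * (k ^ 2 / (4 * s) * w s ^ 2)) (Ioi 0) := by
  obtain ⟨C, hC, hb⟩ := h.bound_sq
  refine integrableOn_of_exp hη hc (ContinuousOn.mul ?_ (h.continuousOn_w.pow 2)) hC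
    fun s hs => (hb s hs).2.2.2.2.1
  exact continuousOn_const.div (by fun_prop) fun s hs => by
    have : (0 : ℝ) < s := hs
    positivity

/-- The energy identity with weight `η`; `η₁ = η'` and `η₂ = (s η')'`. -/
theorem energy_identity {η η₁ η₂ : ℝ → ℝ} (h1 : ∀ s > 0, HasDerivAt η (η₁ s) s)
    (h2 : ∀ s > 0, HasDerivAt (fun s => s * η₁ s) (η₂ s) s)
    (hη : PolyBdd η) (hη₁ : PolyBdd η₁) (hη₂ : PolyBdd η₂)
    (hc₂ : ContinuousOn η₂ (Ioi 0)) :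
    (∫ s in Ioi 0, η s * (v s ^ 2 / s)) + ∫ s in Ioi 0, η s * (k ^ 2 / (4 * s) * w s ^ 2) =
      ∫ s in Ioi 0, (η s * (N - s) + η₂ s / 2) * w s ^ 2 := by
  have hc : ContinuousOn η (Ioi 0) := fun s hs => (h1 s hs).continuousAt.continuousWithinAt
  have i1 := h.integrableOn_v_sq hη hc
  have i2 := h.integrableOn_k_sq hη hc
  have hP : PolyBdd fun s => η s * (N - s) + η₂ s / 2 :=
    (hη.mul ((polyBdd_const N).sub polyBdd_id)).add (by
      simpa [div_eq_mul_inv] using hη₂.mul (polyBdd_const (2⁻¹)))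
  have i3 := h.integrableOn_w_sq hP (by fun_prop)
  obtain ⟨C, hC, hb⟩ := h.bound_sq
  obtain ⟨K, hK, hKb⟩ := hη.mul_exp_le
  obtain ⟨K', hK', hKb'⟩ := (hη₁.mul (polyBdd_const 1 |>.add polyBdd_id)).mul_exp_le
  -- Multiply the equation for `v'` by `ηw`. The cross term `η'wv = sη'(w²)'/2` is turned into
  -- `-(sη')'w²/2` by the second part of the primitive.
  have key := integral_Ioi_deriv_eq_zero (f := fun s => η s * (w s * v s) - s * η₁ s * w s ^ 2 / 2)
    (f' := fun s => (η s * (v s ^ 2 / s) + η s * (k ^ 2 / (4 * s) * w s ^ 2)) -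
      (η s * (N - s) + η₂ s / 2) * w s ^ 2) (K := C * K + C * K') ?_ ((i1.add i2).sub i3) ?_
  · have e1 := integral_add i1 i2
    have e2 := integral_sub (i1.add i2) i3
    simp only [Pi.add_apply] at e2
    linarith
  · intro s hs
    have hs' : s ≠ 0 := hs.ne'
    have := ((h1 s hs).mul ((h.hasDerivAt_w s hs).mul (h.hasDerivAt_v s hs))).sub
      (((h2 s hs).mul ((h.hasDerivAt_w s hs).pow 2)).div_const 2)
    refine this.congr_deriv ?_
    simp only [Pi.pow_apply, Pi.mul_apply]
    field_simp
    ring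
  · intro s hs
    obtain ⟨b1, b2, b3, b4, b5, b6⟩ := hb s hs
    -- A full power of `s` is traded for the `√s` required at the origin; the factor `1 + s` goes
    -- into the polynomial growth.
    have hr : s ≤ Real.sqrt s * (1 + s) := by
      have e1 := Real.mul_self_sqrt hs.le
      have e2 := Real.sqrt_nonneg s
      nlinarith [sq_nonneg (Real.sqrt s - 1)]
    have hsq := Real.sqrt_nonneg s
    rw [Real.norm_eq_abs]
    calc |η s * (w s * v s) - s * η₁ s * w s ^ 2 / 2|
        ≤ |η s * (w s * v s)| + |s * η₁ s * w s ^ 2 / 2| := abs_sub _ _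
      _ = |η s| * |w s * v s| + s * |η₁ s| * |w s ^ 2| / 2 := by
          rw [abs_mul (η s), abs_div, abs_mul (s * η₁ s), abs_mul s, abs_of_pos hs, abs_two]
      _ ≤ |η s| * (C * Real.sqrt s * Real.exp (-s)) +
          Real.sqrt s * (1 + s) * |η₁ s| * (C * Real.exp (-s)) := by
          have : 0 ≤ s * |η₁ s| * |w s ^ 2| := by positivity
          have h3 : s * |η₁ s| * |w s ^ 2| ≤
              Real.sqrt s * (1 + s) * |η₁ s| * (C * Real.exp (-s)) := by gcongr
          have h4 : |η s| * |w s * v s| ≤ |η s| * (C * Real.sqrt s * Real.exp (-s)) := by gcongr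
          linarith
      _ = C * Real.sqrt s * (|η s| * Real.exp (-s)) +
          C * Real.sqrt s * (|η₁ s * (1 + s)| * Real.exp (-s)) := by
          rw [abs_mul (η₁ s), abs_of_pos (show 0 < 1 + s by linarith)]; ring
      _ ≤ C * Real.sqrt s * (K * Real.exp (-s / 2)) +
          C * Real.sqrt s * (K' * Real.exp (-s / 2)) :=
          add_le_add (mul_le_mul_of_nonneg_left (hKb s hs) (by positivity))
            (mul_le_mul_of_nonneg_left (hKb' s hs) (by positivity))
      _ = _ := by ring

/-- The virial identity with weight `η`; `η₁ = η'`, `η₂ = (s η')'` and `η₃ = (s (s η')')'`. -/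
theorem virial_identity {η η₁ η₂ η₃ : ℝ → ℝ} (h1 : ∀ s > 0, HasDerivAt η (η₁ s) s)
    (h2 : ∀ s > 0, HasDerivAt (fun s => s * η₁ s) (η₂ s) s)
    (h3 : ∀ s > 0, HasDerivAt (fun s => s * η₂ s) (η₃ s) s)
    (hη : PolyBdd η) (hη₁ : PolyBdd η₁) (hη₂ : PolyBdd η₂) (hη₃ : PolyBdd η₃)
    (hc₁ : ContinuousOn η₁ (Ioi 0)) (hc₃ : ContinuousOn η₃ (Ioi 0)) :
    ∫ s in Ioi 0, (2 * η₁ s * (k ^ 2 / 4 - s * (N - s)) + η s * (2 * s - N) - η₃ s / 2) *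
      w s ^ 2 = 0 := by
  have hc : ContinuousOn η (Ioi 0) := fun s hs => (h1 s hs).continuousAt.continuousWithinAt
  have hNs : PolyBdd fun s => N - s := (polyBdd_const N).sub polyBdd_id
  have hP : PolyBdd fun s => 2 * η₁ s * (k ^ 2 / 4 - s * (N - s)) + η s * (2 * s - N) - η₃ s / 2 := by
    refine PolyBdd.sub (PolyBdd.add ?_ ?_) ?_
    · exact ((polyBdd_const 2).mul hη₁).mul ((polyBdd_const _).sub (polyBdd_id.mul hNs))
    · exact hη.mul (((polyBdd_const 2).mul polyBdd_id).sub (polyBdd_const N))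
    · simpa [div_eq_mul_inv] using hη₃.mul (polyBdd_const (2⁻¹))
  have i := h.integrableOn_w_sq hP (by fun_prop)
  obtain ⟨C, hC, hb⟩ := h.bound_sq
  have P1 : PolyBdd fun s => (1 + s) * (|η s| * (1 + |N - s|) + s * |η₁ s| + |η₂ s|) :=
    ((polyBdd_const 1).add polyBdd_id).mul <| PolyBdd.add (PolyBdd.add
      (PolyBdd.mul (hη.of_le fun s _ => by simp) ((polyBdd_const 1).add
        (hNs.of_le fun s _ => by simp)))
      (polyBdd_id.mul (hη₁.of_le fun s _ => by simp))) (hη₂.of_le fun s _ => by simp)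
  obtain ⟨L, hL, hLb⟩ := P1.mul_exp_le
  -- With `q = k²/4 - s(N-s)`, the equation reads `s v' = q w`, so `(ηv² - ηqw²)'` contains `v²`
  -- only through `η'v²`. This term is removed by subtracting the primitive `sη'wv`, and the
  -- remaining `(sη')'wv` becomes a third-order term in `w²` as in the energy identity. No
  -- derivative of `w` survives.
  have key := integral_Ioi_deriv_eq_zero
    (f := fun s => -(η s * v s ^ 2 - η s * (k ^ 2 / 4 - s * (N - s)) * w s ^ 2 -
      s * η₁ s * (w s * v s) + s * η₂ s * w s ^ 2 / 2))
    (f' := fun s => (2 * η₁ s * (k ^ 2 / 4 - s * (N - s)) + η s * (2 * s - N) - η₃ s / 2) *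
      w s ^ 2) (K := 3 * C * L) ?_ i ?_
  · exact key
  · intro s hs
    have hs' : s ≠ 0 := hs.ne'
    have hq : HasDerivAt (fun s : ℝ => k ^ 2 / 4 - s * (N - s)) (2 * s - N) s := by
      have := ((hasDerivAt_id s).mul ((hasDerivAt_id s).const_sub N)).const_sub (k ^ 2 / 4)
      refine this.congr_deriv ?_
      simp only [id]; ring
    have hw2 := (h.hasDerivAt_w s hs).pow 2
    have hv2 := (h.hasDerivAt_v s hs).pow 2
    have hwv := (h.hasDerivAt_w s hs).mul (h.hasDerivAt_v s hs)
    have := (((((h1 s hs).mul hv2).sub (((h1 s hs).mul hq).mul hw2)).sub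
      ((h2 s hs).mul hwv)).add (((h3 s hs).mul hw2).div_const 2)).neg
    refine this.congr_deriv ?_
    simp only [Pi.pow_apply, Pi.mul_apply]
    field_simp
    ring
  · intro s hs
    obtain ⟨b1, b2, b3, b4, b5, b6⟩ := hb s hs
    have hr : s ≤ Real.sqrt s * (1 + s) := by
      have e1 := Real.mul_self_sqrt hs.le
      have e2 := Real.sqrt_nonneg s
      nlinarith [sq_nonneg (Real.sqrt s - 1)]
    have hsq := Real.sqrt_nonneg s
    have hx := abs_nonneg (N - s)
    set E := Real.exp (-s) with hE
    have hE0 : 0 < E := Real.exp_pos _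
    have t1 : |η s * v s ^ 2| ≤ |η s| * (C * s * E) := by rw [abs_mul]; gcongr
    have t2 : |η s * (k ^ 2 / 4 - s * (N - s)) * w s ^ 2| ≤
        |η s| * (C * s * E + s * |N - s| * (C * E)) := by
      rw [mul_assoc, abs_mul]
      gcongr
      calc |(k ^ 2 / 4 - s * (N - s)) * w s ^ 2|
          = |k ^ 2 * w s ^ 2 / 4 - s * (N - s) * w s ^ 2| := by congr 1; ring
        _ ≤ |k ^ 2 * w s ^ 2 / 4| + |s * (N - s) * w s ^ 2| := abs_sub _ _
        _ = |k ^ 2 * w s ^ 2| / 4 + s * |N - s| * |w s ^ 2| := by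
            rw [abs_div, abs_mul (s * (N - s)), abs_mul s, abs_of_pos hs]
            norm_num
        _ ≤ _ := by
            have : 0 ≤ |k ^ 2 * w s ^ 2| := abs_nonneg _
            gcongr
            linarith
    have t3 : |s * η₁ s * (w s * v s)| ≤ s * |η₁ s| * (C * Real.sqrt s * E) := by
      rw [abs_mul, abs_mul, abs_of_pos hs]; gcongr
    have t4 : |s * η₂ s * w s ^ 2 / 2| ≤ s * |η₂ s| * (C * E) := by
      rw [abs_div, abs_mul, abs_mul, abs_of_pos hs, abs_two]
      have : s * |η₂ s| * |w s ^ 2| ≤ s * |η₂ s| * (C * E) := by gcongr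
      have : 0 ≤ s * |η₂ s| * |w s ^ 2| := by positivity
      linarith
    rw [Real.norm_eq_abs, abs_neg]
    have hLs := hLb s hs
    rw [abs_of_nonneg (by positivity)] at hLs
    have hA : 0 ≤ |η s| := abs_nonneg _
    calc _ ≤ |η s * v s ^ 2| + |η s * (k ^ 2 / 4 - s * (N - s)) * w s ^ 2| +
          |s * η₁ s * (w s * v s)| + |s * η₂ s * w s ^ 2 / 2| :=
          (abs_add_le _ _).trans (add_le_add_left
            ((abs_sub _ _).trans (add_le_add_left (abs_sub _ _) _)) _)
      _ ≤ |η s| * (C * s * E) + |η s| * (C * s * E + s * |N - s| * (C * E)) +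
          s * |η₁ s| * (C * Real.sqrt s * E) + s * |η₂ s| * (C * E) := by linarith
      _ = C * E * (s * (2 * |η s| + |η s| * |N - s| + |η₂ s|) +
          Real.sqrt s * (s * |η₁ s|)) := by ring
      _ ≤ C * E * (Real.sqrt s * (1 + s) * (2 * |η s| + |η s| * |N - s| + |η₂ s|) +
          Real.sqrt s * ((1 + s) * (s * |η₁ s|))) := by
          have h1 : s * |η₁ s| ≤ (1 + s) * (s * |η₁ s|) := by
            have : 0 ≤ s * (s * |η₁ s|) := by positivity
            linarith
          have h2 := mul_le_mul_of_nonneg_left h1 hsq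
          have h3 : s * (2 * |η s| + |η s| * |N - s| + |η₂ s|) ≤
            Real.sqrt s * (1 + s) * (2 * |η s| + |η s| * |N - s| + |η₂ s|) := by gcongr
          exact mul_le_mul_of_nonneg_left (add_le_add h3 h2) (by positivity)
      _ ≤ C * E * (2 * (Real.sqrt s * ((1 + s) * (|η s| * (1 + |N - s|) + s * |η₁ s| +
          |η₂ s|)))) := by
          gcongr
          have : 0 ≤ Real.sqrt s * (1 + s) * (|η s| * |N - s| + s * |η₁ s| + |η₂ s|) := by
            positivity
          nlinarith
      _ = 2 * C * Real.sqrt s * ((1 + s) * (|η s| * (1 + |N - s|) + s * |η₁ s| +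
          |η₂ s|) * E) := by ring
      _ ≤ 2 * C * Real.sqrt s * (L * Real.exp (-s / 2)) := by gcongr
      _ ≤ 3 * C * L * Real.sqrt s * Real.exp (-s / 2) := by
          have : 0 ≤ C * L * Real.sqrt s * Real.exp (-s / 2) := by positivity
          linarith

end RadialPair

/-! ### The weight at the turning point and its derivatives -/

/-- The weight `(Y⁸ + (N - s)²)^(-1/8)`, which measures the distance to the turning point. -/
noncomputable def turnWeight (Y N s : ℝ) : ℝ := (Y ^ 8 + (N - s) ^ 2) ^ (-(1 / 8) : ℝ)

section turnWeight

variable {Y N : ℝ} (hY : 0 < Y)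
include hY

theorem turnWeight_base_pos (s : ℝ) : 0 < Y ^ 8 + (N - s) ^ 2 := by positivity

theorem turnWeight_pos (s : ℝ) : 0 < turnWeight Y N s :=
  Real.rpow_pos_of_pos (turnWeight_base_pos hY s) _

/-- The source of all bounds on `ψ`: each factor `|N-s|` costs `ψ⁴` and each factor `Y` costs `ψ`.
The eighth root makes every power needed later, down to `|N-s|^{-1/4}`, an integer power of `ψ`. -/
theorem turnWeight_pow_eight (s : ℝ) : turnWeight Y N s ^ 8 * (Y ^ 8 + (N - s) ^ 2) = 1 := by
  have h := turnWeight_base_pos (N := N) hY s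
  rw [turnWeight, ← Real.rpow_natCast, ← Real.rpow_mul h.le]
  norm_num
  rw [Real.rpow_neg_one, inv_mul_cancel₀ h.ne']

/-- Differentiation stays within polynomials in `s`, `N-s` and `ψ`, so higher derivatives need only
a computation with monomials. -/
theorem hasDerivAt_turnWeight (s : ℝ) :
    HasDerivAt (turnWeight Y N) ((N - s) / 4 * turnWeight Y N s ^ 9) s := by
  have h := turnWeight_base_pos (N := N) hY s
  have h1 : HasDerivAt (fun s => Y ^ 8 + (N - s) ^ 2) (-(2 * (N - s))) s := by
    have := (((hasDerivAt_id s).const_sub N).pow 2).const_add (Y ^ 8)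
    refine this.congr_deriv ?_
    simp
  have h2 := h1.rpow_const (p := (-(1 / 8) : ℝ)) (Or.inl h.ne')
  refine h2.congr_deriv ?_
  have e : turnWeight Y N s ^ 9 = (Y ^ 8 + (N - s) ^ 2) ^ (-(1 / 8) - 1 : ℝ) := by
    rw [turnWeight, ← Real.rpow_natCast, ← Real.rpow_mul h.le]
    norm_num
  rw [e]
  ring

theorem continuous_turnWeight : Continuous (turnWeight Y N) :=
  continuous_iff_continuousAt.2 fun s => (hasDerivAt_turnWeight hY s).continuousAt

theorem sq_mul_turnWeight_le (s : ℝ) : (N - s) ^ 2 * turnWeight Y N s ^ 8 ≤ 1 := by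
  have := turnWeight_pow_eight (N := N) hY s
  have : 0 ≤ turnWeight Y N s ^ 8 * Y ^ 8 := by
    have := turnWeight_pos (N := N) hY s
    positivity
  linarith

theorem abs_mul_turnWeight_le (s : ℝ) : |N - s| * turnWeight Y N s ^ 4 ≤ 1 := by
  have h := sq_mul_turnWeight_le (N := N) hY s
  have h0 := turnWeight_pos (N := N) hY s
  rw [← abs_of_nonneg (show 0 ≤ |N - s| * turnWeight Y N s ^ 4 by positivity)]
  rw [← sq_le_one_iff_abs_le_one, mul_pow, sq_abs]
  calc _ = (N - s) ^ 2 * turnWeight Y N s ^ 8 := by ring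
    _ ≤ 1 := h

theorem mul_turnWeight_le_one (s : ℝ) : Y * turnWeight Y N s ≤ 1 := by
  have h := turnWeight_pow_eight (N := N) hY s
  have h0 := turnWeight_pos (N := N) hY s
  have h1 : (Y * turnWeight Y N s) ^ 8 ≤ 1 := by
    have : 0 ≤ turnWeight Y N s ^ 8 * (N - s) ^ 2 := by positivity
    rw [mul_pow]; linarith
  exact (pow_le_one_iff_of_nonneg (by positivity) (by norm_num)).1 h1

theorem polyBdd_turnWeight : PolyBdd (turnWeight Y N) :=
  ⟨1 / Y, 0, fun s _ => by
    rw [abs_of_pos (turnWeight_pos hY s), pow_zero, mul_one, le_div_iff₀ hY, mul_comm]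
    exact mul_turnWeight_le_one hY s⟩

/-- The derivative of the monomial `s^a x^b ψ^p` where `x = N - s` and `ψ` is the weight. -/
theorem hasDerivAt_turnMonomial (c : ℝ) (a b p : ℕ) (s : ℝ) :
    HasDerivAt (fun s => c * s ^ a * (N - s) ^ b * turnWeight Y N s ^ p)
      (c * (a * s ^ (a - 1) * (N - s) ^ b * turnWeight Y N s ^ p -
        s ^ a * (b * (N - s) ^ (b - 1)) * turnWeight Y N s ^ p +
        p / 4 * s ^ a * (N - s) ^ (b + 1) * turnWeight Y N s ^ (p + 8))) s := by
  have h1 := ((hasDerivAt_id s).pow a).const_mul c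
  have h2 := ((hasDerivAt_id s).const_sub N).pow b
  have h3 := (hasDerivAt_turnWeight (N := N) hY s).pow p
  refine ((h1.mul h2).mul h3).congr_deriv ?_
  simp only [id, Pi.pow_apply, Pi.mul_apply]
  rcases p with _ | p
  · simp; ring
  · simp only [Nat.add_sub_cancel]; push_cast; ring

theorem polyBdd_turnMonomial (c : ℝ) (a b p : ℕ) :
    PolyBdd fun s => c * s ^ a * (N - s) ^ b * turnWeight Y N s ^ p :=
  (((polyBdd_const c).mul (polyBdd_id.pow a)).mul
    (((polyBdd_const N).sub polyBdd_id).pow b)).mul ((polyBdd_turnWeight hY).pow p)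

end turnWeight

/-- `s (ψ^p)'' + (ψ^p)'`. -/
noncomputable def turnSecond (Y N : ℝ) (p : ℕ) (s : ℝ) : ℝ :=
  p / 4 * ((N - s) * turnWeight Y N s ^ (p + 8) - s * turnWeight Y N s ^ (p + 8) +
    (p + 8) / 4 * s * (N - s) ^ 2 * turnWeight Y N s ^ (p + 16))

/-- The third order expression `(s (s (ψ^p)')')'`. -/
noncomputable def turnThird (Y N : ℝ) (p : ℕ) (s : ℝ) : ℝ :=
  p / 4 * ((N - s) * turnWeight Y N s ^ (p + 8) - 3 * s * turnWeight Y N s ^ (p + 8) +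
    3 * (p + 8) / 4 * s * (N - s) ^ 2 * turnWeight Y N s ^ (p + 16) -
    3 * (p + 8) / 4 * s ^ 2 * (N - s) * turnWeight Y N s ^ (p + 16) +
    (p + 8) * (p + 16) / 16 * s ^ 2 * (N - s) ^ 3 * turnWeight Y N s ^ (p + 24))

section derivs

variable {Y N : ℝ} (hY : 0 < Y)
include hY

theorem hasDerivAt_turnWeight_pow (p : ℕ) (s : ℝ) :
    HasDerivAt (fun s => turnWeight Y N s ^ p)
      (p / 4 * (N - s) * turnWeight Y N s ^ (p + 8)) s := by
  have := hasDerivAt_turnMonomial (N := N) hY 1 0 0 p s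
  simp only [one_mul, pow_zero] at this
  refine this.congr_deriv ?_
  simp

theorem hasDerivAt_turnFirst (p : ℕ) (s : ℝ) :
    HasDerivAt (fun s => s * (p / 4 * (N - s) * turnWeight Y N s ^ (p + 8)))
      (turnSecond Y N p s) s := by
  have := hasDerivAt_turnMonomial (N := N) hY (p / 4) 1 1 (p + 8) s
  refine (this.congr_of_eventuallyEq (Eventually.of_forall fun s => ?_)).congr_deriv ?_
  · simp only; ring
  · rw [turnSecond]; push_cast; ring

theorem hasDerivAt_turnSecond (p : ℕ) (s : ℝ) :
    HasDerivAt (fun s => s * turnSecond Y N p s) (turnThird Y N p s) s := by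
  have h1 := hasDerivAt_turnMonomial (N := N) hY (p / 4) 1 1 (p + 8) s
  have h2 := hasDerivAt_turnMonomial (N := N) hY (p / 4) 2 0 (p + 8) s
  have h3 := hasDerivAt_turnMonomial (N := N) hY (p / 4 * ((p + 8) / 4)) 2 2 (p + 16) s
  refine (((h1.sub h2).add h3).congr_of_eventuallyEq
    (Eventually.of_forall fun s => ?_)).congr_deriv ?_
  · simp only [turnSecond, Pi.add_apply, Pi.sub_apply]; ring
  · rw [turnThird]; push_cast; ring

theorem polyBdd_turnFirst (p : ℕ) :
    PolyBdd fun s => p / 4 * (N - s) * turnWeight Y N s ^ (p + 8) := by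
  simpa using polyBdd_turnMonomial (N := N) hY (p / 4) 0 1 (p + 8)

theorem polyBdd_turnSecond (p : ℕ) : PolyBdd (turnSecond Y N p) := by
  have hx : PolyBdd fun s => N - s := (polyBdd_const N).sub polyBdd_id
  have hψ := polyBdd_turnWeight (N := N) hY
  exact (polyBdd_const _).mul (((hx.mul (hψ.pow _)).sub (polyBdd_id.mul (hψ.pow _))).add
    ((((polyBdd_const _).mul polyBdd_id).mul (hx.pow 2)).mul (hψ.pow _)))

theorem polyBdd_turnThird (p : ℕ) : PolyBdd (turnThird Y N p) := by
  have hx : PolyBdd fun s => N - s := (polyBdd_const N).sub polyBdd_id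
  have hψ := polyBdd_turnWeight (N := N) hY
  exact (polyBdd_const _).mul (((((hx.mul (hψ.pow _)).sub
    (((polyBdd_const _).mul polyBdd_id).mul (hψ.pow _))).add
    ((((polyBdd_const _).mul polyBdd_id).mul (hx.pow 2)).mul (hψ.pow _))).sub
    ((((polyBdd_const _).mul (polyBdd_id.pow 2)).mul hx).mul (hψ.pow _))).add
    ((((polyBdd_const _).mul (polyBdd_id.pow 2)).mul (hx.pow 3)).mul (hψ.pow _)))

theorem continuous_turnSecond (p : ℕ) : Continuous (turnSecond Y N p) := by
  have := continuous_turnWeight (N := N) hY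
  unfold turnSecond
  fun_prop

theorem continuous_turnThird (p : ℕ) : Continuous (turnThird Y N p) := by
  have := continuous_turnWeight (N := N) hY
  unfold turnThird
  fun_prop

/-- An upper bound is enough for the energy estimate, so the negative term is dropped. Elsewhere
`|N-s|ψ⁴ ≤ 1`, together with `s ≤ N + |N-s|`. -/
theorem turnSecond_le (p : ℕ) {s : ℝ} (hs : 0 < s) :
    turnSecond Y N p s ≤ p / 4 * (turnWeight Y N s ^ (p + 4) +
      (p + 8) / 4 * (N * turnWeight Y N s ^ (p + 8) + turnWeight Y N s ^ (p + 4))) := by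
  set ψ := turnWeight Y N s with hψ
  have h0 : 0 < ψ := turnWeight_pos hY s
  have hx : |N - s| * ψ ^ 4 ≤ 1 := abs_mul_turnWeight_le hY s
  have hx2 : (N - s) ^ 2 * ψ ^ 8 ≤ 1 := sq_mul_turnWeight_le hY s
  have hsN : s ≤ N + |N - s| := by linarith [neg_abs_le (N - s)]
  rw [turnSecond, ← hψ]
  have e1 : (N - s) * ψ ^ (p + 8) ≤ ψ ^ (p + 4) := by
    calc (N - s) * ψ ^ (p + 8) ≤ |N - s| * ψ ^ (p + 8) := by gcongr; exact le_abs_self _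
      _ = ψ ^ (p + 4) * (|N - s| * ψ ^ 4) := by ring
      _ ≤ ψ ^ (p + 4) * 1 := by gcongr
      _ = _ := mul_one _
  have e2 : 0 ≤ s * ψ ^ (p + 8) := by positivity
  have e3 : s * (N - s) ^ 2 * ψ ^ (p + 16) ≤ N * ψ ^ (p + 8) + ψ ^ (p + 4) := by
    calc s * (N - s) ^ 2 * ψ ^ (p + 16) = s * ψ ^ (p + 8) * ((N - s) ^ 2 * ψ ^ 8) := by ring
      _ ≤ s * ψ ^ (p + 8) * 1 := by gcongr
      _ ≤ (N + |N - s|) * ψ ^ (p + 8) := by rw [mul_one]; gcongr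
      _ = N * ψ ^ (p + 8) + ψ ^ (p + 4) * (|N - s| * ψ ^ 4) := by ring
      _ ≤ N * ψ ^ (p + 8) + ψ ^ (p + 4) * 1 := by gcongr
      _ = _ := by ring
  have e4 : ((p : ℝ) + 8) / 4 * s * (N - s) ^ 2 * ψ ^ (p + 16) ≤
      (p + 8) / 4 * (N * ψ ^ (p + 8) + ψ ^ (p + 4)) := by
    calc _ = ((p : ℝ) + 8) / 4 * (s * (N - s) ^ 2 * ψ ^ (p + 16)) := by ring
      _ ≤ _ := by gcongr
  gcongr
  linarith

/-- The same absorption, now two-sided. With `p ≤ 4` the numerical coefficients are at most `3, 9,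
9, 15`, whence `36 = 3+9+9+15` and `24 = 9+15`. -/
theorem abs_turnThird_le (hN : 0 ≤ N) {p : ℕ} (hp : p ≤ 4) {s : ℝ} (hs : 0 < s) :
    |turnThird Y N p s| ≤ turnWeight Y N s ^ (p + 4) + 36 * s * turnWeight Y N s ^ (p + 8) +
      24 * s * N * turnWeight Y N s ^ (p + 12) := by
  set ψ := turnWeight Y N s with hψ
  have h0 : 0 < ψ := turnWeight_pos hY s
  have hx : |N - s| * ψ ^ 4 ≤ 1 := abs_mul_turnWeight_le hY s
  have hx2 : (N - s) ^ 2 * ψ ^ 8 ≤ 1 := sq_mul_turnWeight_le hY s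
  have hsN : s ≤ N + |N - s| := by linarith [neg_abs_le (N - s)]
  have hp' : (p : ℝ) ≤ 4 := by exact_mod_cast hp
  have hp0 : (0 : ℝ) ≤ p := Nat.cast_nonneg p
  have e1 : |(N - s) * ψ ^ (p + 8)| ≤ ψ ^ (p + 4) := by
    rw [abs_mul, abs_of_pos (pow_pos h0 _)]
    calc |N - s| * ψ ^ (p + 8) = ψ ^ (p + 4) * (|N - s| * ψ ^ 4) := by ring
      _ ≤ ψ ^ (p + 4) * 1 := by gcongr
      _ = _ := mul_one _
  have e3 : |s * (N - s) ^ 2 * ψ ^ (p + 16)| ≤ s * ψ ^ (p + 8) := by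
    rw [abs_of_nonneg (by positivity)]
    calc s * (N - s) ^ 2 * ψ ^ (p + 16) = s * ψ ^ (p + 8) * ((N - s) ^ 2 * ψ ^ 8) := by ring
      _ ≤ s * ψ ^ (p + 8) * 1 := by gcongr
      _ = _ := mul_one _
  have e4 : s ^ 2 * ψ ^ (p + 12) ≤ s * N * ψ ^ (p + 12) + s * ψ ^ (p + 8) := by
    calc s ^ 2 * ψ ^ (p + 12) = s * s * ψ ^ (p + 12) := by ring
      _ ≤ s * (N + |N - s|) * ψ ^ (p + 12) := by gcongr
      _ = s * N * ψ ^ (p + 12) + s * ψ ^ (p + 8) * (|N - s| * ψ ^ 4) := by ring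
      _ ≤ s * N * ψ ^ (p + 12) + s * ψ ^ (p + 8) * 1 := by gcongr
      _ = _ := by ring
  have e5 : |s ^ 2 * (N - s) * ψ ^ (p + 16)| ≤ s * N * ψ ^ (p + 12) + s * ψ ^ (p + 8) := by
    rw [abs_mul, abs_mul, abs_of_pos (pow_pos h0 _), abs_of_nonneg (sq_nonneg s)]
    calc s ^ 2 * |N - s| * ψ ^ (p + 16) = s ^ 2 * ψ ^ (p + 12) * (|N - s| * ψ ^ 4) := by ring
      _ ≤ s ^ 2 * ψ ^ (p + 12) * 1 := by gcongr
      _ ≤ _ := by rw [mul_one]; exact e4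
  have e6 : |s ^ 2 * (N - s) ^ 3 * ψ ^ (p + 24)| ≤ s * N * ψ ^ (p + 12) + s * ψ ^ (p + 8) := by
    rw [abs_mul, abs_mul, abs_of_pos (pow_pos h0 _), abs_of_nonneg (sq_nonneg s), abs_pow]
    have : |N - s| ^ 3 * ψ ^ 12 ≤ 1 := by
      calc |N - s| ^ 3 * ψ ^ 12 = (|N - s| * ψ ^ 4) ^ 3 := by ring
        _ ≤ 1 := pow_le_one₀ (by positivity) hx
    calc s ^ 2 * |N - s| ^ 3 * ψ ^ (p + 24) = s ^ 2 * ψ ^ (p + 12) * (|N - s| ^ 3 * ψ ^ 12) := by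
          ring
      _ ≤ s ^ 2 * ψ ^ (p + 12) * 1 := by gcongr
      _ ≤ _ := by rw [mul_one]; exact e4
  set a1 := (N - s) * ψ ^ (p + 8)
  set a2 := s * ψ ^ (p + 8) with ha2
  set a3 := s * (N - s) ^ 2 * ψ ^ (p + 16)
  set a4 := s ^ 2 * (N - s) * ψ ^ (p + 16)
  set a5 := s ^ 2 * (N - s) ^ 3 * ψ ^ (p + 24)
  set a6 := s * N * ψ ^ (p + 12) with ha6
  have h2 : 0 ≤ a2 := by positivity
  have h6 : 0 ≤ a6 := by positivity
  have ee : turnThird Y N p s = p / 4 * (a1 - 3 * a2 + 3 * (p + 8) / 4 * a3 -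
      3 * (p + 8) / 4 * a4 + (p + 8) * (p + 16) / 16 * a5) := by
    rw [turnThird, ← hψ]; ring
  have c1 : 3 * ((p : ℝ) + 8) / 4 ≤ 9 := by linarith
  have c2 : ((p : ℝ) + 8) * (p + 16) / 16 ≤ 15 := by nlinarith
  have b3 : |3 * ((p : ℝ) + 8) / 4 * a3| ≤ 9 * a2 := by
    rw [abs_mul, abs_of_nonneg (by positivity)]
    gcongr
  have b4 : |3 * ((p : ℝ) + 8) / 4 * a4| ≤ 9 * (a6 + a2) := by
    rw [abs_mul, abs_of_nonneg (by positivity)]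
    gcongr
  have b5 : |((p : ℝ) + 8) * (p + 16) / 16 * a5| ≤ 15 * (a6 + a2) := by
    rw [abs_mul, abs_of_nonneg (by positivity)]
    gcongr
  have b : |a1 - 3 * a2 + 3 * (p + 8) / 4 * a3 -
      3 * (p + 8) / 4 * a4 + (p + 8) * (p + 16) / 16 * a5| ≤ ψ ^ (p + 4) + 36 * a2 + 24 * a6 := by
    rw [abs_le] at e1 b3 b4 b5 ⊢
    constructor <;> linarith [e1.1, e1.2, b3.1, b3.2, b4.1, b4.2, b5.1, b5.2]
  rw [ee, abs_mul, abs_of_nonneg (by positivity)]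
  calc _ ≤ 1 * (ψ ^ (p + 4) + 36 * a2 + 24 * a6) := by
        gcongr
        linarith
    _ = _ := by rw [ha2, ha6]; ring

end derivs

/-! ### Moments of the radial density and its mass near the turning point -/

namespace RadialPair

variable {k N t : ℝ} {w v : ℝ → ℝ}

theorem energy_one (h : RadialPair k N w v) :
    (∫ s in Ioi 0, v s ^ 2 / s) + ∫ s in Ioi 0, k ^ 2 / (4 * s) * w s ^ 2 =
      ∫ s in Ioi 0, (N - s) * w s ^ 2 := by
  have := h.energy_identity (η := fun _ => 1) (η₁ := fun _ => 0) (η₂ := fun _ => 0)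
    (fun s _ => hasDerivAt_const s 1) (fun s _ => by simpa using hasDerivAt_const s (0 : ℝ))
    (polyBdd_const 1) (polyBdd_const 0) (polyBdd_const 0) continuousOn_const
  simpa using this

theorem integrableOn_sq (h : RadialPair k N w v) : IntegrableOn (fun s => w s ^ 2) (Ioi 0) := by
  simpa using h.integrableOn_w_sq (polyBdd_const 1) continuousOn_const

theorem integrableOn_id_mul_sq (h : RadialPair k N w v) :
    IntegrableOn (fun s => s * w s ^ 2) (Ioi 0) :=
  h.integrableOn_w_sq polyBdd_id continuousOn_id

theorem integral_potential_eq (h : RadialPair k N w v) :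
    ∫ s in Ioi 0, (N - s) * w s ^ 2 =
      N * (∫ s in Ioi 0, w s ^ 2) - ∫ s in Ioi 0, s * w s ^ 2 := by
  rw [← integral_const_mul, ← integral_sub (h.integrableOn_sq.const_mul N) h.integrableOn_id_mul_sq]
  congr 1
  ext s
  ring

theorem integral_v_sq_nonneg {η : ℝ → ℝ} (hη : ∀ s, 0 ≤ η s) :
    0 ≤ ∫ s in Ioi 0, η s * (v s ^ 2 / s) :=
  setIntegral_nonneg measurableSet_Ioi fun s hs => by
    have := hη s
    have : (0 : ℝ) < s := hs
    positivity

theorem integral_k_sq_nonneg {η : ℝ → ℝ} (hη : ∀ s > 0, 0 ≤ η s) :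
    0 ≤ ∫ s in Ioi 0, η s * (k ^ 2 / (4 * s) * w s ^ 2) :=
  setIntegral_nonneg measurableSet_Ioi fun s hs => by
    have := hη s hs
    have : (0 : ℝ) < s := hs
    positivity

theorem integral_id_mul_sq_nonneg : 0 ≤ ∫ s in Ioi 0, s * w s ^ 2 :=
  setIntegral_nonneg measurableSet_Ioi fun s hs => by
    have : (0 : ℝ) < s := hs
    positivity

/-- Kinetic and centrifugal energies are nonnegative, so the mean of `N - s` is nonnegative. -/
theorem integral_id_mul_sq_le (h : RadialPair k N w v) : ∫ s in Ioi 0, s * w s ^ 2 ≤ 2 * N := by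
  have h1 := h.energy_one
  have h2 := integral_v_sq_nonneg (v := v) (η := fun _ => 1) (fun _ => zero_le_one)
  have h3 := integral_k_sq_nonneg (k := k) (w := w) (η := fun _ => 1) (fun _ _ => zero_le_one)
  simp only [one_mul] at h2 h3
  rw [h.integral_potential_eq] at h1
  have := h.integral_sq_le
  have := h.one_le
  nlinarith

theorem integral_v_sq_add_le (h : RadialPair k N w v) :
    (∫ s in Ioi 0, v s ^ 2 / s) + ∫ s in Ioi 0, k ^ 2 / (4 * s) * w s ^ 2 ≤ 2 * N := by
  rw [h.energy_one, h.integral_potential_eq]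
  have := h.integral_sq_le
  have := h.one_le
  have := integral_id_mul_sq_nonneg (w := w)
  nlinarith

/-- Energy identity with weight `s`: `∫s²w² ≤ N∫sw² + ½∫w² ≤ 2N² + 1`. -/
theorem integral_sq_mul_sq_le (h : RadialPair k N w v) :
    ∫ s in Ioi 0, s ^ 2 * w s ^ 2 ≤ 3 * N ^ 2 := by
  have h1 := h.energy_identity (η := fun s => s) (η₁ := fun _ => 1) (η₂ := fun _ => 1)
    (fun s _ => hasDerivAt_id' s) (fun s _ => by simpa using hasDerivAt_id' s)
    polyBdd_id (polyBdd_const 1) (polyBdd_const 1) continuousOn_const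
  have h2 : 0 ≤ ∫ s in Ioi 0, s * (v s ^ 2 / s) :=
    setIntegral_nonneg measurableSet_Ioi fun s hs => by
      have : (0 : ℝ) < s := hs
      positivity
  have h3 := integral_k_sq_nonneg (k := k) (w := w) (η := fun s => s) (fun s hs => hs.le)
  have i2 : IntegrableOn (fun s => s ^ 2 * w s ^ 2) (Ioi 0) :=
    h.integrableOn_w_sq (polyBdd_id.pow 2) (by fun_prop)
  have e : ∫ s in Ioi 0, (s * (N - s) + 1 / 2) * w s ^ 2 =
      N * (∫ s in Ioi 0, s * w s ^ 2) - (∫ s in Ioi 0, s ^ 2 * w s ^ 2) +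
        1 / 2 * ∫ s in Ioi 0, w s ^ 2 := by
    have i3 : IntegrableOn (fun s => N * (s * w s ^ 2) - s ^ 2 * w s ^ 2) (Ioi 0) :=
      (h.integrableOn_id_mul_sq.const_mul N).sub i2
    rw [← integral_const_mul, ← integral_const_mul,
      ← integral_sub (h.integrableOn_id_mul_sq.const_mul N) i2,
      ← integral_add i3 (h.integrableOn_sq.const_mul (1 / 2))]
    congr 1
    ext s
    ring
  rw [e] at h1
  have := h.integral_sq_le
  have := h.one_le
  have := h.integral_id_mul_sq_le
  nlinarith

theorem integrableOn_abs_mul_sq (h : RadialPair k N w v) :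
    IntegrableOn (fun s => |N - s| * w s ^ 2) (Ioi 0) :=
  h.integrableOn_w_sq (((polyBdd_const N).sub polyBdd_id).of_le fun s _ => by simp)
    (by fun_prop)

theorem integral_abs_mul_sq_le (h : RadialPair k N w v) :
    ∫ s in Ioi 0, |N - s| * w s ^ 2 ≤ 4 * N := by
  have hN := h.one_le
  calc ∫ s in Ioi 0, |N - s| * w s ^ 2 ≤ ∫ s in Ioi 0, (N * w s ^ 2 + s * w s ^ 2) := by
        refine setIntegral_mono_on h.integrableOn_abs_mul_sq
          ((h.integrableOn_sq.const_mul N).add h.integrableOn_id_mul_sq) measurableSet_Ioi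
          fun s hs => ?_
        have hs : 0 < s := hs
        rw [← add_mul]
        gcongr
        rw [abs_le]; constructor <;> linarith
    _ = N * (∫ s in Ioi 0, w s ^ 2) + ∫ s in Ioi 0, s * w s ^ 2 := by
        rw [integral_add (h.integrableOn_sq.const_mul N) h.integrableOn_id_mul_sq,
          integral_const_mul]
    _ ≤ 4 * N := by
        have := h.integral_sq_le
        have := h.integral_id_mul_sq_le
        nlinarith

/-- An integral against the density `w²` of a weight bounded by a virial weight, a constant and
a multiple of `|N - s|`. -/
theorem integral_le_of_virial (h : RadialPair k N w v) {W F : ℝ → ℝ} {a b : ℝ}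
    (ha : 0 ≤ a) (hb : 0 ≤ b)
    (iW : IntegrableOn (fun s => W s * w s ^ 2) (Ioi 0))
    (iF : IntegrableOn (fun s => F s * w s ^ 2) (Ioi 0))
    (hF : ∫ s in Ioi 0, F s * w s ^ 2 = 0)
    (hle : ∀ s > 0, W s ≤ F s + (a + b * |N - s|)) :
    ∫ s in Ioi 0, W s * w s ^ 2 ≤ 2 * a + 4 * b * N := by
  have i1 := h.integrableOn_sq.const_mul a
  have i2 := h.integrableOn_abs_mul_sq.const_mul b
  have i3 : IntegrableOn (fun s => a * w s ^ 2 + b * (|N - s| * w s ^ 2)) (Ioi 0) := i1.add i2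
  calc ∫ s in Ioi 0, W s * w s ^ 2
      ≤ ∫ s in Ioi 0, (F s * w s ^ 2 + (a * w s ^ 2 + b * (|N - s| * w s ^ 2))) := by
        refine setIntegral_mono_on iW (iF.add i3) measurableSet_Ioi fun s hs => ?_
        have := mul_le_mul_of_nonneg_right (hle s hs) (sq_nonneg (w s))
        linarith
    _ = a * (∫ s in Ioi 0, w s ^ 2) + b * ∫ s in Ioi 0, |N - s| * w s ^ 2 := by
        rw [integral_add iF i3, hF, zero_add, integral_add i1 i2, integral_const_mul,
          integral_const_mul]
    _ ≤ _ := by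
        have h1 := mul_le_mul_of_nonneg_left h.integral_sq_le ha
        have h2 := mul_le_mul_of_nonneg_left h.integral_abs_mul_sq_le hb
        linarith

theorem integrableOn_turnWeight_mul (h : RadialPair k N w v) {Y : ℝ} (hY : 0 < Y) (p : ℕ) :
    IntegrableOn (fun s => turnWeight Y N s ^ p * w s ^ 2) (Ioi 0) :=
  h.integrableOn_w_sq ((polyBdd_turnWeight hY).pow p)
    ((continuous_turnWeight hY).pow p).continuousOn

/-- The virial weight associated with `ψ^p`. -/
noncomputable def virialWeight (k N Y : ℝ) (p : ℕ) (s : ℝ) : ℝ :=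
  2 * (p / 4 * (N - s) * turnWeight Y N s ^ (p + 8)) * (k ^ 2 / 4 - s * (N - s)) +
    turnWeight Y N s ^ p * (2 * s - N) - turnThird Y N p s / 2

theorem integrableOn_virialWeight (h : RadialPair k N w v) {Y : ℝ} (hY : 0 < Y) (p : ℕ) :
    IntegrableOn (fun s => virialWeight k N Y p s * w s ^ 2) (Ioi 0) := by
  have hx : PolyBdd fun s => N - s := (polyBdd_const N).sub polyBdd_id
  have hψ := polyBdd_turnWeight (N := N) hY
  have hc := continuous_turnWeight (N := N) hY
  have hc3 := continuous_turnThird (N := N) hY p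
  refine h.integrableOn_w_sq ?_ ?_
  · refine PolyBdd.sub (PolyBdd.add ?_ ?_) ?_
    · exact ((polyBdd_const 2).mul (polyBdd_turnFirst hY p)).mul
        ((polyBdd_const _).sub (polyBdd_id.mul hx))
    · exact (hψ.pow p).mul (((polyBdd_const 2).mul polyBdd_id).sub (polyBdd_const N))
    · simpa [div_eq_mul_inv] using (polyBdd_turnThird (N := N) hY p).mul (polyBdd_const (2⁻¹))
  · unfold virialWeight
    fun_prop

theorem integral_virialWeight (h : RadialPair k N w v) {Y : ℝ} (hY : 0 < Y) (p : ℕ) :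
    ∫ s in Ioi 0, virialWeight k N Y p s * w s ^ 2 = 0 := by
  have hc := continuous_turnWeight (N := N) hY
  exact h.virial_identity (fun s _ => hasDerivAt_turnWeight_pow hY p s)
    (fun s _ => hasDerivAt_turnFirst hY p s) (fun s _ => hasDerivAt_turnSecond hY p s)
    ((polyBdd_turnWeight hY).pow p) (polyBdd_turnFirst hY p) (polyBdd_turnSecond hY p)
    (polyBdd_turnThird hY p) (by fun_prop) (continuous_turnThird hY p).continuousOn

section turning

variable (h : RadialPair k N w v) (ht : 1 ≤ t) (hN : N = t ^ 12) (hk : k ^ 2 ≤ N)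
include h ht hN hk

/-- The virial weight of `ψ` has leading part `sψ(1 - (N-s)²ψ⁸/2) ≥ sψ/2`, which is comparable with
`Nψ` up to `(N-s)ψ`. All other terms are at most `t⁹` or small multiples of `sψ`, so `N∫ψw² =
O(t⁹)`. In WKB terms, the density is about `(s(N-s))^{-1/2}`, and integrating `|N-s|^{-1/4}` against
it gives `N^{-1/4} = t^{-3}`. -/
theorem integral_turnWeight_le :
    t ^ 3 * ∫ s in Ioi 0, turnWeight (2 * t) N s * w s ^ 2 ≤ 30 := by
  have hY : 0 < 2 * t := by linarith
  have iW := (h.integrableOn_turnWeight_mul hY 1).const_mul (2 / 5 * t ^ 12)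
  simp only [pow_one, ← mul_assoc] at iW
  have key := h.integral_le_of_virial (W := fun s => 2 / 5 * t ^ 12 * turnWeight (2 * t) N s)
    (a := 12 / 5 * t ^ 9) (b := 7 / 5 / t ^ 3) (by positivity) (by positivity) iW
    (h.integrableOn_virialWeight hY 1) (h.integral_virialWeight hY 1) ?_
  · simp only [mul_assoc] at key
    rw [integral_const_mul, integral_const_mul, hN] at key
    have e : 4 * (7 / 5 / t ^ 3 * t ^ 12) = 28 / 5 * t ^ 9 := by
      field_simp
      ring
    rw [e] at key
    have h9 : 0 < t ^ 9 := by positivity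
    have : t ^ 9 * (t ^ 3 * ∫ s in Ioi 0, turnWeight (2 * t) N s * w s ^ 2) ≤ t ^ 9 * 30 := by
      rw [hN]
      have : t ^ 12 = t ^ 9 * t ^ 3 := by ring
      rw [this] at key ⊢
      nlinarith
    exact le_of_mul_le_mul_left this h9
  · intro s hs
    set ψ := turnWeight (2 * t) N s with hψ
    have h0 : 0 < ψ := turnWeight_pos hY s
    have hx : |N - s| * ψ ^ 4 ≤ 1 := abs_mul_turnWeight_le hY s
    have hx2 : (N - s) ^ 2 * ψ ^ 8 ≤ 1 := sq_mul_turnWeight_le hY s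
    have hYψ : 2 * t * ψ ≤ 1 := mul_turnWeight_le_one hY s
    have hk2 : 0 ≤ k ^ 2 := sq_nonneg k
    have h3 := (abs_le.1 (abs_turnThird_le hY (N := N) (by linarith [h.one_le]) (p := 1) (by norm_num) hs)).2
    rw [← hψ] at h3
    have ht0 : 0 < t := by linarith
    have hψ1 : ψ ≤ 1 / 2 := by nlinarith
    have hψ8 : ψ ^ 8 ≤ 1 / 256 := by
      calc ψ ^ 8 ≤ (1 / 2) ^ 8 := by gcongr
        _ = _ := by norm_num
    have hN12 : N * ψ ^ 12 ≤ 1 / 4096 := by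
      have : (2 * t * ψ) ^ 12 ≤ 1 := pow_le_one₀ (by positivity) hYψ
      rw [hN]; nlinarith
    have hk5 : k ^ 2 * ψ ^ 5 ≤ t ^ 9 / 32 := by
      have h5 : (2 * t * ψ) ^ 5 ≤ 1 := pow_le_one₀ (by positivity) hYψ
      calc k ^ 2 * ψ ^ 5 ≤ t ^ 12 * ψ ^ 5 := by rw [← hN]; gcongr
        _ = t ^ 7 / 32 * (2 * t * ψ) ^ 5 := by ring
        _ ≤ t ^ 7 / 32 * 1 := by gcongr
        _ ≤ t ^ 9 / 32 := by
            have : t ^ 7 ≤ t ^ 9 := pow_le_pow_right₀ ht (by norm_num)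
            linarith
    have hψ5 : ψ ^ 5 ≤ t ^ 9 / 32 := by
      have : ψ ^ 5 ≤ (1 / 2) ^ 5 := by gcongr
      have : 1 ≤ t ^ 9 := one_le_pow₀ ht
      norm_num at *
      linarith
    -- The split `ψ ≶ t⁻³` separates the bulk region, where `|N-s| ≤ N`, from the rest. The second
    -- term is integrated with the first moment of `|N-s|`.
    have hxψ : |N - s| * ψ ≤ t ^ 9 + |N - s| / t ^ 3 := by
      rcases le_total (ψ * t ^ 3) 1 with hc | hc
      · have : |N - s| * ψ ≤ |N - s| / t ^ 3 := by
          rw [le_div_iff₀ (by positivity), mul_assoc]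
          nlinarith [abs_nonneg (N - s)]
        have : 0 ≤ t ^ 9 := by positivity
        linarith
      · have h1 : |N - s| * ψ ≤ t ^ 9 := by
          calc |N - s| * ψ = |N - s| * ψ * 1 ^ 3 := by ring
            _ ≤ |N - s| * ψ * (ψ * t ^ 3) ^ 3 := by gcongr
            _ = (|N - s| * ψ ^ 4) * t ^ 9 := by ring
            _ ≤ 1 * t ^ 9 := by gcongr
            _ = _ := one_mul _
        have : 0 ≤ |N - s| / t ^ 3 := by positivity
        linarith
    have hb : 7 / 5 / t ^ 3 * |N - s| = 7 / 5 * (|N - s| / t ^ 3) := by ring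
    rw [hb, virialWeight, ← hψ, ← hN]
    have m1 : s * ψ ^ 9 ≤ s * ψ / 256 := by
      calc s * ψ ^ 9 = s * ψ * ψ ^ 8 := by ring
        _ ≤ s * ψ * (1 / 256) := by gcongr
        _ = _ := by ring
    have m2 : s * N * ψ ^ 13 ≤ s * ψ / 4096 := by
      calc s * N * ψ ^ 13 = s * ψ * (N * ψ ^ 12) := by ring
        _ ≤ s * ψ * (1 / 4096) := by gcongr
        _ = _ := by ring
    have m3 : s * (N - s) ^ 2 * ψ ^ 9 ≤ s * ψ := by
      calc s * (N - s) ^ 2 * ψ ^ 9 = s * ψ * ((N - s) ^ 2 * ψ ^ 8) := by ring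
        _ ≤ s * ψ * 1 := by gcongr
        _ = _ := mul_one _
    have m4 : -((N - s) * ψ ^ 9 * k ^ 2) ≤ t ^ 9 / 32 := by
      calc -((N - s) * ψ ^ 9 * k ^ 2) = -(N - s) * ψ ^ 9 * k ^ 2 := by ring
        _ ≤ |N - s| * ψ ^ 9 * k ^ 2 := by gcongr; exact neg_le_abs _
        _ = (|N - s| * ψ ^ 4) * (k ^ 2 * ψ ^ 5) := by ring
        _ ≤ 1 * (t ^ 9 / 32) := by gcongr
        _ = _ := one_mul _
    have m5 : (N - s) * ψ ≤ |N - s| * ψ := by gcongr; exact le_abs_self _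
    have m6 : 0 ≤ s * ψ := by positivity
    have h9 : 0 ≤ t ^ 9 := by positivity
    have id1 : 2 * (((1 : ℕ) : ℝ) / 4 * (N - s) * ψ ^ (1 + 8)) * (k ^ 2 / 4 - s * (N - s)) +
        ψ ^ 1 * (2 * s - N) = (N - s) * ψ ^ 9 * k ^ 2 / 8 - s * (N - s) ^ 2 * ψ ^ 9 / 2 +
          s * ψ - (N - s) * ψ := by push_cast; ring
    have id2 : N * ψ = s * ψ + (N - s) * ψ := by ring
    rw [id1]
    norm_num only at h3 ⊢
    linarith

/-- Put `X = (N-s)²ψ⁸`, which lies in `[0,1]`. The virial weight of `ψ⁴` has leading part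
`sψ⁴(1-2X)`, with the wrong sign away from the turning point. It is therefore subtracted, and the
failure near the turning point, where `X` is small, is repaired by a multiple of the virial weight
of `ψ²`, whose leading part `sψ²(1-X)` is nonnegative. The exponent `8` of `t` is the Airy scaling
`N^{-2/3}`. -/
theorem integral_turnWeight_pow_four_le :
    t ^ 8 * ∫ s in Ioi 0, turnWeight (2 * t) N s ^ 4 * w s ^ 2 ≤ 20 := by
  have hY : 0 < 2 * t := by linarith
  have ht0 : 0 < t := by linarith
  have iW := (h.integrableOn_turnWeight_mul hY 4).const_mul (7 / 10 * t ^ 12)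
  simp only [← mul_assoc] at iW
  have iF : IntegrableOn (fun s => (1 / (2 * t ^ 2) * virialWeight k N (2 * t) 2 s -
      virialWeight k N (2 * t) 4 s) * w s ^ 2) (Ioi 0) := by
    simp only [sub_mul, mul_assoc]
    exact ((h.integrableOn_virialWeight hY 2).const_mul (1 / (2 * t ^ 2))).sub
      (h.integrableOn_virialWeight hY 4)
  have key := h.integral_le_of_virial
    (W := fun s => 7 / 10 * t ^ 12 * turnWeight (2 * t) N s ^ 4)
    (F := fun s => 1 / (2 * t ^ 2) * virialWeight k N (2 * t) 2 s - virialWeight k N (2 * t) 4 s)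
    (a := 11 / 4 * t ^ 4) (b := 3 / 4 / t ^ 8) (by positivity) (by positivity) iW
    iF ?_ ?_
  · simp only [mul_assoc] at key
    rw [integral_const_mul, integral_const_mul, hN] at key
    have e : 4 * (3 / 4 / t ^ 8 * t ^ 12) = 3 * t ^ 4 := by
      field_simp
    rw [e] at key
    have h9 : 0 < t ^ 4 := by positivity
    have : t ^ 4 * (t ^ 8 * ∫ s in Ioi 0, turnWeight (2 * t) N s ^ 4 * w s ^ 2) ≤ t ^ 4 * 20 := by
      rw [hN]
      have : t ^ 12 = t ^ 4 * t ^ 8 := by ring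
      rw [this] at key ⊢
      nlinarith
    exact le_of_mul_le_mul_left this h9
  · simp only [sub_mul, mul_assoc]
    rw [integral_sub ((h.integrableOn_virialWeight hY 2).const_mul (1 / (2 * t ^ 2)))
      (h.integrableOn_virialWeight hY 4), integral_const_mul, h.integral_virialWeight hY,
      h.integral_virialWeight hY]
    simp
  · intro s hs
    set ψ := turnWeight (2 * t) N s with hψ
    have h0 : 0 < ψ := turnWeight_pos hY s
    have hx : |N - s| * ψ ^ 4 ≤ 1 := abs_mul_turnWeight_le hY s
    have hx2 : (N - s) ^ 2 * ψ ^ 8 ≤ 1 := sq_mul_turnWeight_le hY s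
    have hYψ : 2 * t * ψ ≤ 1 := mul_turnWeight_le_one hY s
    have hk2 : 0 ≤ k ^ 2 := sq_nonneg k
    have hN1 : 0 ≤ N := by linarith [h.one_le]
    have h3 := (abs_le.1 (abs_turnThird_le hY hN1 (p := 2) (by norm_num) hs)).2
    have h3' := (abs_le.1 (abs_turnThird_le hY hN1 (p := 4) (by norm_num) hs)).1
    rw [← hψ] at h3 h3'
    norm_num only at h3 h3'
    -- Since `2tψ ≤ 1`, this is the natural multiplier for which `Z ≥ 2ψ²` everywhere.
    set Z := 1 / (2 * t ^ 2) with hZ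
    have hZ0 : 0 < Z := by positivity
    have hψ1 : ψ ≤ 1 / 2 := by nlinarith
    have hZψ : 2 * ψ ^ 2 ≤ Z := by
      rw [hZ, le_div_iff₀ (by positivity)]
      calc 2 * ψ ^ 2 * (2 * t ^ 2) = (2 * t * ψ) ^ 2 := by ring
        _ ≤ 1 := pow_le_one₀ (by positivity) hYψ
    have hZ1 : Z ≤ 1 / 2 := by
      rw [hZ, div_le_iff₀ (by positivity)]
      have : 1 ≤ t ^ 2 := one_le_pow₀ ht
      linarith
    have hψ4 : ψ ^ 4 ≤ 1 / 16 := by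
      calc ψ ^ 4 ≤ (1 / 2) ^ 4 := by gcongr
        _ = _ := by norm_num
    have hψ8 : ψ ^ 8 ≤ 1 / 256 := by
      calc ψ ^ 8 ≤ (1 / 2) ^ 8 := by gcongr
        _ = _ := by norm_num
    have hψ6 : Z * ψ ^ 6 ≤ 1 / 128 := by
      have : ψ ^ 6 ≤ 1 / 64 := by
        calc ψ ^ 6 ≤ (1 / 2) ^ 6 := by gcongr
          _ = _ := by norm_num
      calc Z * ψ ^ 6 ≤ 1 / 2 * (1 / 64) := by gcongr
        _ = _ := by norm_num
    have hZψ6 : Z * ψ ^ 6 ≤ 1 / 128 := hψ6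
    have hZN : Z * (N * ψ ^ 10) ≤ 1 / 2048 := by
      have e10 : (2 * t * ψ) ^ 10 ≤ 1 := pow_le_one₀ (by positivity) hYψ
      have : Z * (N * ψ ^ 10) = (2 * t * ψ) ^ 10 / 2048 := by
        rw [hZ, hN]; field_simp; norm_num
      rw [this]; linarith
    have hN12 : N * ψ ^ 12 ≤ 1 / 4096 := by
      have : (2 * t * ψ) ^ 12 ≤ 1 := pow_le_one₀ (by positivity) hYψ
      rw [hN]; nlinarith
    have hk6 : Z * (k ^ 2 * ψ ^ 6) ≤ t ^ 4 / 128 := by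
      have h6 : (2 * t * ψ) ^ 6 ≤ 1 := pow_le_one₀ (by positivity) hYψ
      calc Z * (k ^ 2 * ψ ^ 6) ≤ Z * (t ^ 12 * ψ ^ 6) := by rw [← hN]; gcongr
        _ = t ^ 4 / 128 * (2 * t * ψ) ^ 6 := by rw [hZ]; field_simp; norm_num
        _ ≤ t ^ 4 / 128 * 1 := by gcongr
        _ = _ := mul_one _
    have hk8 : k ^ 2 * ψ ^ 8 ≤ t ^ 4 / 256 := by
      have h8 : (2 * t * ψ) ^ 8 ≤ 1 := pow_le_one₀ (by positivity) hYψ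
      calc k ^ 2 * ψ ^ 8 ≤ t ^ 12 * ψ ^ 8 := by rw [← hN]; gcongr
        _ = t ^ 4 / 256 * (2 * t * ψ) ^ 8 := by ring
        _ ≤ t ^ 4 / 256 * 1 := by gcongr
        _ = _ := mul_one _
    have ht4 : 1 ≤ t ^ 4 := one_le_pow₀ ht
    have hxψ : Z * (|N - s| * ψ ^ 2) ≤ t ^ 4 / 2 + |N - s| / t ^ 8 / 2 := by
      have h1 : |N - s| * ψ ^ 2 ≤ t ^ 6 + |N - s| / t ^ 6 := by
        rcases le_total (ψ * t ^ 3) 1 with hc | hc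
        · have : |N - s| * ψ ^ 2 ≤ |N - s| / t ^ 6 := by
            rw [le_div_iff₀ (by positivity), mul_assoc]
            have : (ψ * t ^ 3) ^ 2 ≤ 1 := pow_le_one₀ (by positivity) hc
            nlinarith [abs_nonneg (N - s)]
          have : 0 ≤ t ^ 6 := by positivity
          linarith
        · have h1 : |N - s| * ψ ^ 2 ≤ t ^ 6 := by
            calc |N - s| * ψ ^ 2 = |N - s| * ψ ^ 2 * 1 ^ 2 := by ring
              _ ≤ |N - s| * ψ ^ 2 * (ψ * t ^ 3) ^ 2 := by gcongr
              _ = (|N - s| * ψ ^ 4) * t ^ 6 := by ring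
              _ ≤ 1 * t ^ 6 := by gcongr
              _ = _ := one_mul _
          have : 0 ≤ |N - s| / t ^ 6 := by positivity
          linarith
      calc Z * (|N - s| * ψ ^ 2) ≤ Z * (t ^ 6 + |N - s| / t ^ 6) := by gcongr
        _ = _ := by rw [hZ]; field_simp
    have hb : 3 / 4 / t ^ 8 * |N - s| = 3 / 4 * (|N - s| / t ^ 8) := by ring
    rw [hb]
    simp only [virialWeight, ← hψ, ← hN]
    have q0 : 0 ≤ s * ψ ^ 4 := by positivity
    have m1 : Z * (s * ψ ^ 10) ≤ s * ψ ^ 4 / 128 := by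
      calc Z * (s * ψ ^ 10) = s * ψ ^ 4 * (Z * ψ ^ 6) := by ring
        _ ≤ s * ψ ^ 4 * (1 / 128) := by gcongr
        _ = _ := by ring
    have m2 : Z * (s * N * ψ ^ 14) ≤ s * ψ ^ 4 / 2048 := by
      calc Z * (s * N * ψ ^ 14) = s * ψ ^ 4 * (Z * (N * ψ ^ 10)) := by ring
        _ ≤ s * ψ ^ 4 * (1 / 2048) := by gcongr
        _ = _ := by ring
    have m1' : s * ψ ^ 12 ≤ s * ψ ^ 4 / 256 := by
      calc s * ψ ^ 12 = s * ψ ^ 4 * ψ ^ 8 := by ring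
        _ ≤ s * ψ ^ 4 * (1 / 256) := by gcongr
        _ = _ := by ring
    have m2' : s * N * ψ ^ 16 ≤ s * ψ ^ 4 / 4096 := by
      calc s * N * ψ ^ 16 = s * ψ ^ 4 * (N * ψ ^ 12) := by ring
        _ ≤ s * ψ ^ 4 * (1 / 4096) := by gcongr
        _ = _ := by ring
    -- The right side minus `sψ⁴` equals `sψ²(Z - 2ψ²)(1 - X)`, a product of nonnegative factors.
    have hcore : s * ψ ^ 4 ≤ Z * (s * ψ ^ 2 - s * (N - s) ^ 2 * ψ ^ 10) -
        (s * ψ ^ 4 - 2 * (s * (N - s) ^ 2 * ψ ^ 12)) := by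
      have hm : 0 ≤ 1 - (N - s) ^ 2 * ψ ^ 8 := by linarith
      have hzz : 0 ≤ Z - 2 * ψ ^ 2 := by linarith
      have : 0 ≤ s * ψ ^ 2 * (Z - 2 * ψ ^ 2) * (1 - (N - s) ^ 2 * ψ ^ 8) := by positivity
      nlinarith
    have m5 : Z * (N - s) * ψ ^ 2 ≤ Z * (|N - s| * ψ ^ 2) := by
      rw [mul_assoc]; gcongr; exact le_abs_self _
    have m5' : -((N - s) * ψ ^ 4) ≤ 1 := by
      calc -((N - s) * ψ ^ 4) = -(N - s) * ψ ^ 4 := by ring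
        _ ≤ |N - s| * ψ ^ 4 := by gcongr; exact neg_le_abs _
        _ ≤ 1 := hx
    have m5'' : (N - s) * ψ ^ 4 ≤ 1 := by
      calc (N - s) * ψ ^ 4 ≤ |N - s| * ψ ^ 4 := by gcongr; exact le_abs_self _
        _ ≤ 1 := hx
    have m6 : -(Z * ((N - s) * ψ ^ 10 * k ^ 2)) ≤ t ^ 4 / 128 := by
      calc -(Z * ((N - s) * ψ ^ 10 * k ^ 2)) = -(N - s) * ψ ^ 4 * (Z * (k ^ 2 * ψ ^ 6)) := by ring
        _ ≤ 1 * (t ^ 4 / 128) := by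
            gcongr
            calc -(N - s) * ψ ^ 4 = -((N - s) * ψ ^ 4) := by ring
              _ ≤ 1 := m5'
        _ = _ := one_mul _
    have m7 : (N - s) * ψ ^ 12 * k ^ 2 ≤ t ^ 4 / 256 := by
      calc (N - s) * ψ ^ 12 * k ^ 2 = (N - s) * ψ ^ 4 * (k ^ 2 * ψ ^ 8) := by ring
        _ ≤ 1 * (t ^ 4 / 256) := by gcongr
        _ = _ := one_mul _
    have h3Z := mul_le_mul_of_nonneg_left h3 hZ0.le
    have id1 : Z * (2 * (((2 : ℕ) : ℝ) / 4 * (N - s) * ψ ^ (2 + 8)) *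
        (k ^ 2 / 4 - s * (N - s)) + ψ ^ 2 * (2 * s - N) - turnThird (2 * t) N 2 s / 2) -
        (2 * (((4 : ℕ) : ℝ) / 4 * (N - s) * ψ ^ (4 + 8)) *
        (k ^ 2 / 4 - s * (N - s)) + ψ ^ 4 * (2 * s - N) - turnThird (2 * t) N 4 s / 2) =
        (Z * (s * ψ ^ 2 - s * (N - s) ^ 2 * ψ ^ 10) -
          (s * ψ ^ 4 - 2 * (s * (N - s) ^ 2 * ψ ^ 12))) +
        Z * ((N - s) * ψ ^ 10 * k ^ 2) / 4 - (N - s) * ψ ^ 12 * k ^ 2 / 2 -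
        Z * (N - s) * ψ ^ 2 + (N - s) * ψ ^ 4 - Z * turnThird (2 * t) N 2 s / 2 +
        turnThird (2 * t) N 4 s / 2 := by push_cast; ring
    have id2 : N * ψ ^ 4 = s * ψ ^ 4 + (N - s) * ψ ^ 4 := by ring
    have id3 : Z * (ψ ^ 6 + 36 * s * ψ ^ 10 + 24 * s * N * ψ ^ 14) =
      Z * ψ ^ 6 + 36 * (Z * (s * ψ ^ 10)) + 24 * (Z * (s * N * ψ ^ 14)) := by ring
    have x0 : 0 ≤ |N - s| / t ^ 8 := by positivity
    rw [id1]
    rw [id3] at h3Z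
    linarith

omit hk in
/-- A weighted energy estimate away from the turning point. -/
theorem integral_turnWeight_v_sq_le {p : ℕ} (hp : 5 ≤ p) (hp' : p ≤ 8) :
    ∫ s in Ioi 0, turnWeight (2 * t) N s ^ p * (v s ^ 2 / s) ≤
      12 * ∫ s in Ioi 0, turnWeight (2 * t) N s ^ (p - 4) * w s ^ 2 := by
  have hY : 0 < 2 * t := by linarith
  have ht0 : 0 < t := by linarith
  obtain ⟨q, rfl⟩ : ∃ q, p = q + 4 := ⟨p - 4, by omega⟩
  have key := h.energy_identity (fun s _ => hasDerivAt_turnWeight_pow (N := N) hY (q + 4) s)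
    (fun s _ => hasDerivAt_turnFirst hY (q + 4) s) ((polyBdd_turnWeight hY).pow (q + 4))
    (polyBdd_turnFirst hY (q + 4)) (polyBdd_turnSecond hY (q + 4))
    (continuous_turnSecond hY (q + 4)).continuousOn
  have hnn := integral_k_sq_nonneg (k := k) (w := w)
    (η := fun s => turnWeight (2 * t) N s ^ (q + 4))
    (fun s _ => (pow_pos (turnWeight_pos hY s) _).le)
  have hP : PolyBdd fun s => turnWeight (2 * t) N s ^ (q + 4) * (N - s) +
      turnSecond (2 * t) N (q + 4) s / 2 :=
    (((polyBdd_turnWeight hY).pow _).mul ((polyBdd_const N).sub polyBdd_id)).add (by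
      simpa [div_eq_mul_inv] using (polyBdd_turnSecond hY _).mul (polyBdd_const (2⁻¹)))
  have hc := continuous_turnWeight (N := N) hY
  have hc2 := continuous_turnSecond (N := N) hY (q + 4)
  have i1 := h.integrableOn_w_sq hP (by fun_prop)
  have i2 := (h.integrableOn_turnWeight_mul hY q).const_mul 12
  rw [Nat.add_sub_cancel]
  -- The centrifugal term is nonnegative and is discarded. In the rest, four powers of `ψ` absorb `N
  -- - s`, and `Nψ¹²` is bounded because `N = t¹²`.
  calc _ ≤ ∫ s in Ioi 0, (turnWeight (2 * t) N s ^ (q + 4) * (N - s) +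
      turnSecond (2 * t) N (q + 4) s / 2) * w s ^ 2 := by linarith
    _ ≤ ∫ s in Ioi 0, 12 * (turnWeight (2 * t) N s ^ q * w s ^ 2) := by
        refine setIntegral_mono_on i1 i2 measurableSet_Ioi fun s hs => ?_
        rw [← mul_assoc]
        refine mul_le_mul_of_nonneg_right ?_ (sq_nonneg _)
        have h2 := turnSecond_le (N := N) hY (q + 4) hs
        set ψ := turnWeight (2 * t) N s with hψ
        have h0 : 0 < ψ := turnWeight_pos hY s
        have hx : |N - s| * ψ ^ 4 ≤ 1 := abs_mul_turnWeight_le hY s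
        have hYψ : 2 * t * ψ ≤ 1 := mul_turnWeight_le_one hY s
        have hψ1 : ψ ≤ 1 / 2 := by nlinarith
        have hN12 : N * ψ ^ 12 ≤ 1 / 4096 := by
          have : (2 * t * ψ) ^ 12 ≤ 1 := pow_le_one₀ (by positivity) hYψ
          rw [hN]; nlinarith
        have hψ8 : ψ ^ 8 ≤ 1 / 256 := by
          calc ψ ^ 8 ≤ (1 / 2) ^ 8 := by gcongr
            _ = _ := by norm_num
        have hq : (q : ℝ) ≤ 4 := by exact_mod_cast (by omega : q ≤ 4)
        have hq0 : (0 : ℝ) ≤ q := Nat.cast_nonneg q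
        have hN0 : 0 ≤ N := by linarith [h.one_le]
        have p0 : 0 ≤ ψ ^ q := by positivity
        have e1 : ψ ^ (q + 4) * (N - s) ≤ ψ ^ q := by
          calc ψ ^ (q + 4) * (N - s) ≤ ψ ^ (q + 4) * |N - s| := by gcongr; exact le_abs_self _
            _ = ψ ^ q * (|N - s| * ψ ^ 4) := by ring
            _ ≤ ψ ^ q * 1 := by gcongr
            _ = _ := mul_one _
        have e2 : ψ ^ (q + 4 + 4) ≤ ψ ^ q := by
          calc ψ ^ (q + 4 + 4) = ψ ^ q * ψ ^ 8 := by ring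
            _ ≤ ψ ^ q * 1 := by gcongr; linarith
            _ = _ := mul_one _
        have e3 : N * ψ ^ (q + 4 + 8) ≤ ψ ^ q := by
          calc N * ψ ^ (q + 4 + 8) = ψ ^ q * (N * ψ ^ 12) := by ring
            _ ≤ ψ ^ q * 1 := by gcongr; linarith
            _ = _ := mul_one _
        have h2' : turnSecond (2 * t) N (q + 4) s ≤ 16 * ψ ^ q := by
          refine h2.trans ?_
          push_cast
          calc ((q : ℝ) + 4) / 4 * (ψ ^ (q + 4 + 4) + (q + 4 + 8) / 4 *
              (N * ψ ^ (q + 4 + 8) + ψ ^ (q + 4 + 4)))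
              ≤ (4 + 4) / 4 * (ψ ^ (q + 4 + 4) + (4 + 4 + 8) / 4 *
              (N * ψ ^ (q + 4 + 8) + ψ ^ (q + 4 + 4))) := by gcongr
            _ ≤ 16 * ψ ^ q := by
              have f2 : ψ ^ (q + 4 + 4) ≤ ψ ^ q / 256 := by
                calc ψ ^ (q + 4 + 4) = ψ ^ q * ψ ^ 8 := by ring
                  _ ≤ ψ ^ q * (1 / 256) := by gcongr
                  _ = _ := by ring
              linarith
        linarith
    _ = _ := integral_const_mul _ _

end turning

end RadialPair

/-! ### Elementary majorants on the half-line -/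

/-- `f` is integrable on the half-line, with integral at most `c`. -/
def IntLe (f : ℝ → ℝ) (c : ℝ) : Prop := IntegrableOn f (Ioi 0) ∧ ∫ s in Ioi 0, f s ≤ c

theorem IntLe.add {f g : ℝ → ℝ} {c d : ℝ} (hf : IntLe f c) (hg : IntLe g d) :
    IntLe (fun s => f s + g s) (c + d) :=
  ⟨hf.1.add hg.1, by rw [integral_add hf.1 hg.1]; exact add_le_add hf.2 hg.2⟩

theorem IntLe.const_mul {f : ℝ → ℝ} {c : ℝ} (hf : IntLe f c) {a : ℝ} (ha : 0 ≤ a) :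
    IntLe (fun s => a * f s) (a * c) :=
  ⟨hf.1.const_mul a, by rw [integral_const_mul]; gcongr; exact hf.2⟩

theorem IntLe.mono {f : ℝ → ℝ} {c d : ℝ} (hf : IntLe f c) (h : c ≤ d) : IntLe f d :=
  ⟨hf.1, hf.2.trans h⟩

theorem IntLe.norm_integral_le {E : Type*} [NormedAddCommGroup E] [NormedSpace ℝ E] {F : ℝ → E}
    {b : ℝ → ℝ} {c : ℝ} (hb : IntLe b c) (h : ∀ s > 0, ‖F s‖ ≤ b s) :
    ‖∫ s in Ioi 0, F s‖ ≤ c := by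
  refine le_trans ?_ hb.2
  refine norm_integral_le_of_norm_le hb.1 ?_
  filter_upwards [ae_restrict_mem measurableSet_Ioi] with s hs using h s hs

theorem intLe_lorentz {c : ℝ} (hc : 0 < c) (N : ℝ) :
    IntLe (fun s => 1 / (c ^ 2 + (N - s) ^ 2)) (Real.pi / c) := by
  have e : (fun s => 1 / (c ^ 2 + (N - s) ^ 2)) =
      fun s => (c ^ 2)⁻¹ * (1 + ((s - N) / c) ^ 2)⁻¹ := by
    ext s
    have h1 : 0 < c ^ 2 + (N - s) ^ 2 := by positivity
    have h2 : 0 < 1 + ((s - N) / c) ^ 2 := by positivity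
    rw [← mul_inv, one_div]
    congr 1
    field_simp
    ring
  have i : Integrable (fun s : ℝ => (1 + ((s - N) / c) ^ 2)⁻¹) :=
    (integrable_inv_one_add_sq.comp_div hc.ne').comp_sub_right N
  rw [e]
  refine ⟨(i.const_mul _).integrableOn, ?_⟩
  rw [integral_const_mul]
  have h1 : ∫ s in Ioi 0, (1 + ((s - N) / c) ^ 2)⁻¹ ≤ ∫ s, (1 + ((s - N) / c) ^ 2)⁻¹ :=
    setIntegral_le_integral i (Eventually.of_forall fun s => by positivity)
  have h2 : ∫ s, (1 + ((s - N) / c) ^ 2)⁻¹ = c * Real.pi := by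
    rw [integral_sub_right_eq_self (fun s => (1 + (s / c) ^ 2)⁻¹) N,
      Measure.integral_comp_div (fun s => (1 + s ^ 2)⁻¹) c, abs_of_pos hc,
      integral_univ_inv_one_add_sq, smul_eq_mul]
  calc (c ^ 2)⁻¹ * ∫ s in Ioi 0, (1 + ((s - N) / c) ^ 2)⁻¹ ≤ (c ^ 2)⁻¹ * (c * Real.pi) := by
        rw [← h2]; gcongr
    _ = _ := by field_simp

theorem intLe_indicator {S : Set ℝ} (hS : MeasurableSet S) {f : ℝ → ℝ} {c : ℝ}
    (hi : IntegrableOn f S) (hf : ∀ s ∈ S, 0 ≤ f s) (h : ∫ s in S, f s ≤ c) :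
    IntLe (S.indicator f) c := by
  refine ⟨(hi.integrable_indicator hS).integrableOn, le_trans ?_ h⟩
  rw [← integral_indicator hS]
  refine setIntegral_le_integral (hi.integrable_indicator hS) (Eventually.of_forall fun s => ?_)
  exact indicator_nonneg hf s

/-- Since `ψ³` behaves like `|N-s|^{-3/4}`, a near-primitive is `-4(N-s)ψ³`: its derivative `4ψ³ -
3(N-s)²ψ¹¹` is at least `ψ³`. At both endpoints `|N-s| = N`, and each contributes at most `4N^{1/4}
= 4t³`. -/
theorem integral_turnWeight_pow_three_le {t N : ℝ} (ht : 1 ≤ t) (hN : N = t ^ 12) :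
    ∫ s in Ioc 0 (2 * N), turnWeight (2 * t) N s ^ 3 ≤ 8 * t ^ 3 := by
  have hY : 0 < 2 * t := by linarith
  have ht0 : 0 < t := by linarith
  have hN0 : 0 < N := by rw [hN]; positivity
  have hc := continuous_turnWeight (N := N) hY
  have hd : ∀ s, HasDerivAt (fun s => -4 * (N - s) * turnWeight (2 * t) N s ^ 3)
      (4 * turnWeight (2 * t) N s ^ 3 -
        3 * (N - s) ^ 2 * turnWeight (2 * t) N s ^ 11) s := by
    intro s
    have := hasDerivAt_turnMonomial (N := N) hY (-4) 0 1 3 s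
    simp only [pow_zero, mul_one, pow_one] at this
    refine this.congr_deriv ?_
    simp; ring
  have e := intervalIntegral.integral_eq_sub_of_hasDerivAt (a := 0) (b := 2 * N)
    (fun s _ => hd s) (Continuous.intervalIntegrable (by fun_prop) _ _)
  have hb : ∀ s, |N - s| = t ^ 12 → N * turnWeight (2 * t) N s ^ 3 ≤ t ^ 3 := by
    intro s hs
    have h0 : 0 < turnWeight (2 * t) N s := turnWeight_pos hY s
    have hx := abs_mul_turnWeight_le (N := N) hY s
    rw [hs] at hx
    have h1 : turnWeight (2 * t) N s * t ^ 3 ≤ 1 := by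
      refine (pow_le_one_iff_of_nonneg (by positivity) (by norm_num : (4 : ℕ) ≠ 0)).1 ?_
      calc _ = t ^ 12 * turnWeight (2 * t) N s ^ 4 := by ring
        _ ≤ 1 := hx
    calc N * turnWeight (2 * t) N s ^ 3 = t ^ 3 * (turnWeight (2 * t) N s * t ^ 3) ^ 3 := by
          rw [hN]; ring
      _ ≤ t ^ 3 * 1 := by gcongr; exact pow_le_one₀ (by positivity) h1
      _ = _ := mul_one _
  rw [← intervalIntegral.integral_of_le (by linarith)]
  calc ∫ s in (0 : ℝ)..(2 * N), turnWeight (2 * t) N s ^ 3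
      ≤ ∫ s in (0 : ℝ)..(2 * N), (4 * turnWeight (2 * t) N s ^ 3 -
        3 * (N - s) ^ 2 * turnWeight (2 * t) N s ^ 11) := by
        refine intervalIntegral.integral_mono_on (by linarith)
          (Continuous.intervalIntegrable (by fun_prop) _ _)
          (Continuous.intervalIntegrable (by fun_prop) _ _) fun s _ => ?_
        have h0 : 0 < turnWeight (2 * t) N s := turnWeight_pos hY s
        have hx2 := sq_mul_turnWeight_le (N := N) hY s
        have : (N - s) ^ 2 * turnWeight (2 * t) N s ^ 11 ≤ turnWeight (2 * t) N s ^ 3 := by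
          calc _ = (N - s) ^ 2 * turnWeight (2 * t) N s ^ 8 * turnWeight (2 * t) N s ^ 3 := by ring
            _ ≤ 1 * turnWeight (2 * t) N s ^ 3 := by gcongr
            _ = _ := one_mul _
        linarith
    _ = _ := e
    _ ≤ 8 * t ^ 3 := by
        have h1 := hb 0 (by rw [sub_zero, abs_of_pos hN0, hN])
        have h2 := hb (2 * N) (by
          rw [show N - 2 * N = -N by ring, abs_neg, abs_of_pos hN0, hN])
        nlinarith

namespace RadialPair

variable {k N t : ℝ} {w v : ℝ → ℝ}

/-- Weighted Cauchy–Schwarz in the form `2|w| ≤ P w² + 1/P` with `P = (N²+s²)/N^{3/2}`. The first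
term is controlled by the moments of orders zero and two, the second is a Lorentzian; the total is
`(5+π)/2 · √N`. -/
theorem intLe_abs (h : RadialPair k N w v) : IntLe (fun s => |w s|) (5 * Real.sqrt N) := by
  have hN := h.one_le
  have hN0 : 0 < N := by linarith
  set r := Real.sqrt N with hr
  have hr0 : 0 < r := Real.sqrt_pos.2 hN0
  have hrN : r ^ 2 = N := Real.sq_sqrt hN0.le
  have i2 : IntegrableOn (fun s => s ^ 2 * w s ^ 2) (Ioi 0) :=
    h.integrableOn_w_sq (polyBdd_id.pow 2) (by fun_prop)
  have hl := intLe_lorentz hN0 0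
  have hb : IntLe (fun s => 1 / 2 * ((1 / r ^ 3) * (N ^ 2 * w s ^ 2 + s ^ 2 * w s ^ 2) +
      r ^ 3 * (1 / (N ^ 2 + (0 - s) ^ 2))))
      (1 / 2 * ((1 / r ^ 3) * (N ^ 2 * 2 + 3 * N ^ 2) + r ^ 3 * (Real.pi / N))) :=
    ((((IntLe.const_mul ⟨h.integrableOn_sq, h.integral_sq_le⟩ (sq_nonneg N)).add
      ⟨i2, h.integral_sq_mul_sq_le⟩).const_mul (by positivity)).add
        (hl.const_mul (by positivity))).const_mul (by norm_num)
  have hle : ∀ s > 0, ‖|w s|‖ ≤ 1 / 2 * ((1 / r ^ 3) * (N ^ 2 * w s ^ 2 + s ^ 2 * w s ^ 2) +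
      r ^ 3 * (1 / (N ^ 2 + (0 - s) ^ 2))) := by
    intro s hs
    rw [norm_abs_eq_norm, Real.norm_eq_abs]
    have hP : 0 < (N ^ 2 + s ^ 2) / r ^ 3 := by positivity
    have e : 1 / 2 * ((1 / r ^ 3) * (N ^ 2 * w s ^ 2 + s ^ 2 * w s ^ 2) +
      r ^ 3 * (1 / (N ^ 2 + (0 - s) ^ 2))) =
      ((N ^ 2 + s ^ 2) / r ^ 3 * |w s| ^ 2 + 1 / ((N ^ 2 + s ^ 2) / r ^ 3)) / 2 := by
      rw [sq_abs]; field_simp; ring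
    rw [e]
    set P := (N ^ 2 + s ^ 2) / r ^ 3
    have : 0 ≤ (P * |w s| - 1) ^ 2 / P := by positivity
    have e2 : (P * |w s| - 1) ^ 2 / P = P * |w s| ^ 2 - 2 * |w s| + 1 / P := by
      field_simp; ring
    linarith
  have i : IntegrableOn (fun s => |w s|) (Ioi 0) := by
    refine hb.1.mono' (h.continuousOn_w.abs.aestronglyMeasurable measurableSet_Ioi) ?_
    filter_upwards [ae_restrict_mem measurableSet_Ioi] with s hs using hle s hs
  refine ⟨i, (le_abs_self _).trans ((hb.norm_integral_le hle).trans ?_)⟩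
  rw [← hrN]
  have : 1 / 2 * (1 / r ^ 3 * ((r ^ 2) ^ 2 * 2 + 3 * (r ^ 2) ^ 2) + r ^ 3 * (Real.pi / r ^ 2)) =
      (5 + Real.pi) / 2 * r := by field_simp; ring
  rw [this]
  have := Real.pi_le_four
  gcongr
  linarith

end RadialPair

/-! ### Integration by parts against a function with one bounded derivative -/

namespace RadialPair

variable {k N t : ℝ} {w v : ℝ → ℝ}

/-- The majorant of the integrand that remains after one integration by parts. -/
noncomputable def partsMajorant (k N t : ℝ) (w v : ℝ → ℝ) (s : ℝ) : ℝ :=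
  128 * (t ^ 8 * (turnWeight (2 * t) N s ^ 4 * w s ^ 2) +
      t ^ 4 / 16 * (1 / (((2 * t) ^ 4) ^ 2 + (N - s) ^ 2))) +
    (t ^ 3 * (turnWeight (2 * t) N s ^ 5 * (v s ^ 2 / s)) + 1 / t ^ 12 * (v s ^ 2 / s) +
      1 / t ^ 3 * (Ioc 0 (2 * N)).indicator (fun s => turnWeight (2 * t) N s ^ 3) s +
      2 * t ^ 12 * (1 / ((t ^ 12) ^ 2 + (N - s) ^ 2))) +
    1 / 2 * (t ^ 8 * (turnWeight (2 * t) N s ^ 8 * (v s ^ 2 / s)) +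
      t ^ 4 * (1 / (((2 * t) ^ 4) ^ 2 + (N - s) ^ 2))) +
    k / 2 * (1 / t ^ 12 * (k ^ 2 / (4 * s) * w s ^ 2) +
      1 / t ^ 12 * (Ioc 0 (N / 2)).indicator (fun _ => 1) s +
      1 / 2 * (1 / (((2 * t) ^ 4) ^ 2 + (N - s) ^ 2)))

/-- The prefactors were chosen so that the powers of `t` cancel in every summand, except the last
Lorentzian, where `t ≥ 1` is used. Only the dependence on `k` remains. -/
theorem intLe_partsMajorant (h : RadialPair k N w v) (ht : 1 ≤ t) (hN : N = t ^ 12)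
    (hk : k ^ 2 ≤ N) : IntLe (partsMajorant k N t w v) (4000 * (k + 1)) := by
  have hY : 0 < 2 * t := by linarith
  have ht0 : 0 < t := by linarith
  have hk0 := h.k_nonneg
  have hN0 : 0 < N := by rw [hN]; positivity
  have hc := continuous_turnWeight (N := N) hY
  have l1 := intLe_lorentz (show 0 < (2 * t) ^ 4 by positivity) N
  have l2 := intLe_lorentz (show 0 < t ^ 12 by positivity) N
  have j1 : IntLe (fun s => turnWeight (2 * t) N s * w s ^ 2) (30 / t ^ 3) :=
    ⟨by simpa using h.integrableOn_turnWeight_mul hY 1, by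
      rw [le_div_iff₀ (by positivity), mul_comm]; exact h.integral_turnWeight_le ht hN hk⟩
  have j4 : IntLe (fun s => turnWeight (2 * t) N s ^ 4 * w s ^ 2) (20 / t ^ 8) :=
    ⟨h.integrableOn_turnWeight_mul hY 4, by
      rw [le_div_iff₀ (by positivity), mul_comm]; exact h.integral_turnWeight_pow_four_le ht hN hk⟩
  have e5 : IntLe (fun s => turnWeight (2 * t) N s ^ 5 * (v s ^ 2 / s)) (12 * (30 / t ^ 3)) := by
    refine ⟨h.integrableOn_v_sq ((polyBdd_turnWeight hY).pow 5) (hc.pow 5).continuousOn, ?_⟩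
    refine (h.integral_turnWeight_v_sq_le ht hN le_rfl (by norm_num)).trans ?_
    simpa using j1.2
  have e8 : IntLe (fun s => turnWeight (2 * t) N s ^ 8 * (v s ^ 2 / s)) (12 * (20 / t ^ 8)) := by
    refine ⟨h.integrableOn_v_sq ((polyBdd_turnWeight hY).pow 8) (hc.pow 8).continuousOn, ?_⟩
    refine (h.integral_turnWeight_v_sq_le ht hN (by norm_num) le_rfl).trans ?_
    simpa using j4.2
  have i0 : IntegrableOn (fun s => v s ^ 2 / s) (Ioi 0) := by
    simpa using h.integrableOn_v_sq (polyBdd_const 1) continuousOn_const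
  have ik : IntegrableOn (fun s => k ^ 2 / (4 * s) * w s ^ 2) (Ioi 0) := by
    simpa using h.integrableOn_k_sq (polyBdd_const 1) continuousOn_const
  have hen := h.integral_v_sq_add_le
  have hn1 := integral_v_sq_nonneg (v := v) (η := fun _ => 1) (fun _ => zero_le_one)
  have hn2 := integral_k_sq_nonneg (k := k) (w := w) (η := fun _ => 1) (fun _ _ => zero_le_one)
  simp only [one_mul] at hn1 hn2
  have e0 : IntLe (fun s => v s ^ 2 / s) (2 * N) := ⟨i0, by linarith⟩
  have ek : IntLe (fun s => k ^ 2 / (4 * s) * w s ^ 2) (2 * N) := ⟨ik, by linarith⟩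
  have d1 : IntLe ((Ioc 0 (2 * N)).indicator fun s => turnWeight (2 * t) N s ^ 3) (8 * t ^ 3) :=
    intLe_indicator measurableSet_Ioc
      ((hc.pow 3).integrableOn_Icc.mono_set Ioc_subset_Icc_self)
      (fun s _ => (pow_pos (turnWeight_pos hY s) _).le) (integral_turnWeight_pow_three_le ht hN)
  have d2 : IntLe ((Ioc 0 (N / 2)).indicator fun _ => (1 : ℝ)) (N / 2) :=
    intLe_indicator measurableSet_Ioc
      (continuous_const.integrableOn_Icc.mono_set Ioc_subset_Icc_self)
      (fun _ _ => zero_le_one) (by simp; positivity)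
  have A := ((j4.const_mul (show 0 ≤ t ^ 8 by positivity)).add
    (l1.const_mul (show 0 ≤ t ^ 4 / 16 by positivity))).const_mul (show (0 : ℝ) ≤ 128 by norm_num)
  have B := (((e5.const_mul (show 0 ≤ t ^ 3 by positivity)).add
    (e0.const_mul (show 0 ≤ 1 / t ^ 12 by positivity))).add
    (d1.const_mul (show 0 ≤ 1 / t ^ 3 by positivity))).add
    (l2.const_mul (show 0 ≤ 2 * t ^ 12 by positivity))
  have B' := ((e8.const_mul (show 0 ≤ t ^ 8 by positivity)).add
    (l1.const_mul (show 0 ≤ t ^ 4 by positivity))).const_mul (show (0 : ℝ) ≤ 1 / 2 by norm_num)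
  have C := (((ek.const_mul (show 0 ≤ 1 / t ^ 12 by positivity)).add
    (d2.const_mul (show 0 ≤ 1 / t ^ 12 by positivity))).add
    (l1.const_mul (show (0 : ℝ) ≤ 1 / 2 by norm_num))).const_mul (show 0 ≤ k / 2 by positivity)
  refine (((A.add B).add B').add C).mono ?_
  have hπ := Real.pi_le_four
  have hπ0 := Real.pi_pos
  have f1 : t ^ 8 * (20 / t ^ 8) = 20 := by field_simp
  have f2 : t ^ 4 / 16 * (Real.pi / (2 * t) ^ 4) = Real.pi / 256 := by field_simp; norm_num
  have f3 : t ^ 3 * (12 * (30 / t ^ 3)) = 360 := by field_simp; norm_num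
  have f4 : 1 / t ^ 12 * (2 * N) = 2 := by rw [hN]; field_simp
  have f5 : 1 / t ^ 3 * (8 * t ^ 3) = 8 := by field_simp
  have f6 : 2 * t ^ 12 * (Real.pi / t ^ 12) = 2 * Real.pi := by field_simp
  have f7 : t ^ 8 * (12 * (20 / t ^ 8)) = 240 := by field_simp; norm_num
  have f8 : t ^ 4 * (Real.pi / (2 * t) ^ 4) = Real.pi / 16 := by field_simp; norm_num
  have f9 : 1 / t ^ 12 * (N / 2) = 1 / 2 := by rw [hN]; field_simp
  have f10 : Real.pi / (2 * t) ^ 4 ≤ Real.pi := by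
    refine div_le_self hπ0.le (one_le_pow₀ (by linarith))
  rw [f1, f2, f3, f4, f5, f6, f7, f8, f9]
  nlinarith

/-- The integrand that remains after one integration by parts. -/
noncomputable def partsRemainder (k N t : ℝ) (w v : ℝ → ℝ) (G G' : ℝ → ℂ) (s : ℝ) : ℂ :=
  G s * ((256 * t ^ 8 * turnWeight (2 * t) N s ^ 8 * w s : ℝ) : ℂ) +
    G s * (((N - s) * turnWeight (2 * t) N s ^ 8 * (k ^ 2 / (4 * s)) * w s : ℝ) : ℂ) +
    (G' s * (((N - s) * turnWeight (2 * t) N s ^ 8 : ℝ) : ℂ) +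
      G s * ((2 * (N - s) ^ 2 * turnWeight (2 * t) N s ^ 16 -
        turnWeight (2 * t) N s ^ 8 : ℝ) : ℂ)) * (v s : ℂ)

theorem two_mul_le_add_sq' {a b : ℝ} (c : ℝ) (hc : 0 < c) : 2 * (a * b) ≤ c * a ^ 2 + b ^ 2 / c := by
  have : 0 ≤ (c * a - b) ^ 2 / c := by positivity
  have e : (c * a - b) ^ 2 / c = c * a ^ 2 - 2 * (a * b) + b ^ 2 / c := by field_simp; ring
  linarith

set_option maxHeartbeats 1000000 in
-- Every product of `w` or `v/√s` with a power of `ψ` is split by Young's inequality into a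
-- quadratic term, covered by the weighted bounds, and an explicitly integrable function. The Young
-- weights are the powers of `t` which balance the two integrals.
theorem norm_partsRemainder_le (ht : 1 ≤ t) (hN : N = t ^ 12) (hk : 0 ≤ k)
    {G G' : ℝ → ℂ} {s : ℝ} (hs : 0 < s) (hG : ‖G s‖ ≤ 1) (hG' : Real.sqrt s * ‖G' s‖ ≤ 1)
    (hGk : k * ‖G s‖ ≤ k * Real.sqrt s) :
    ‖partsRemainder k N t w v G G' s‖ ≤ partsMajorant k N t w v s := by
  have hY : 0 < 2 * t := by linarith
  have ht0 : 0 < t := by linarith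
  have hN0 : 0 < N := by rw [hN]; positivity
  set ψ := turnWeight (2 * t) N s with hψ
  have h0 : 0 < ψ := turnWeight_pos hY s
  have hx : |N - s| * ψ ^ 4 ≤ 1 := abs_mul_turnWeight_le hY s
  have hx2 : (N - s) ^ 2 * ψ ^ 8 ≤ 1 := sq_mul_turnWeight_le hY s
  have hYψ : 2 * t * ψ ≤ 1 := mul_turnWeight_le_one hY s
  have hψ1 : ψ ≤ 1 / 2 := by nlinarith
  have hψ8 : 1 / (((2 * t) ^ 4) ^ 2 + (N - s) ^ 2) = ψ ^ 8 := by
    have := turnWeight_pow_eight (N := N) hY s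
    rw [← hψ] at this
    rw [div_eq_iff (by positivity), ← this]
    ring
  set r := Real.sqrt s with hr
  have hr0 : 0 < r := Real.sqrt_pos.2 hs
  have hrs : r ^ 2 = s := Real.sq_sqrt hs.le
  set q := |v s| / r with hq
  have hq0 : 0 ≤ q := by positivity
  have hqv : |v s| = r * q := by rw [hq]; field_simp
  have hq2 : v s ^ 2 / s = q ^ 2 := by rw [hq, div_pow, sq_abs, hrs]
  set W := |w s| with hW
  have hW0 : 0 ≤ W := abs_nonneg _
  have hW2 : w s ^ 2 = W ^ 2 := (sq_abs _).symm
  have kap : |(N - s) * ψ ^ 8| ≤ ψ ^ 4 := by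
    rw [abs_mul, abs_of_pos (pow_pos h0 _)]
    calc |N - s| * ψ ^ 8 = |N - s| * ψ ^ 4 * ψ ^ 4 := by ring
      _ ≤ 1 * ψ ^ 4 := by gcongr
      _ = _ := one_mul _
  have kap' : |2 * (N - s) ^ 2 * ψ ^ 16 - ψ ^ 8| ≤ ψ ^ 8 := by
    have : (N - s) ^ 2 * ψ ^ 16 ≤ ψ ^ 8 := by
      calc (N - s) ^ 2 * ψ ^ 16 = (N - s) ^ 2 * ψ ^ 8 * ψ ^ 8 := by ring
        _ ≤ 1 * ψ ^ 8 := by gcongr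
        _ = _ := one_mul _
    have : 0 ≤ (N - s) ^ 2 * ψ ^ 16 := by positivity
    rw [abs_le]; constructor <;> linarith
  have tA : ‖G s * ((256 * t ^ 8 * ψ ^ 8 * w s : ℝ) : ℂ)‖ ≤
      128 * (t ^ 8 * (ψ ^ 4 * w s ^ 2) + t ^ 4 / 16 * ψ ^ 8) := by
    rw [norm_mul, Complex.norm_real, Real.norm_eq_abs, abs_mul, abs_of_nonneg (by positivity)]
    have hY4 : (2 * t * ψ) ^ 4 ≤ 1 := pow_le_one₀ (by positivity) hYψ
    have am : 2 * (W * ψ ^ 4) ≤ 1 * W ^ 2 + (ψ ^ 4) ^ 2 / 1 := two_mul_le_add_sq' 1 one_pos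
    calc ‖G s‖ * (256 * t ^ 8 * ψ ^ 8 * |w s|) ≤ 1 * (256 * t ^ 8 * ψ ^ 8 * |w s|) := by gcongr
      _ = 128 * (t ^ 8 * (ψ ^ 4 * (2 * (W * ψ ^ 4)))) := by ring
      _ ≤ 128 * (t ^ 8 * (ψ ^ 4 * (1 * W ^ 2 + (ψ ^ 4) ^ 2 / 1))) := by gcongr
      _ = 128 * (t ^ 8 * (ψ ^ 4 * W ^ 2) + t ^ 4 / 16 * ψ ^ 8 * (2 * t * ψ) ^ 4) := by ring
      _ ≤ 128 * (t ^ 8 * (ψ ^ 4 * W ^ 2) + t ^ 4 / 16 * ψ ^ 8 * 1) := by gcongr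
      _ = _ := by rw [hW2, mul_one]
  have tC : ‖G s * (((N - s) * ψ ^ 8 * (k ^ 2 / (4 * s)) * w s : ℝ) : ℂ)‖ ≤
      k / 2 * (1 / t ^ 12 * (k ^ 2 / (4 * s) * w s ^ 2) +
      1 / t ^ 12 * (Ioc 0 (N / 2)).indicator (fun _ => 1) s + 1 / 2 * ψ ^ 8) := by
    have hg0 := norm_nonneg (G s)
    rw [norm_mul, Complex.norm_real, Real.norm_eq_abs, abs_mul, abs_mul,
      abs_of_nonneg (show 0 ≤ k ^ 2 / (4 * s) by positivity)]
    -- The explicit half of the centrifugal term. For `s ≤ N/2` the vanishing of `G` at the origin,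
    -- `‖G‖² ≤ s` if `k ≠ 0`, cancels `1/s`, while `ψ⁸ ≤ 4/N²`. For `s > N/2` the factor `N/(4s)` is
    -- at most `1/2`.
    have main : t ^ 12 * (k * ((‖G s‖ * ψ ^ 4) ^ 2 / (4 * s))) ≤
        k * (1 / t ^ 12 * (Ioc 0 (N / 2)).indicator (fun _ => 1) s + 1 / 2 * ψ ^ 8) := by
      by_cases hsN : s ≤ N / 2
      · rw [indicator_of_mem (show s ∈ Ioc 0 (N / 2) from ⟨hs, hsN⟩)]
        have g1 : k * (‖G s‖ ^ 2 / s) ≤ k := by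
          rw [← mul_div_assoc, div_le_iff₀ hs]
          calc k * ‖G s‖ ^ 2 = k * ‖G s‖ * ‖G s‖ := by ring
            _ ≤ k * r * ‖G s‖ := by gcongr
            _ = k * ‖G s‖ * r := by ring
            _ ≤ k * r * r := by gcongr
            _ = k * s := by rw [← hrs]; ring
        have g2 : ψ ^ 8 * t ^ 24 ≤ 4 := by
          have : N ^ 2 / 4 ≤ (N - s) ^ 2 := by nlinarith
          calc ψ ^ 8 * t ^ 24 = 4 * (N ^ 2 / 4 * ψ ^ 8) := by rw [hN]; ring
            _ ≤ 4 * ((N - s) ^ 2 * ψ ^ 8) := by gcongr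
            _ ≤ 4 * 1 := by gcongr
            _ = _ := by norm_num
        calc t ^ 12 * (k * ((‖G s‖ * ψ ^ 4) ^ 2 / (4 * s)))
            = k * (‖G s‖ ^ 2 / s) * ((ψ ^ 8 * t ^ 24) / 4) * (1 / t ^ 12) := by
              field_simp
          _ ≤ k * (4 / 4) * (1 / t ^ 12) := by gcongr
          _ = k * (1 / t ^ 12 * 1 + 0) := by ring
          _ ≤ _ := by gcongr; positivity
      · rw [indicator_of_notMem (fun hm => hsN hm.2)]
        push Not at hsN
        have g1 : ‖G s‖ ^ 2 ≤ 1 := pow_le_one₀ hg0 hG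
        have g2 : t ^ 12 / (4 * s) ≤ 1 / 2 := by
          rw [← hN, div_le_iff₀ (by positivity)]; linarith
        calc t ^ 12 * (k * ((‖G s‖ * ψ ^ 4) ^ 2 / (4 * s)))
            = k * (t ^ 12 / (4 * s) * (‖G s‖ ^ 2 * ψ ^ 8)) := by field_simp
          _ ≤ k * (1 / 2 * (1 * ψ ^ 8)) := by gcongr
          _ = _ := by ring
    have am : 2 * (k * W * (‖G s‖ * ψ ^ 4)) ≤
        1 / t ^ 12 * (k * W) ^ 2 + (‖G s‖ * ψ ^ 4) ^ 2 / (1 / t ^ 12) :=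
      two_mul_le_add_sq' _ (by positivity)
    calc ‖G s‖ * (|(N - s) * ψ ^ 8| * (k ^ 2 / (4 * s)) * |w s|)
        ≤ ‖G s‖ * (ψ ^ 4 * (k ^ 2 / (4 * s)) * |w s|) := by gcongr
      _ = k / 2 / (4 * s) * (2 * (k * W * (‖G s‖ * ψ ^ 4))) := by ring
      _ ≤ k / 2 / (4 * s) * (1 / t ^ 12 * (k * W) ^ 2 + (‖G s‖ * ψ ^ 4) ^ 2 / (1 / t ^ 12)) := by
          gcongr
      _ = k / 2 * (1 / t ^ 12 * (k ^ 2 / (4 * s) * w s ^ 2)) +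
          1 / 2 * (t ^ 12 * (k * ((‖G s‖ * ψ ^ 4) ^ 2 / (4 * s)))) := by
          rw [hW2]; field_simp
      _ ≤ _ := by linarith
  -- Here `q = |v|/√s`. The weight `ψ³` is not integrable at infinity, so the splitting `ψ⁴q =
  -- ψ³·(ψq)` is used only for `s ≤ 2N`. Beyond that, `|N-s| ≥ N` and the unweighted energy together
  -- with a Lorentzian of width `N` suffice.
  have tB1 : 2 * (ψ ^ 4 * q) ≤ t ^ 3 * (ψ ^ 5 * q ^ 2) + 1 / t ^ 12 * q ^ 2 +
      1 / t ^ 3 * (Ioc 0 (2 * N)).indicator (fun s => turnWeight (2 * t) N s ^ 3) s +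
      2 * t ^ 12 * (1 / ((t ^ 12) ^ 2 + (N - s) ^ 2)) := by
    by_cases hsN : s ≤ 2 * N
    · rw [indicator_of_mem (show s ∈ Ioc 0 (2 * N) from ⟨hs, hsN⟩), ← hψ]
      have am : 2 * (ψ * q * 1) ≤ t ^ 3 * (ψ * q) ^ 2 + 1 ^ 2 / t ^ 3 :=
        two_mul_le_add_sq' _ (by positivity)
      have : 2 * (ψ ^ 4 * q) ≤ t ^ 3 * (ψ ^ 5 * q ^ 2) + 1 / t ^ 3 * ψ ^ 3 := by
        calc 2 * (ψ ^ 4 * q) = ψ ^ 3 * (2 * (ψ * q * 1)) := by ring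
          _ ≤ ψ ^ 3 * (t ^ 3 * (ψ * q) ^ 2 + 1 ^ 2 / t ^ 3) := by gcongr
          _ = _ := by ring
      have : 0 ≤ 1 / t ^ 12 * q ^ 2 := by positivity
      have : 0 ≤ 2 * t ^ 12 * (1 / ((t ^ 12) ^ 2 + (N - s) ^ 2)) := by positivity
      linarith
    · rw [indicator_of_notMem (fun hm => hsN hm.2)]
      push Not at hsN
      have am : 2 * (q * ψ ^ 4) ≤ 1 / t ^ 12 * q ^ 2 + (ψ ^ 4) ^ 2 / (1 / t ^ 12) :=
        two_mul_le_add_sq' _ (by positivity)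
      have g : ψ ^ 8 ≤ 2 * (1 / ((t ^ 12) ^ 2 + (N - s) ^ 2)) := by
        rw [mul_one_div, le_div_iff₀ (by positivity), ← hN]
        have : N ^ 2 ≤ (N - s) ^ 2 := by nlinarith
        have : ψ ^ 8 * N ^ 2 ≤ ψ ^ 8 * (N - s) ^ 2 := by gcongr
        linarith
      have g2 := mul_le_mul_of_nonneg_left g (show 0 ≤ t ^ 12 by positivity)
      have e : (ψ ^ 4) ^ 2 / (1 / t ^ 12) = t ^ 12 * ψ ^ 8 := by field_simp
      have : 0 ≤ t ^ 3 * (ψ ^ 5 * q ^ 2) := by positivity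
      linarith
  have tB2 : t ^ 6 * ψ ^ 8 * q ≤ 1 / 2 * (t ^ 8 * (ψ ^ 8 * q ^ 2) + t ^ 4 * ψ ^ 8) := by
    have am : 2 * (q * 1) ≤ t ^ 2 * q ^ 2 + 1 ^ 2 / t ^ 2 := two_mul_le_add_sq' _ (by positivity)
    calc t ^ 6 * ψ ^ 8 * q = 1 / 2 * (t ^ 6 * ψ ^ 8 * (2 * (q * 1))) := by ring
      _ ≤ 1 / 2 * (t ^ 6 * ψ ^ 8 * (t ^ 2 * q ^ 2 + 1 ^ 2 / t ^ 2)) := by gcongr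
      _ = _ := by field_simp
  -- From `s ≤ N + |N-s|` and `|N-s|ψ⁴ ≤ 1`, with `√N = t⁶`: it converts `|v| = √s·q` into `q` in
  -- the term containing `κ'`, the derivative of `κ = (N-s)ψ⁸`.
  have hrt : r * ψ ^ 2 ≤ t ^ 6 * ψ ^ 2 + 1 := by
    have h1 : (r * ψ ^ 2) ^ 2 ≤ (t ^ 6 * ψ ^ 2 + 1) ^ 2 := by
      have : s * ψ ^ 4 ≤ N * ψ ^ 4 + 1 := by
        have : s ≤ N + |N - s| := by linarith [neg_abs_le (N - s)]
        have := mul_le_mul_of_nonneg_right this (pow_pos h0 4).le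
        linarith
      have e1 : (r * ψ ^ 2) ^ 2 = s * ψ ^ 4 := by rw [← hrs]; ring
      have e2 : (t ^ 6 * ψ ^ 2 + 1) ^ 2 = N * ψ ^ 4 + 1 + 2 * (t ^ 6 * ψ ^ 2) := by rw [hN]; ring
      have : 0 ≤ t ^ 6 * ψ ^ 2 := by positivity
      rw [e1, e2]; linarith
    exact le_of_sq_le_sq h1 (by positivity)
  have tB : ‖(G' s * (((N - s) * ψ ^ 8 : ℝ) : ℂ) + G s * ((2 * (N - s) ^ 2 * ψ ^ 16 -
      ψ ^ 8 : ℝ) : ℂ)) * (v s : ℂ)‖ ≤ 2 * (ψ ^ 4 * q) + t ^ 6 * ψ ^ 8 * q := by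
    rw [norm_mul, Complex.norm_real, Real.norm_eq_abs, hqv]
    have n1 : ‖G' s * (((N - s) * ψ ^ 8 : ℝ) : ℂ)‖ * r ≤ ψ ^ 4 := by
      rw [norm_mul, Complex.norm_real, Real.norm_eq_abs]
      calc ‖G' s‖ * |(N - s) * ψ ^ 8| * r = r * ‖G' s‖ * |(N - s) * ψ ^ 8| := by ring
        _ ≤ 1 * ψ ^ 4 := by gcongr
        _ = _ := one_mul _
    have n2 : ‖G s * ((2 * (N - s) ^ 2 * ψ ^ 16 - ψ ^ 8 : ℝ) : ℂ)‖ * r ≤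
        t ^ 6 * ψ ^ 8 + ψ ^ 4 := by
      rw [norm_mul, Complex.norm_real, Real.norm_eq_abs]
      calc ‖G s‖ * |2 * (N - s) ^ 2 * ψ ^ 16 - ψ ^ 8| * r ≤ 1 * ψ ^ 8 * r := by gcongr
        _ = ψ ^ 6 * (r * ψ ^ 2) := by ring
        _ ≤ ψ ^ 6 * (t ^ 6 * ψ ^ 2 + 1) := by gcongr
        _ = t ^ 6 * ψ ^ 8 + ψ ^ 4 * ψ ^ 2 := by ring
        _ ≤ t ^ 6 * ψ ^ 8 + ψ ^ 4 * 1 := by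
            gcongr
            exact pow_le_one₀ h0.le (by linarith)
        _ = _ := by rw [mul_one]
    calc _ ≤ (‖G' s * (((N - s) * ψ ^ 8 : ℝ) : ℂ)‖ +
          ‖G s * ((2 * (N - s) ^ 2 * ψ ^ 16 - ψ ^ 8 : ℝ) : ℂ)‖) * (r * q) := by
          gcongr; exact norm_add_le _ _
      _ = (‖G' s * (((N - s) * ψ ^ 8 : ℝ) : ℂ)‖ * r +
          ‖G s * ((2 * (N - s) ^ 2 * ψ ^ 16 - ψ ^ 8 : ℝ) : ℂ)‖ * r) * q := by ring
      _ ≤ (ψ ^ 4 + (t ^ 6 * ψ ^ 8 + ψ ^ 4)) * q := by gcongr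
      _ = _ := by ring
  rw [partsRemainder, partsMajorant, hψ8, hq2, ← hψ]
  refine (norm_add_le _ _).trans ?_
  have := norm_add_le (G s * ((256 * t ^ 8 * ψ ^ 8 * w s : ℝ) : ℂ))
    (G s * (((N - s) * ψ ^ 8 * (k ^ 2 / (4 * s)) * w s : ℝ) : ℂ))
  linarith

end RadialPair

namespace RadialPair

variable {k N t : ℝ} {w v : ℝ → ℝ}

/-- Pairing an eigenfunction with a bounded function having one bounded derivative, in the region
of small angular momentum. -/
theorem norm_integral_le_of_sq_le (h : RadialPair k N w v) (hk : k ^ 2 ≤ N) {G G' : ℝ → ℂ}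
    (hd : ∀ s > 0, HasDerivAt G (G' s) s) (hc : ContinuousOn G' (Ioi 0))
    (hG : ∀ s > 0, ‖G s‖ ≤ 1) (hG' : ∀ s > 0, Real.sqrt s * ‖G' s‖ ≤ 1)
    (hGk : ∀ s > 0, k * ‖G s‖ ≤ k * Real.sqrt s) :
    ‖∫ s in Ioi 0, G s * w s‖ ≤ 4000 * (k + 1) := by
  -- With `t = N^{1/12}` the scales `N^{1/4}`, `N^{1/3}`, `N^{1/2}`, `N^{2/3}` are all integer
  -- powers. The choice `Y = 2t` gives `Y⁴ = 16N^{1/3}`, the Airy width.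
  obtain ⟨t, ht, hN⟩ : ∃ t : ℝ, 1 ≤ t ∧ N = t ^ 12 := by
    refine ⟨N ^ (1 / 12 : ℝ), Real.one_le_rpow h.one_le (by norm_num), ?_⟩
    rw [← Real.rpow_natCast, ← Real.rpow_mul (by linarith [h.one_le])]
    norm_num
  have hY : 0 < 2 * t := by linarith
  have hψc := continuous_turnWeight (N := N) hY
  have hGc : ContinuousOn G (Ioi 0) := fun s hs => (hd s hs).continuousAt.continuousWithinAt
  have hwc := h.continuousOn_w
  have hvc := h.continuousOn_v
  have hb := h.intLe_partsMajorant ht hN hk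
  have hRle : ∀ s > 0, ‖partsRemainder k N t w v G G' s‖ ≤ partsMajorant k N t w v s :=
    fun s hs => norm_partsRemainder_le ht hN h.k_nonneg hs (hG s hs) (hG' s hs) (hGk s hs)
  have hRc : ContinuousOn (partsRemainder k N t w v G G') (Ioi 0) := by
    have hinv : ContinuousOn (fun s : ℝ => k ^ 2 / (4 * s)) (Ioi 0) :=
      continuousOn_const.div (by fun_prop) fun s hs => by
        have : (0 : ℝ) < s := hs
        positivity
    have hofReal : ∀ {f : ℝ → ℝ}, ContinuousOn f (Ioi 0) →
        ContinuousOn (fun s => ((f s : ℝ) : ℂ)) (Ioi 0) := fun hf =>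
      Complex.continuous_ofReal.comp_continuousOn hf
    unfold partsRemainder
    refine ((hGc.mul (hofReal ?_)).add (hGc.mul (hofReal ?_))).add
      (((hc.mul (hofReal ?_)).add (hGc.mul (hofReal ?_))).mul (hofReal hvc))
    all_goals fun_prop
  have hRi : IntegrableOn (partsRemainder k N t w v G G') (Ioi 0) := by
    refine hb.1.mono' (hRc.aestronglyMeasurable measurableSet_Ioi) ?_
    filter_upwards [ae_restrict_mem measurableSet_Ioi] with s hs using hRle s hs
  obtain ⟨C, hC, hCb⟩ := h.bound
  have hwi : IntegrableOn (fun s => G s * (w s : ℂ)) (Ioi 0) := by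
    refine integrableOn_of_norm_le_exp (K := C)
      (hGc.mul (Complex.continuous_ofReal.comp_continuousOn hwc)) fun s hs => ?_
    rw [norm_mul, Complex.norm_real, Real.norm_eq_abs]
    calc ‖G s‖ * |w s| ≤ 1 * (C * Real.exp (-s / 2)) :=
          mul_le_mul (hG s hs) (hCb s hs).1 (abs_nonneg _) zero_le_one
      _ = _ := one_mul _
  -- The factor `κ = (N-s)ψ⁸` is a regularised `1/(N-s)`, with `(N-s)κ = 1 - Y⁸ψ⁸` and `Y⁸ = 256t⁸`.
  -- Differentiating `Gκv` therefore produces `-Gw` plus the error near the turning point, the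
  -- centrifugal term and `(Gκ)'v`.
  have key := integral_Ioi_deriv_eq_zero
    (f := fun s => G s * ((((N - s) * turnWeight (2 * t) N s ^ 8 : ℝ) : ℂ)) * (v s : ℂ))
    (f' := fun s => partsRemainder k N t w v G G' s - G s * w s) (K := C) ?_ (hRi.sub hwi) ?_
  · rw [integral_sub hRi hwi, sub_eq_zero] at key
    rw [← key]
    exact hb.norm_integral_le hRle
  · intro s hs
    have h1 := hasDerivAt_turnMonomial (N := N) hY 1 0 1 8 s
    simp only [one_mul, pow_zero, pow_one] at h1
    have h2 := ((hd s hs).mul h1.ofReal_comp).mul (h.hasDerivAt_v s hs).ofReal_comp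
    refine h2.congr_deriv ?_
    unfold partsRemainder
    have e8 := turnWeight_pow_eight (N := N) hY s
    set ψ := turnWeight (2 * t) N s
    have e : (256 * t ^ 8 * ψ ^ 8 : ℝ) = 1 - (N - s) ^ 2 * ψ ^ 8 := by
      rw [← e8]; ring
    have hs' : (s : ℂ) ≠ 0 := by exact_mod_cast hs.ne'
    rw [e]
    simp only [Pi.mul_apply]
    push_cast
    field_simp
    ring
  · intro s hs
    have h0 : 0 < turnWeight (2 * t) N s := turnWeight_pos hY s
    have hx := abs_mul_turnWeight_le (N := N) hY s
    have h1 := mul_turnWeight_le_one (N := N) hY s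
    have hψ1 : turnWeight (2 * t) N s ≤ 1 := by nlinarith
    have hψ4 : turnWeight (2 * t) N s ^ 4 ≤ 1 := pow_le_one₀ h0.le hψ1
    rw [norm_mul, norm_mul, Complex.norm_real, Complex.norm_real, Real.norm_eq_abs,
      Real.norm_eq_abs, abs_mul, abs_of_pos (pow_pos h0 8)]
    have : |N - s| * turnWeight (2 * t) N s ^ 8 ≤ 1 := by
      calc _ = |N - s| * turnWeight (2 * t) N s ^ 4 * turnWeight (2 * t) N s ^ 4 := by ring
        _ ≤ 1 * 1 := by gcongr
        _ = 1 := one_mul _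
    calc _ ≤ 1 * 1 * (C * Real.sqrt s * Real.exp (-s / 2)) := by
          gcongr
          · exact hG s hs
          · exact (hCb s hs).2.1
      _ = _ := by ring

theorem norm_integral_le_abs (h : RadialPair k N w v) {G : ℝ → ℂ} {K : ℝ}
    (hG : ∀ s > 0, ‖G s‖ ≤ K) : ‖∫ s in Ioi 0, G s * w s‖ ≤ K * (5 * Real.sqrt N) := by
  have hK : 0 ≤ K := (norm_nonneg _).trans (hG 1 one_pos)
  refine (h.intLe_abs.const_mul hK).norm_integral_le fun s hs => ?_
  rw [norm_mul, Complex.norm_real, Real.norm_eq_abs]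
  gcongr
  exact hG s hs

/-- Pairing an eigenfunction with a bounded function having one bounded derivative. -/
theorem norm_integral_le (h : RadialPair k N w v) {G G' : ℝ → ℂ} {K : ℝ} (hK : 0 < K)
    (hd : ∀ s > 0, HasDerivAt G (G' s) s) (hc : ContinuousOn G' (Ioi 0))
    (hG : ∀ s > 0, ‖G s‖ ≤ K) (hG' : ∀ s > 0, Real.sqrt s * ‖G' s‖ ≤ K)
    (hGk : ∀ s > 0, k * ‖G s‖ ≤ k * (K * Real.sqrt s)) :
    ‖∫ s in Ioi 0, G s * w s‖ ≤ 4000 * K * (k + 1) := by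
  rcases le_total (k ^ 2) N with hk | hk
  · have hKc : (K : ℂ) ≠ 0 := by exact_mod_cast hK.ne'
    have hn : ‖((K : ℂ))⁻¹‖ = K⁻¹ := by
      rw [norm_inv, Complex.norm_real, Real.norm_of_nonneg hK.le]
    have := h.norm_integral_le_of_sq_le hk (G := fun s => (K : ℂ)⁻¹ * G s)
      (G' := fun s => (K : ℂ)⁻¹ * G' s) (fun s hs => (hd s hs).const_mul _)
      (continuousOn_const.mul hc)
      (fun s hs => by
        rw [norm_mul, hn, inv_mul_le_iff₀ hK, mul_one]; exact hG s hs)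
      (fun s hs => by
        rw [norm_mul, hn, mul_left_comm, inv_mul_le_iff₀ hK, mul_one]; exact hG' s hs)
      (fun s hs => by
        rw [norm_mul, hn, mul_left_comm, inv_mul_le_iff₀ hK]
        calc _ ≤ _ := hGk s hs
          _ = _ := by ring)
    simp only [mul_assoc] at this
    rw [integral_const_mul, norm_mul, hn, inv_mul_le_iff₀ hK] at this
    calc _ ≤ _ := this
      _ = _ := by ring
  -- For `k² ≥ N` no oscillation is needed: the size bound `5K√N` is at most `5Kk`.
  · refine (h.norm_integral_le_abs hG).trans ?_
    have h1 : Real.sqrt N ≤ k := by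
      rw [← Real.sqrt_sq h.k_nonneg]
      exact Real.sqrt_le_sqrt hk
    have := h.k_nonneg
    nlinarith

end RadialPair

/-! ### Hermite functions and their cross-Wigner functions -/

/-- The normalized Hermite function at `hbar = 1`. -/
noncomputable def hermiteOne (j : ℕ) (u : ℝ) : ℝ :=
  Real.pi ^ (-(1 / 4) : ℝ) / Real.sqrt (j.factorial : ℝ) *
    (Polynomial.aeval (Real.sqrt 2 * u) (Polynomial.hermite j) : ℝ) * Real.exp (-(u ^ 2) / 2)

theorem hermiteFun_eq {hbar : ℝ} (h : 0 < hbar) (j : ℕ) (x : ℝ) :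
    hermiteFun hbar j x = ((hbar ^ (-(1 / 4) : ℝ) * hermiteOne j (x / Real.sqrt hbar) : ℝ) : ℂ) := by
  have h0 : 0 < Real.sqrt hbar := Real.sqrt_pos.2 h
  rw [hermiteFun, hermiteOne, Real.mul_rpow Real.pi_pos.le h.le, Real.sqrt_div zero_le_two]
  have e1 : Real.sqrt 2 * (x / Real.sqrt hbar) = Real.sqrt 2 / Real.sqrt hbar * x := by ring
  have e2 : -(x / Real.sqrt hbar) ^ 2 / 2 = -x ^ 2 / (2 * hbar) := by
    rw [div_pow, Real.sq_sqrt h.le]; field_simp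
  rw [e1, e2]
  congr 1
  ring

/-- This is the creation operator, from `He_{j+1} = X He_j - He_j'`. Only the raised index occurs,
so every family below can be built from the ground state without a lowering relation. -/
theorem hasDerivAt_hermiteOne (j : ℕ) (u : ℝ) :
    HasDerivAt (hermiteOne j)
      (u * hermiteOne j u - Real.sqrt (2 * (j + 1)) * hermiteOne (j + 1) u) u := by
  set p : Polynomial ℝ := (Polynomial.hermite j).map (Int.castRingHom ℝ) with hp
  have hev : ∀ (q : Polynomial ℤ) (x : ℝ), (Polynomial.aeval x q : ℝ) =
      (q.map (Int.castRingHom ℝ)).eval x := fun q x => by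
    rw [Polynomial.eval_map, Polynomial.aeval_def]; rfl
  have h1 : HasDerivAt (fun u : ℝ => Real.sqrt 2 * u) (Real.sqrt 2) u := by
    simpa using (hasDerivAt_id u).const_mul (Real.sqrt 2)
  have h2 : HasDerivAt (fun u : ℝ => Real.exp (-(u ^ 2) / 2)) (Real.exp (-(u ^ 2) / 2) * (-u)) u := by
    have : HasDerivAt (fun u : ℝ => -(u ^ 2) / 2) (-u) u := by
      refine (((hasDerivAt_id u).pow 2).neg.div_const 2).congr_deriv ?_
      simp
      ring
    exact this.exp
  have h3 := (((p.hasDerivAt (Real.sqrt 2 * u)).comp u h1).const_mul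
    (Real.pi ^ (-(1 / 4) : ℝ) / Real.sqrt (j.factorial : ℝ))).mul h2
  have e : hermiteOne j = fun u => Real.pi ^ (-(1 / 4) : ℝ) / Real.sqrt (j.factorial : ℝ) *
      p.eval (Real.sqrt 2 * u) * Real.exp (-(u ^ 2) / 2) := by
    ext u; rw [hermiteOne, hev]
  rw [e]
  refine h3.congr_deriv ?_
  rw [hermiteOne, hev, Polynomial.hermite_succ]
  simp only [Polynomial.map_sub, Polynomial.map_mul, Polynomial.map_X, Polynomial.eval_sub,
    Polynomial.eval_mul, Polynomial.eval_X, ← Polynomial.derivative_map, ← hp, Function.comp]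
  have hs2 : Real.sqrt 2 * Real.sqrt 2 = 2 := Real.mul_self_sqrt zero_le_two
  have hj : (0 : ℝ) < Real.sqrt (j + 1) := Real.sqrt_pos.2 (by positivity)
  have hf : (0 : ℝ) < Real.sqrt (j.factorial : ℝ) := Real.sqrt_pos.2 (by positivity)
  have hfac : Real.sqrt ((j + 1).factorial : ℝ) =
      Real.sqrt (j + 1) * Real.sqrt (j.factorial : ℝ) := by
    rw [Nat.factorial_succ, ← Real.sqrt_mul (by positivity)]
    push_cast; rfl
  rw [hfac, Real.sqrt_mul zero_le_two]
  field_simp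
  linear_combination (u * Polynomial.eval (Real.sqrt 2 * u) p) * hs2

theorem exists_eval_mul_exp_le (p : Polynomial ℝ) {c : ℝ} (hc : 0 < c) :
    ∃ K : ℝ, 0 < K ∧ ∀ u : ℝ, |p.eval u| * Real.exp (-(c * u ^ 2)) ≤ K := by
  induction p using Polynomial.induction_on' with
  | add p q hp hq =>
    obtain ⟨K, hK, h1⟩ := hp
    obtain ⟨L, hL, h2⟩ := hq
    refine ⟨K + L, by positivity, fun u => ?_⟩
    rw [Polynomial.eval_add]
    have := Real.exp_pos (-(c * u ^ 2))
    calc _ ≤ (|p.eval u| + |q.eval u|) * Real.exp (-(c * u ^ 2)) := by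
          gcongr; exact abs_add_le _ _
      _ ≤ K + L := by rw [add_mul]; exact add_le_add (h1 u) (h2 u)
  | monomial n a =>
    obtain ⟨K, hK, h⟩ := one_add_pow_mul_exp_le n hc
    refine ⟨(|a| + 1) * K, by positivity, fun u => ?_⟩
    rw [Polynomial.eval_monomial, abs_mul, abs_pow]
    have h1 : |u| ≤ 1 + u ^ 2 := by
      rw [← sq_abs]; nlinarith [sq_nonneg (|u| - 1)]
    calc |a| * |u| ^ n * Real.exp (-(c * u ^ 2))
        ≤ (|a| + 1) * (1 + u ^ 2) ^ n * Real.exp (-(c * u ^ 2)) := by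
          gcongr
          linarith
      _ = (|a| + 1) * ((1 + u ^ 2) ^ n * Real.exp (-(c * u ^ 2))) := by ring
      _ ≤ _ := by gcongr; exact h _ (sq_nonneg u)

theorem exists_abs_hermiteOne_le (j : ℕ) :
    ∃ K : ℝ, 0 < K ∧ ∀ u, |hermiteOne j u| ≤ K * Real.exp (-(u ^ 2) / 4) := by
  obtain ⟨K, hK, h⟩ := exists_eval_mul_exp_le
    ((Polynomial.C (Real.pi ^ (-(1 / 4) : ℝ) / Real.sqrt (j.factorial : ℝ))) *
      ((Polynomial.hermite j).map (Int.castRingHom ℝ)).comp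
      (Polynomial.C (Real.sqrt 2) * Polynomial.X)) (c := 1 / 4) (by norm_num)
  refine ⟨K, hK, fun u => ?_⟩
  have e : hermiteOne j u = (Polynomial.C (Real.pi ^ (-(1 / 4) : ℝ) / Real.sqrt (j.factorial : ℝ)) *
      ((Polynomial.hermite j).map (Int.castRingHom ℝ)).comp
      (Polynomial.C (Real.sqrt 2) * Polynomial.X)).eval u * Real.exp (-(1 / 4 * u ^ 2)) *
      Real.exp (-(u ^ 2) / 4) := by
    rw [hermiteOne, mul_assoc _ (Real.exp _) (Real.exp _), ← Real.exp_add]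
    simp only [Polynomial.eval_mul, Polynomial.eval_C, Polynomial.eval_comp, Polynomial.eval_X,
      Polynomial.eval_map, Polynomial.aeval_def]
    congr 2
    ring
  rw [e, abs_mul, abs_mul, Real.abs_exp, Real.abs_exp]
  gcongr
  exact h u

theorem continuous_hermiteOne (j : ℕ) : Continuous (hermiteOne j) :=
  continuous_iff_continuousAt.2 fun u => (hasDerivAt_hermiteOne j u).continuousAt

/-- The product `h_j(x - y/2) h_m(x + y/2)`. -/
noncomputable def hermitePair (j m : ℕ) (x y : ℝ) : ℝ :=
  hermiteOne j (x - y / 2) * hermiteOne m (x + y / 2)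

/-- The parallelogram identity `(x-y/2)² + (x+y/2)² = 2x² + y²/2` gives a Gaussian in `y` uniform in
`x`, as needed to differentiate under the integral. -/
theorem exists_abs_hermitePair_le (j m : ℕ) :
    ∃ K : ℝ, 0 < K ∧ ∀ x y, |hermitePair j m x y| ≤ K * Real.exp (-(1 / 8 * y ^ 2)) := by
  obtain ⟨K, hK, h1⟩ := exists_abs_hermiteOne_le j
  obtain ⟨L, hL, h2⟩ := exists_abs_hermiteOne_le m
  refine ⟨K * L, by positivity, fun x y => ?_⟩
  rw [hermitePair, abs_mul]
  calc _ ≤ (K * Real.exp (-((x - y / 2) ^ 2) / 4)) * (L * Real.exp (-((x + y / 2) ^ 2) / 4)) :=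
        mul_le_mul (h1 _) (h2 _) (abs_nonneg _) (by positivity)
    _ = K * L * Real.exp (-(x ^ 2) / 2 - 1 / 8 * y ^ 2) := by
        rw [show K * Real.exp (-((x - y / 2) ^ 2) / 4) * (L * Real.exp (-((x + y / 2) ^ 2) / 4)) =
          K * L * (Real.exp (-((x - y / 2) ^ 2) / 4) * Real.exp (-((x + y / 2) ^ 2) / 4)) by ring,
          ← Real.exp_add]
        congr 2; ring
    _ ≤ _ := by
        gcongr
        nlinarith [sq_nonneg x]

theorem continuous_hermitePair (j m : ℕ) :
    Continuous fun p : ℝ × ℝ => hermitePair j m p.1 p.2 := by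
  have h1 := continuous_hermiteOne j
  have h2 := continuous_hermiteOne m
  unfold hermitePair
  fun_prop

theorem continuous_hermitePair_right (j m : ℕ) (x : ℝ) :
    Continuous fun y => hermitePair j m x y :=
  (continuous_hermitePair j m).comp (Continuous.prodMk continuous_const continuous_id)

theorem hasDerivAt_hermitePair_fst (j m : ℕ) (x y : ℝ) :
    HasDerivAt (fun x => hermitePair j m x y)
      (2 * x * hermitePair j m x y - Real.sqrt (2 * (j + 1)) * hermitePair (j + 1) m x y -
        Real.sqrt (2 * (m + 1)) * hermitePair j (m + 1) x y) x := by
  have h1 : HasDerivAt (fun x : ℝ => x - y / 2) 1 x := (hasDerivAt_id x).sub_const _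
  have h2 : HasDerivAt (fun x : ℝ => x + y / 2) 1 x := (hasDerivAt_id x).add_const _
  have := ((hasDerivAt_hermiteOne j (x - y / 2)).comp x h1).mul
    ((hasDerivAt_hermiteOne m (x + y / 2)).comp x h2)
  refine this.congr_deriv ?_
  simp only [hermitePair, Function.comp]
  ring

theorem hasDerivAt_hermitePair_snd (j m : ℕ) (x y : ℝ) :
    HasDerivAt (fun y => hermitePair j m x y)
      (1 / 2 * (y * hermitePair j m x y + Real.sqrt (2 * (j + 1)) * hermitePair (j + 1) m x y -
        Real.sqrt (2 * (m + 1)) * hermitePair j (m + 1) x y)) y := by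
  have h1 : HasDerivAt (fun y : ℝ => x - y / 2) (-(1 / 2)) y := by
    simpa using ((hasDerivAt_id y).div_const 2).const_sub x
  have h2 : HasDerivAt (fun y : ℝ => x + y / 2) (1 / 2) y := by
    simpa using ((hasDerivAt_id y).div_const 2).const_add x
  have := ((hasDerivAt_hermiteOne j (x - y / 2)).comp y h1).mul
    ((hasDerivAt_hermiteOne m (x + y / 2)).comp y h2)
  refine this.congr_deriv ?_
  simp only [hermitePair, Function.comp]
  ring

/-- `2π` times the Wigner function of `|h_m⟩⟨h_j|` at `hbar = 1`. -/
noncomputable def crossWigner (j m : ℕ) (x ξ : ℝ) : ℂ :=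
  ∫ y : ℝ, Complex.exp (Complex.I * ξ * y) * (hermitePair j m x y : ℂ)

/-- The first `y`-moment of the integrand of `crossWigner`. -/
noncomputable def crossMoment (j m : ℕ) (x ξ : ℝ) : ℂ :=
  ∫ y : ℝ, Complex.exp (Complex.I * ξ * y) * ((y * hermitePair j m x y : ℝ) : ℂ)

theorem norm_exp_phase (ξ y : ℝ) : ‖Complex.exp (Complex.I * ξ * y)‖ = 1 := by
  rw [show Complex.I * (ξ : ℂ) * y = ((ξ * y : ℝ) : ℂ) * Complex.I by push_cast; ring]
  exact Complex.norm_exp_ofReal_mul_I _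

theorem integrable_gauss_eighth : Integrable fun y : ℝ => Real.exp (-(1 / 8 * y ^ 2)) := by
  simpa [neg_mul] using integrable_exp_neg_mul_sq (b := 1 / 8) (by norm_num)

theorem integrable_abs_mul_gauss_eighth :
    Integrable fun y : ℝ => |y| * Real.exp (-(1 / 8 * y ^ 2)) := by
  have := (integrable_mul_exp_neg_mul_sq (b := 1 / 8) (by norm_num)).abs
  simpa [abs_mul, neg_mul] using this

theorem integrable_crossWigner (j m : ℕ) (x ξ : ℝ) :
    Integrable fun y : ℝ => Complex.exp (Complex.I * ξ * y) * (hermitePair j m x y : ℂ) := by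
  obtain ⟨K, hK, h⟩ := exists_abs_hermitePair_le j m
  refine (integrable_gauss_eighth.const_mul K).mono' ?_ (Eventually.of_forall fun y => ?_)
  · have : Continuous fun y => hermitePair j m x y :=
      continuous_hermitePair_right j m x
    exact Continuous.aestronglyMeasurable (by fun_prop)
  · rw [norm_mul, norm_exp_phase, one_mul, Complex.norm_real]
    exact h x y

theorem integrable_crossMoment (j m : ℕ) (x ξ : ℝ) :
    Integrable fun y : ℝ =>
      Complex.exp (Complex.I * ξ * y) * ((y * hermitePair j m x y : ℝ) : ℂ) := by
  obtain ⟨K, hK, h⟩ := exists_abs_hermitePair_le j m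
  refine (integrable_abs_mul_gauss_eighth.const_mul K).mono' ?_ (Eventually.of_forall fun y => ?_)
  · have : Continuous fun y => hermitePair j m x y :=
      continuous_hermitePair_right j m x
    exact Continuous.aestronglyMeasurable (by fun_prop)
  · rw [norm_mul, norm_exp_phase, one_mul, Complex.norm_real, Real.norm_eq_abs, abs_mul]
    calc |y| * |hermitePair j m x y| ≤ |y| * (K * Real.exp (-(1 / 8 * y ^ 2))) := by
          gcongr; exact h x y
      _ = _ := by ring

/-- Together with the formula in `ξ`, this says that `∂x - i∂ξ` raises `j` alone and `∂x + i∂ξ`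
raises `m` alone, up to multiplication by `2z̄` and `2z` respectively. -/
theorem hasDerivAt_crossWigner_fst (j m : ℕ) (x ξ : ℝ) :
    HasDerivAt (fun x => crossWigner j m x ξ)
      (2 * x * crossWigner j m x ξ - Real.sqrt (2 * (j + 1)) * crossWigner (j + 1) m x ξ -
        Real.sqrt (2 * (m + 1)) * crossWigner j (m + 1) x ξ) x := by
  obtain ⟨K, hK, h⟩ := exists_abs_hermitePair_le j m
  obtain ⟨K₁, hK₁, h₁⟩ := exists_abs_hermitePair_le (j + 1) m
  obtain ⟨K₂, hK₂, h₂⟩ := exists_abs_hermitePair_le j (m + 1)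
  set a := Real.sqrt (2 * (j + 1))
  set b := Real.sqrt (2 * (m + 1))
  have ha : 0 ≤ a := Real.sqrt_nonneg _
  have hb : 0 ≤ b := Real.sqrt_nonneg _
  have key := hasDerivAt_integral_of_dominated_loc_of_deriv_le (μ := volume) (x₀ := x)
    (s := Metric.ball x 1)
    (F := fun x y => Complex.exp (Complex.I * ξ * y) * (hermitePair j m x y : ℂ))
    (F' := fun x y => Complex.exp (Complex.I * ξ * y) * ((2 * x * hermitePair j m x y -
      a * hermitePair (j + 1) m x y - b * hermitePair j (m + 1) x y : ℝ) : ℂ))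
    (bound := fun y => (2 * (|x| + 1) * K + a * K₁ + b * K₂) * Real.exp (-(1 / 8 * y ^ 2)))
    (Metric.ball_mem_nhds x one_pos)
    (Eventually.of_forall fun x' => (integrable_crossWigner j m x' ξ).aestronglyMeasurable)
    (integrable_crossWigner j m x ξ) ?_ (Eventually.of_forall fun y x' hx' => ?_)
    (integrable_gauss_eighth.const_mul _) (Eventually.of_forall fun y x' _ => ?_)
  · refine key.2.congr_deriv ?_
    simp only [crossWigner]
    rw [← integral_const_mul, ← integral_const_mul, ← integral_const_mul, ← integral_sub,
      ← integral_sub]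
    · congr 1
      ext y
      push_cast
      ring
    · exact ((integrable_crossWigner j m x ξ).const_mul _).sub
        ((integrable_crossWigner (j + 1) m x ξ).const_mul _)
    · exact (integrable_crossWigner j (m + 1) x ξ).const_mul _
    · exact (integrable_crossWigner j m x ξ).const_mul _
    · exact (integrable_crossWigner (j + 1) m x ξ).const_mul _
  · have c1 : Continuous fun y => hermitePair j m x y :=
      continuous_hermitePair_right j m x
    have c2 : Continuous fun y => hermitePair (j + 1) m x y :=
      continuous_hermitePair_right (j + 1) m x
    have c3 : Continuous fun y => hermitePair j (m + 1) x y :=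
      continuous_hermitePair_right j (m + 1) x
    exact Continuous.aestronglyMeasurable (by fun_prop)
  · rw [norm_mul, norm_exp_phase, one_mul, Complex.norm_real, Real.norm_eq_abs]
    have hx : |x'| ≤ |x| + 1 := by
      rw [Metric.mem_ball, Real.dist_eq] at hx'
      have := abs_sub_abs_le_abs_sub x' x
      linarith
    set E := Real.exp (-(1 / 8 * y ^ 2))
    calc _ ≤ |2 * x' * hermitePair j m x' y| + |a * hermitePair (j + 1) m x' y| +
          |b * hermitePair j (m + 1) x' y| :=
          (abs_sub _ _).trans (add_le_add_left (abs_sub _ _) _)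
      _ ≤ 2 * (|x| + 1) * (K * E) + a * (K₁ * E) + b * (K₂ * E) := by
          rw [abs_mul, abs_mul, abs_mul a, abs_mul b, abs_of_nonneg ha, abs_of_nonneg hb, abs_two]
          gcongr
          · exact h x' y
          · exact h₁ x' y
          · exact h₂ x' y
      _ = _ := by ring
  · exact (hasDerivAt_hermitePair_fst j m x' y).ofReal_comp.const_mul _

theorem hasDerivAt_phase_left (ξ y : ℝ) :
    HasDerivAt (fun ξ : ℝ => Complex.exp (Complex.I * ξ * y))
      (Complex.exp (Complex.I * ξ * y) * (Complex.I * y)) ξ := by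
  have : HasDerivAt (fun ξ : ℝ => Complex.I * (ξ : ℂ) * y) (Complex.I * y) ξ := by
    simpa using (((hasDerivAt_id ξ).ofReal_comp).const_mul Complex.I).mul_const (y : ℂ)
  exact this.cexp

theorem hasDerivAt_phase_right (ξ y : ℝ) :
    HasDerivAt (fun y : ℝ => Complex.exp (Complex.I * ξ * y))
      (Complex.exp (Complex.I * ξ * y) * (Complex.I * ξ)) y := by
  have : HasDerivAt (fun y : ℝ => Complex.I * (ξ : ℂ) * y) (Complex.I * ξ) y := by
    simpa using ((hasDerivAt_id y).ofReal_comp).const_mul (Complex.I * (ξ : ℂ))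
  exact this.cexp

/-- The integral of the `y`-derivative of the integrand of `crossWigner` vanishes. Solving for the
moment removes the factor `y` created by differentiating in `ξ`. -/
theorem crossMoment_eq (j m : ℕ) (x ξ : ℝ) :
    crossMoment j m x ξ = -(2 * Complex.I * ξ * crossWigner j m x ξ) -
      Real.sqrt (2 * (j + 1)) * crossWigner (j + 1) m x ξ +
      Real.sqrt (2 * (m + 1)) * crossWigner j (m + 1) x ξ := by
  set a := Real.sqrt (2 * (j + 1))
  set b := Real.sqrt (2 * (m + 1))
  have i0 := (integrable_crossWigner j m x ξ).const_mul (Complex.I * ξ)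
  have i1 := (integrable_crossMoment j m x ξ).const_mul (1 / 2)
  have i2 := (integrable_crossWigner (j + 1) m x ξ).const_mul (a / 2)
  have i3 := (integrable_crossWigner j (m + 1) x ξ).const_mul (b / 2)
  have i01 := i0.add i1
  have i012 := i01.add i2
  have i0123 := i012.sub i3
  have key := integral_eq_zero_of_hasDerivAt_of_integrable
    (f := fun y : ℝ => Complex.exp (Complex.I * ξ * y) * (hermitePair j m x y : ℂ))
    (fun y => ?_) i0123 (integrable_crossWigner j m x ξ)
  · have e3 := integral_sub i012 i3
    have e2 := integral_add i01 i2
    have e1 := integral_add i0 i1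
    simp only [Pi.add_apply, Pi.sub_apply] at e1 e2 e3 key
    rw [e3, e2, e1, integral_const_mul, integral_const_mul, integral_const_mul,
      integral_const_mul] at key
    simp only [crossMoment, crossWigner]
    linear_combination 2 * key
  · have := (hasDerivAt_phase_right ξ y).mul (hasDerivAt_hermitePair_snd j m x y).ofReal_comp
    refine this.congr_deriv ?_
    simp only [Pi.add_apply, Pi.sub_apply]
    push_cast
    ring

theorem hasDerivAt_crossWigner_snd (j m : ℕ) (x ξ : ℝ) :
    HasDerivAt (fun ξ => crossWigner j m x ξ)
      (2 * ξ * crossWigner j m x ξ -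
        Complex.I * Real.sqrt (2 * (j + 1)) * crossWigner (j + 1) m x ξ +
        Complex.I * Real.sqrt (2 * (m + 1)) * crossWigner j (m + 1) x ξ) ξ := by
  obtain ⟨K, hK, h⟩ := exists_abs_hermitePair_le j m
  have key := hasDerivAt_integral_of_dominated_loc_of_deriv_le (μ := volume) (x₀ := ξ)
    (s := univ)
    (F := fun (ξ : ℝ) (y : ℝ) => Complex.exp (Complex.I * ξ * y) * (hermitePair j m x y : ℂ))
    (F' := fun (ξ : ℝ) (y : ℝ) => Complex.I * (Complex.exp (Complex.I * ξ * y) *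
      ((y * hermitePair j m x y : ℝ) : ℂ)))
    (bound := fun y => K * (|y| * Real.exp (-(1 / 8 * y ^ 2))))
    univ_mem
    (Eventually.of_forall fun ξ' => (integrable_crossWigner j m x ξ').aestronglyMeasurable)
    (integrable_crossWigner j m x ξ)
    ((integrable_crossMoment j m x ξ).const_mul Complex.I).aestronglyMeasurable
    (Eventually.of_forall fun y ξ' _ => ?_)
    (integrable_abs_mul_gauss_eighth.const_mul _) (Eventually.of_forall fun y ξ' _ => ?_)
  · refine key.2.congr_deriv ?_
    rw [integral_const_mul]
    have := crossMoment_eq j m x ξ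
    rw [crossMoment] at this
    rw [this]
    linear_combination -2 * ξ * crossWigner j m x ξ * Complex.I_sq
  · rw [norm_mul, norm_mul, norm_exp_phase, Complex.norm_I, one_mul, one_mul, Complex.norm_real,
      Real.norm_eq_abs, abs_mul]
    calc |y| * |hermitePair j m x y| ≤ |y| * (K * Real.exp (-(1 / 8 * y ^ 2))) := by
          gcongr; exact h x y
      _ = _ := by ring
  · refine ((hasDerivAt_phase_left ξ' y).mul_const (hermitePair j m x y : ℂ)).congr_deriv ?_
    push_cast
    ring

/-- Substitute `y ↦ -y`. This reduces `m < j` to the case `j ≤ m`. -/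
theorem crossWigner_conj (j m : ℕ) (x ξ : ℝ) :
    crossWigner j m x ξ = (starRingEnd ℂ) (crossWigner m j x ξ) := by
  rw [crossWigner, crossWigner, ← integral_conj, ← integral_neg_eq_self]
  congr 1
  ext y
  rw [map_mul, ← Complex.exp_conj, Complex.conj_ofReal]
  simp only [map_mul, Complex.conj_I, Complex.conj_ofReal]
  have : hermitePair j m x (-y) = hermitePair m j x y := by
    simp only [hermitePair]
    rw [mul_comm]
    congr 2 <;> ring
  rw [this]
  congr 2
  push_cast
  ring

theorem crossWigner_zero_zero (x ξ : ℝ) :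
    crossWigner 0 0 x ξ = ((2 * Real.exp (-(x ^ 2 + ξ ^ 2)) : ℝ) : ℂ) := by
  have e : ∀ y : ℝ, Complex.exp (Complex.I * ξ * y) * (hermitePair 0 0 x y : ℂ) =
      ((Real.pi ^ (-(1 / 2) : ℝ) * Real.exp (-x ^ 2) : ℝ) : ℂ) *
        (Complex.exp (Complex.I * ξ * y) * Complex.exp (-(1 / 4 : ℂ) * y ^ 2)) := by
    intro y
    have h1 : hermitePair 0 0 x y =
        Real.pi ^ (-(1 / 2) : ℝ) * Real.exp (-x ^ 2) * Real.exp (-(1 / 4) * y ^ 2) := by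
      have h2 : Real.pi ^ (-(1 / 2) : ℝ) = Real.pi ^ (-(1 / 4) : ℝ) * Real.pi ^ (-(1 / 4) : ℝ) := by
        rw [← Real.rpow_add Real.pi_pos]; norm_num
      rw [h2, mul_assoc (_ * _), ← Real.exp_add]
      simp only [hermitePair, hermiteOne, Polynomial.hermite_zero, Nat.factorial_zero]
      simp only [Nat.cast_one, Real.sqrt_one, div_one, map_one, mul_one]
      rw [mul_mul_mul_comm, ← Real.exp_add]
      congr 2
      ring
    rw [h1]
    push_cast
    ring
  rw [crossWigner]
  simp only [e]
  rw [integral_const_mul, fourierIntegral_gaussian (b := 1 / 4) (by norm_num)]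
  have h3 : ((Real.pi : ℂ) / (1 / 4)) ^ (1 / 2 : ℂ) = ((2 * Real.pi ^ (1 / 2 : ℝ) : ℝ) : ℂ) := by
    have : (Real.pi : ℂ) / (1 / 4) = ((4 * Real.pi : ℝ) : ℂ) := by push_cast; ring
    rw [this]
    have h5 : (1 / 2 : ℂ) = ((1 / 2 : ℝ) : ℂ) := by push_cast; rfl
    rw [h5, ← Complex.ofReal_cpow (by positivity), Real.mul_rpow (by norm_num) Real.pi_pos.le]
    congr 2
    rw [← Real.sqrt_eq_rpow, show (4 : ℝ) = 2 ^ 2 by norm_num, Real.sqrt_sq zero_le_two]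
  have h4 : Complex.exp (-(ξ : ℂ) ^ 2 / (4 * (1 / 4))) = ((Real.exp (-ξ ^ 2) : ℝ) : ℂ) := by
    push_cast
    congr 1
    ring
  rw [h3, h4, ← Complex.ofReal_mul, ← Complex.ofReal_mul]
  congr 1
  have h6 : Real.pi ^ (-(1 / 2) : ℝ) * Real.pi ^ (1 / 2 : ℝ) = 1 := by
    rw [← Real.rpow_add Real.pi_pos]; norm_num
  rw [show -(x ^ 2 + ξ ^ 2) = -x ^ 2 + -ξ ^ 2 by ring, Real.exp_add]
  linear_combination 2 * Real.exp (-x ^ 2) * Real.exp (-ξ ^ 2) * h6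

end HermiteWigner

/-! ### The Laguerre form of the cross-Wigner functions -/

namespace HermiteWigner

open Set Filter Topology Polynomial

theorem polyBdd_eval (p : ℝ[X]) : PolyBdd fun s => p.eval s := by
  induction p using Polynomial.induction_on' with
  | add p q hp hq => simpa using hp.add hq
  | monomial n a => simpa using (polyBdd_const a).mul (polyBdd_id.pow n)

theorem integrableOn_polyBdd_mul_exp {f : ℝ → ℝ} (hf : PolyBdd f) (hc : Continuous f) :
    IntegrableOn (fun s => f s * Real.exp (-(2 * s))) (Ioi 0) := by
  obtain ⟨K, hK, h⟩ := hf.mul_exp_le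
  refine integrableOn_of_norm_le_exp (K := K) (by fun_prop) fun s hs => ?_
  rw [norm_mul, Real.norm_eq_abs, Real.norm_eq_abs, Real.abs_exp]
  refine le_trans ?_ (h s hs)
  gcongr
  linarith

/-- `Q` is the radial polynomial of the Wigner function of `|h_{j+k}⟩⟨h_j|`: a multiple of a
Laguerre polynomial. -/
structure LaguerreForm (j k : ℕ) (Q : ℝ[X]) : Prop where
  form : ∀ x ξ : ℝ, crossWigner j (j + k) x ξ = ((x : ℂ) + ξ * Complex.I) ^ k *
    ((Q.eval (x ^ 2 + ξ ^ 2) * Real.exp (-(x ^ 2 + ξ ^ 2)) : ℝ) : ℂ)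
  ode : X * derivative (derivative Q) + (C ((k : ℝ) + 1) - 2 * X) * derivative Q +
    C (2 * (j : ℝ)) * Q = 0
  norm_sq : ∫ s in Ioi (0 : ℝ), s ^ k * Q.eval s ^ 2 * Real.exp (-(2 * s)) = 2

theorem hasDerivAt_radial (Q : ℝ[X]) (s : ℝ) :
    HasDerivAt (fun s => Q.eval s * Real.exp (-s))
      ((derivative Q - Q).eval s * Real.exp (-s)) s := by
  have := (Q.hasDerivAt s).mul ((hasDerivAt_neg' s).exp)
  refine this.congr_deriv ?_
  rw [eval_sub]
  ring

/-- The partial derivatives of `z ^ k q(|z|²)`. -/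
theorem hasDerivAt_form_fst (k : ℕ) (Q : ℝ[X]) (x ξ : ℝ) :
    HasDerivAt (fun x : ℝ => ((x : ℂ) + ξ * Complex.I) ^ k *
        ((Q.eval (x ^ 2 + ξ ^ 2) * Real.exp (-(x ^ 2 + ξ ^ 2)) : ℝ) : ℂ))
      (k * ((x : ℂ) + ξ * Complex.I) ^ (k - 1) *
        ((Q.eval (x ^ 2 + ξ ^ 2) * Real.exp (-(x ^ 2 + ξ ^ 2)) : ℝ) : ℂ) +
       ((x : ℂ) + ξ * Complex.I) ^ k * (2 * x *
        (((derivative Q - Q).eval (x ^ 2 + ξ ^ 2) * Real.exp (-(x ^ 2 + ξ ^ 2)) : ℝ) : ℂ))) x := by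
  have h1 : HasDerivAt (fun x : ℝ => (x : ℂ) + ξ * Complex.I) 1 x := by
    simpa using ((hasDerivAt_id x).ofReal_comp).add_const (ξ * Complex.I)
  have h2 : HasDerivAt (fun x : ℝ => x ^ 2 + ξ ^ 2) (2 * x) x := by
    simpa using (hasDerivAt_pow 2 x).add_const (ξ ^ 2)
  have h3 := ((hasDerivAt_radial Q (x ^ 2 + ξ ^ 2)).comp x h2).ofReal_comp
  refine ((h1.pow k).mul h3).congr_deriv ?_
  simp only [Function.comp, Pi.pow_apply]
  push_cast
  ring

theorem hasDerivAt_form_snd (k : ℕ) (Q : ℝ[X]) (x ξ : ℝ) :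
    HasDerivAt (fun ξ : ℝ => ((x : ℂ) + ξ * Complex.I) ^ k *
        ((Q.eval (x ^ 2 + ξ ^ 2) * Real.exp (-(x ^ 2 + ξ ^ 2)) : ℝ) : ℂ))
      (k * ((x : ℂ) + ξ * Complex.I) ^ (k - 1) * Complex.I *
        ((Q.eval (x ^ 2 + ξ ^ 2) * Real.exp (-(x ^ 2 + ξ ^ 2)) : ℝ) : ℂ) +
       ((x : ℂ) + ξ * Complex.I) ^ k * (2 * ξ *
        (((derivative Q - Q).eval (x ^ 2 + ξ ^ 2) * Real.exp (-(x ^ 2 + ξ ^ 2)) : ℝ) : ℂ))) ξ := by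
  have h1 : HasDerivAt (fun ξ : ℝ => (x : ℂ) + ξ * Complex.I) Complex.I ξ := by
    simpa using (((hasDerivAt_id ξ).ofReal_comp).mul_const Complex.I).const_add (x : ℂ)
  have h2 : HasDerivAt (fun ξ : ℝ => x ^ 2 + ξ ^ 2) (2 * ξ) ξ := by
    simpa using (hasDerivAt_pow 2 ξ).const_add (x ^ 2)
  have h3 := ((hasDerivAt_radial Q (x ^ 2 + ξ ^ 2)).comp ξ h2).ofReal_comp
  refine ((h1.pow k).mul h3).congr_deriv ?_
  simp only [Function.comp, Pi.pow_apply]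
  push_cast
  ring

theorem hasDerivAt_neg_two_mul (s : ℝ) : HasDerivAt (fun s : ℝ => -(2 * s)) (-2) s := by
  simpa using ((hasDerivAt_id' s).const_mul 2).fun_neg

theorem laguerreForm_zero_zero : LaguerreForm 0 0 (C 2) where
  form x ξ := by
    rw [add_zero, crossWigner_zero_zero]
    simp
  ode := by simp
  norm_sq := by
    have h := integral_exp_mul_Ioi (a := (-2 : ℝ)) (by norm_num) 0
    have e : ∀ s : ℝ, s ^ 0 * (C (2 : ℝ)).eval s ^ 2 * Real.exp (-(2 * s)) =
        4 * Real.exp (-2 * s) := fun s => by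
      rw [eval_C]; ring_nf
    simp only [e]
    rw [integral_const_mul, h]
    norm_num

/-- `∂x + i∂ξ` annihilates `z^m` and multiplies the Gaussian by `-2z`, so raising `m` multiplies by
`2z/√(2(m+1))`. The normalisation is preserved by the Gamma recursion `2∫s^{m+1}e^{-2s} = (m+1)∫s^m
e^{-2s}`. -/
theorem LaguerreForm.raise {m : ℕ} {c : ℝ} (h : LaguerreForm 0 m (C c)) :
    LaguerreForm 0 (m + 1) (C (2 * c / Real.sqrt (2 * (m + 1)))) where
  form x ξ := by
    have hb : (0 : ℝ) < Real.sqrt (2 * (m + 1)) := Real.sqrt_pos.2 (by positivity)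
    have h1 := (hasDerivAt_crossWigner_fst 0 (0 + m) x ξ).unique
      ((hasDerivAt_form_fst m (C c) x ξ).congr_of_eventuallyEq
        (Eventually.of_forall fun x => h.form x ξ))
    have h2 := (hasDerivAt_crossWigner_snd 0 (0 + m) x ξ).unique
      ((hasDerivAt_form_snd m (C c) x ξ).congr_of_eventuallyEq
        (Eventually.of_forall fun ξ => h.form x ξ))
    rw [h.form] at h1 h2
    simp only [derivative_C, zero_sub, eval_neg, eval_C, Nat.cast_add, Nat.cast_zero] at h1 h2 ⊢
    simp only [zero_add] at h1 h2 ⊢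
    have hb' : (Real.sqrt (2 * (m + 1)) : ℂ) ≠ 0 := by exact_mod_cast hb.ne'
    push_cast at h1 h2 ⊢
    field_simp
    linear_combination (-1 / 2) * h1 - Complex.I / 2 * h2 +
      (1 / 2 * Real.sqrt (2 * (m + 1)) * crossWigner 0 (m + 1) x ξ -
        1 / 2 * m * (x + ξ * Complex.I) ^ (m - 1) * (c * Complex.exp (-(x ^ 2 + ξ ^ 2))) -
        1 / 2 * (Real.sqrt (2 * 1) : ℝ) * crossWigner 1 m x ξ) * Complex.I_sq
  ode := by simp
  norm_sq := by
    have hi1 := integrableOn_polyBdd_mul_exp (polyBdd_id.pow m) (by fun_prop)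
    have hi2 := integrableOn_polyBdd_mul_exp (polyBdd_id.pow (m + 1)) (by fun_prop)
    have hd : ∀ s : ℝ, s > 0 → HasDerivAt (fun s : ℝ => s ^ (m + 1) * Real.exp (-(2 * s)))
        ((m + 1) * (s ^ m * Real.exp (-(2 * s))) - 2 * (s ^ (m + 1) * Real.exp (-(2 * s)))) s := by
      intro s _
      have h2 : HasDerivAt (fun s : ℝ => -(2 * s)) (-2) s := hasDerivAt_neg_two_mul s
      refine ((hasDerivAt_pow (m + 1) s).mul h2.exp).congr_deriv ?_
      push_cast
      ring
    have i1 : IntegrableOn (fun s : ℝ => (m + 1) * (s ^ m * Real.exp (-(2 * s)))) (Ioi 0) :=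
      hi1.const_mul _
    have i2 : IntegrableOn (fun s : ℝ => 2 * (s ^ (m + 1) * Real.exp (-(2 * s)))) (Ioi 0) :=
      hi2.const_mul _
    have key := integral_Ioi_of_hasDerivAt_of_tendsto (a := 0)
      (f := fun s : ℝ => s ^ (m + 1) * Real.exp (-(2 * s))) (m := 0)
      (by fun_prop) hd (i1.sub i2) (by
        have h1 := ((Real.tendsto_pow_mul_exp_neg_atTop_nhds_zero (m + 1)).comp
          (tendsto_id.const_mul_atTop (show (0 : ℝ) < 2 by norm_num))).const_mul (1 / 2 ^ (m + 1))
        rw [mul_zero] at h1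
        refine h1.congr fun s => ?_
        simp only [Function.comp, id, mul_pow]
        field_simp)
    rw [integral_sub i1 i2, integral_const_mul, integral_const_mul] at key
    have hn := h.norm_sq
    simp only [eval_C] at hn ⊢
    have e1 : ∀ s : ℝ, s ^ m * c ^ 2 * Real.exp (-(2 * s)) =
      c ^ 2 * (s ^ m * Real.exp (-(2 * s))) := fun s => by ring
    have e2 : ∀ s : ℝ, s ^ (m + 1) * (2 * c / Real.sqrt (2 * (m + 1))) ^ 2 * Real.exp (-(2 * s)) =
      (2 * c / Real.sqrt (2 * (m + 1))) ^ 2 * (s ^ (m + 1) * Real.exp (-(2 * s))) :=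
      fun s => by ring
    simp only [e1, e2] at hn ⊢
    rw [integral_const_mul] at hn ⊢
    rw [div_pow, Real.sq_sqrt (by positivity)]
    simp only [ne_eq, Nat.succ_ne_zero, not_false_eq_true, zero_pow, zero_mul, sub_zero] at key
    field_simp
    linear_combination ((m : ℝ) + 1) / 2 * hn - c ^ 2 / 2 * key

theorem exists_laguerreForm_zero (m : ℕ) : ∃ c, LaguerreForm 0 m (C c) := by
  induction m with
  | zero => exact ⟨2, laguerreForm_zero_zero⟩
  | succ m ih => exact ⟨_, ih.choose_spec.raise⟩

/-- The polynomial obtained from `Q` by raising `j` and lowering `k + 1` to `k`. -/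
noncomputable def laguerreShift (k : ℕ) (Q : ℝ[X]) : ℝ[X] :=
  2 * X * Q - C ((k : ℝ) + 1) * Q - X * derivative Q

/-- Laguerre's equation written as a first-order system: the derivative undoes the shift. -/
theorem LaguerreForm.derivative_shift {j k : ℕ} {Q : ℝ[X]} (h : LaguerreForm j (k + 1) Q) :
    derivative (laguerreShift k Q) = C (2 * ((j : ℝ) + 1)) * Q := by
  have e := h.ode
  simp only [laguerreShift, derivative_sub, derivative_mul, derivative_C, derivative_X,
    derivative_ofNat]
  push_cast at e
  simp only [map_add, map_mul, map_one, map_ofNat] at e ⊢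
  linear_combination -e

/-- Let `P` be the shifted polynomial. Shift and derivative are adjoint for the weights `s^k
e^{-2s}` and `s^{k+1}e^{-2s}`, so `∫s^kP²e^{-2s} = 2(j+1)∫s^{k+1}Q²e^{-2s}`. The auxiliary `R` in
the proof is `-QP`, and `s^{k+1}Re^{-2s}` is the boundary term. -/
theorem LaguerreForm.integral_shift {j k : ℕ} {Q : ℝ[X]} (h : LaguerreForm j (k + 1) Q) :
    ∫ s in Ioi (0 : ℝ), s ^ k * (laguerreShift k Q).eval s ^ 2 * Real.exp (-(2 * s)) =
      4 * (j + 1) := by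
  have hQ := polyBdd_eval Q
  have hQ' := polyBdd_eval (derivative Q)
  have hP := polyBdd_eval (laguerreShift k Q)
  have cQ : Continuous fun s => Q.eval s := Q.continuous
  have cP : Continuous fun s => (laguerreShift k Q).eval s := (laguerreShift k Q).continuous
  have i1 := integrableOn_polyBdd_mul_exp ((polyBdd_id.pow k).mul (hP.pow 2)) (by fun_prop)
  have i2 : IntegrableOn (fun s => (2 * ((j : ℝ) + 1)) *
      (s ^ (k + 1) * Q.eval s ^ 2 * Real.exp (-(2 * s)))) (Ioi 0) :=
    (integrableOn_polyBdd_mul_exp ((polyBdd_id.pow (k + 1)).mul (hQ.pow 2)) (by fun_prop)).const_mul _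
  set R : ℝ → ℝ := fun s => ((k : ℝ) + 1) * Q.eval s ^ 2 + s * Q.eval s * (derivative Q).eval s -
    2 * s * Q.eval s ^ 2 with hR
  have hRb : PolyBdd fun s => (1 + s) * s ^ k * R s :=
    ((((polyBdd_const 1).add polyBdd_id).mul (polyBdd_id.pow k))).mul
      (((((polyBdd_const _).mul (hQ.pow 2)).add ((polyBdd_id.mul hQ).mul hQ'))).sub
        (((polyBdd_const 2).mul polyBdd_id).mul (hQ.pow 2)))
  obtain ⟨K, hK, hb⟩ := hRb.mul_exp_le
  have hd : ∀ s : ℝ, s > 0 → HasDerivAt (fun s => s ^ (k + 1) * R s * Real.exp (-(2 * s)))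
      (s ^ k * (laguerreShift k Q).eval s ^ 2 * Real.exp (-(2 * s)) -
        (2 * ((j : ℝ) + 1)) * (s ^ (k + 1) * Q.eval s ^ 2 * Real.exp (-(2 * s)))) s := by
    intro s _
    have h2 : HasDerivAt (fun s : ℝ => -(2 * s)) (-2) s := hasDerivAt_neg_two_mul s
    have d1 := Q.hasDerivAt s
    have d2 := (derivative Q).hasDerivAt s
    have hRd := ((((d1.pow 2).const_mul ((k : ℝ) + 1)).add
      (((hasDerivAt_id' s).mul d1).mul d2)).sub
      (((hasDerivAt_id' s).const_mul 2).mul (d1.pow 2)))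
    refine (((hasDerivAt_pow (k + 1) s).mul hRd).mul h2.exp).congr_deriv ?_
    have e := congrArg (eval s) h.ode
    simp only [eval_add, eval_mul, eval_sub, eval_X, eval_C, eval_ofNat, eval_zero] at e
    simp only [laguerreShift, eval_mul, eval_sub, eval_X, eval_C, eval_ofNat, Pi.mul_apply,
      Pi.pow_apply, Pi.add_apply, Pi.sub_apply, Nat.add_sub_cancel]
    push_cast at e ⊢
    linear_combination (s ^ (k + 1) * Q.eval s * Real.exp (-(2 * s))) * e
  have key := integral_Ioi_deriv_eq_zero hd (i1.sub i2) (K := K) ?_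
  · rw [integral_sub i1 i2, integral_const_mul, h.norm_sq] at key
    linarith
  · intro s hs
    have hs0 : (0 : ℝ) < s := hs
    have h1 : s ≤ Real.sqrt s * (1 + s) := by
      have := Real.mul_self_sqrt hs0.le
      nlinarith [Real.sqrt_nonneg s, sq_nonneg (Real.sqrt s - 1)]
    rw [norm_mul, norm_mul, Real.norm_eq_abs, Real.norm_eq_abs, Real.norm_eq_abs, Real.abs_exp,
      abs_of_pos (by positivity), pow_succ]
    have e1 : |(1 + s) * s ^ k * R s| = (1 + s) * s ^ k * |R s| := by
      rw [abs_mul, abs_of_pos (by positivity)]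
    have := hb s hs
    rw [e1] at this
    calc s ^ k * s * |R s| * Real.exp (-(2 * s))
        ≤ s ^ k * (Real.sqrt s * (1 + s)) * |R s| * Real.exp (-s) := by
          gcongr; linarith
      _ = Real.sqrt s * ((1 + s) * s ^ k * |R s| * Real.exp (-s)) := by ring
      _ ≤ Real.sqrt s * (K * Real.exp (-s / 2)) := by gcongr
      _ = _ := by ring

/-- Raising `j` with `m` fixed lowers the angular momentum by one. Applying `∂x - i∂ξ` to the form
loses one factor `z` and produces the shifted polynomial in `|z|²`. -/
theorem LaguerreForm.shift {j k : ℕ} {Q : ℝ[X]} (h : LaguerreForm j (k + 1) Q) :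
    LaguerreForm (j + 1) k (C (1 / Real.sqrt (2 * (j + 1))) * laguerreShift k Q) where
  form x ξ := by
    have ha : (0 : ℝ) < Real.sqrt (2 * (j + 1)) := Real.sqrt_pos.2 (by positivity)
    have h1 := (hasDerivAt_crossWigner_fst j (j + (k + 1)) x ξ).unique
      ((hasDerivAt_form_fst (k + 1) Q x ξ).congr_of_eventuallyEq
        (Eventually.of_forall fun x => h.form x ξ))
    have h2 := (hasDerivAt_crossWigner_snd j (j + (k + 1)) x ξ).unique
      ((hasDerivAt_form_snd (k + 1) Q x ξ).congr_of_eventuallyEq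
        (Eventually.of_forall fun ξ => h.form x ξ))
    rw [h.form] at h1 h2
    rw [show j + 1 + k = j + (k + 1) by omega]
    simp only [laguerreShift, eval_mul, eval_sub, eval_X, eval_C, eval_ofNat,
      Nat.add_sub_cancel] at h1 h2 ⊢
    have ha' : (Real.sqrt (2 * (j + 1)) : ℂ) ≠ 0 := by exact_mod_cast ha.ne'
    push_cast at h1 h2 ⊢
    field_simp
    linear_combination (-1 / 2) * h1 + Complex.I / 2 * h2 +
      (1 / 2 * Real.sqrt (2 * (j + 1)) * crossWigner (j + 1) (j + (k + 1)) x ξ +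
        (1 / 2 * (k + 1) * (Q.eval (x ^ 2 + ξ ^ 2) : ℝ) -
          2 * ξ ^ 2 * (Q.eval (x ^ 2 + ξ ^ 2) : ℝ) +
          ξ ^ 2 * ((derivative Q).eval (x ^ 2 + ξ ^ 2) : ℝ)) * (x + ξ * Complex.I) ^ k *
          Complex.exp (-(x ^ 2 + ξ ^ 2)) -
        1 / 2 * Real.sqrt (2 * (j + (k + 1) + 1)) * crossWigner j (j + (k + 1) + 1) x ξ) *
          Complex.I_sq
  ode := by
    have e := h.derivative_shift
    have e2 : laguerreShift k Q = 2 * X * Q - C ((k : ℝ) + 1) * Q - X * derivative Q := rfl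
    rw [derivative_C_mul, derivative_C_mul, e, derivative_C_mul]
    rw [e2]
    push_cast
    simp only [map_add, map_mul, map_one, map_ofNat]
    ring
  norm_sq := by
    have := h.integral_shift
    have e : ∀ s : ℝ, s ^ k * (C (1 / Real.sqrt (2 * (j + 1))) * laguerreShift k Q).eval s ^ 2 *
        Real.exp (-(2 * s)) = (1 / Real.sqrt (2 * (j + 1))) ^ 2 *
        (s ^ k * (laguerreShift k Q).eval s ^ 2 * Real.exp (-(2 * s))) := fun s => by
      rw [eval_mul, eval_C]; ring
    simp only [e]
    rw [integral_const_mul, this, div_pow, Real.sq_sqrt (by positivity)]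
    field_simp
    norm_num

/-- Induction on `j` for all `k` at once, since the step passes from `(j, k+1)` to `(j+1, k)`. The
row `j = 0` comes from raising `m`. -/
theorem exists_laguerreForm (j k : ℕ) : ∃ Q, LaguerreForm j k Q := by
  induction j generalizing k with
  | zero => exact ⟨_, (exists_laguerreForm_zero k).choose_spec⟩
  | succ j ih => exact ⟨_, (ih (k + 1)).choose_spec.shift⟩

end HermiteWigner

/-! ### Laguerre profiles as radial eigenfunctions -/

namespace HermiteWigner

open Set Filter Topology Polynomial

/-- The radial profile `s ^ (k/2) Q(s) exp(-s)` in the variable `s = |z|²`. -/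
noncomputable def profile (k : ℕ) (Q : ℝ[X]) (s : ℝ) : ℝ :=
  Real.sqrt s ^ k * (Q.eval s * Real.exp (-s))

theorem hasDerivAt_sqrt_pow (k : ℕ) {s : ℝ} (hs : 0 < s) :
    HasDerivAt (fun s => Real.sqrt s ^ k) (k / 2 * Real.sqrt s ^ k / s) s := by
  have h := (Real.hasDerivAt_sqrt hs.ne').pow k
  refine h.congr_deriv ?_
  have h0 := Real.sqrt_pos.2 hs
  have h1 := Real.sq_sqrt hs.le
  rcases k with _ | k
  · simp
  · rw [Nat.add_sub_cancel, pow_succ]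
    field_simp
    linear_combination -h1

theorem hasDerivAt_profile (k : ℕ) (Q : ℝ[X]) {s : ℝ} (hs : 0 < s) :
    HasDerivAt (profile k Q)
      ((k / 2 * profile k Q s + s * profile k (derivative Q - Q) s) / s) s := by
  refine ((hasDerivAt_sqrt_pow k hs).mul (hasDerivAt_radial Q s)).congr_deriv ?_
  simp only [profile]
  field_simp

theorem exists_abs_profile_le (k : ℕ) (Q : ℝ[X]) :
    ∃ K : ℝ, 0 < K ∧ ∀ s > 0, |profile k Q s| ≤ K * Real.exp (-s / 2) := by
  have h : PolyBdd fun s => Real.sqrt s ^ k * Q.eval s := by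
    refine PolyBdd.of_le (((polyBdd_const 1).add polyBdd_id).pow k |>.mul (polyBdd_eval Q))
      fun s hs => ?_
    rw [abs_mul, abs_mul, abs_pow, abs_pow, abs_of_nonneg (Real.sqrt_nonneg s),
      abs_of_pos (by linarith : (0 : ℝ) < 1 + s)]
    gcongr
    rw [Real.sqrt_le_left (by linarith)]
    nlinarith
  obtain ⟨K, hK, hb⟩ := h.mul_exp_le
  refine ⟨K, hK, fun s hs => ?_⟩
  have := hb s hs
  rwa [profile, ← mul_assoc, abs_mul, Real.abs_exp]

theorem exists_abs_profile_le_sqrt {k : ℕ} (hk : k ≠ 0) (Q : ℝ[X]) :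
    ∃ K : ℝ, 0 < K ∧ ∀ s > 0, |profile k Q s| ≤ K * Real.sqrt s * Real.exp (-s / 2) := by
  obtain ⟨k, rfl⟩ := Nat.exists_eq_succ_of_ne_zero hk
  obtain ⟨K, hK, hb⟩ := exists_abs_profile_le k Q
  refine ⟨K, hK, fun s hs => ?_⟩
  have e : profile (k + 1) Q s = Real.sqrt s * profile k Q s := by
    simp only [profile, pow_succ]; ring
  rw [Nat.succ_eq_add_one, e, abs_mul, abs_of_nonneg (Real.sqrt_nonneg s)]
  calc _ ≤ Real.sqrt s * (K * Real.exp (-s / 2)) := by gcongr; exact hb s hs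
    _ = _ := by ring

theorem exists_mul_abs_profile_le (k : ℕ) (Q : ℝ[X]) :
    ∃ K : ℝ, 0 < K ∧ ∀ s > 0, k * |profile k Q s| ≤ K * Real.sqrt s * Real.exp (-s / 2) := by
  rcases eq_or_ne k 0 with rfl | hk
  · exact ⟨1, one_pos, fun s hs => by simp; positivity⟩
  · obtain ⟨K, hK, hb⟩ := exists_abs_profile_le_sqrt hk Q
    refine ⟨(k + 1) * K, by positivity, fun s hs => ?_⟩
    rw [mul_assoc, mul_assoc, ← mul_assoc K]
    have h1 := hb s hs
    have h2 : 0 ≤ |profile k Q s| := abs_nonneg _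
    have h3 : (0 : ℝ) ≤ k := Nat.cast_nonneg k
    nlinarith

/-- The factor `s^{k/2}e^{-s}` turns Laguerre's equation into the radial oscillator equation with `N
= 2j+k+1`. -/
theorem LaguerreForm.radialPair {j k : ℕ} {Q : ℝ[X]} (h : LaguerreForm j k Q) :
    RadialPair k (2 * j + k + 1) (profile k Q)
      (fun s => k / 2 * profile k Q s + s * profile k (derivative Q - Q) s) where
  k_nonneg := Nat.cast_nonneg k
  one_le := by
    have : (0 : ℝ) ≤ j := Nat.cast_nonneg j
    have : (0 : ℝ) ≤ k := Nat.cast_nonneg k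
    linarith
  hasDerivAt_w s hs := hasDerivAt_profile k Q hs
  hasDerivAt_v s hs := by
    refine (((hasDerivAt_profile k Q hs).const_mul _).add
      ((hasDerivAt_id' s).mul (hasDerivAt_profile k (derivative Q - Q) hs))).congr_deriv ?_
    have e := congrArg (eval s) h.ode
    simp only [eval_add, eval_mul, eval_sub, eval_X, eval_C, eval_ofNat, eval_zero] at e
    have hs0 : s ≠ 0 := ne_of_gt hs
    simp only [profile, derivative_sub, eval_sub]
    field_simp
    linear_combination (16 * s) * e
  bound := by
    obtain ⟨K₁, hK₁, h₁⟩ := exists_abs_profile_le k Q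
    obtain ⟨K₂, hK₂, h₂⟩ := exists_mul_abs_profile_le k Q
    obtain ⟨K₄, hK₄, h₄⟩ : ∃ K : ℝ, 0 < K ∧ ∀ s > 0, |s * profile k (derivative Q - Q) s| ≤
        K * Real.sqrt s * Real.exp (-s / 2) := by
      -- Multiplying a profile by `s` amounts to replacing `k` by `k + 2`, which is nonzero, so the
      -- factor `√s` is available even for `k = 0`.
      obtain ⟨K, hK, hb⟩ := exists_abs_profile_le_sqrt (k := k + 2) (by omega) (derivative Q - Q)
      refine ⟨K, hK, fun s hs => ?_⟩
      refine le_of_eq_of_le ?_ (hb s hs)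
      congr 1
      simp only [profile, pow_add, Real.sq_sqrt (le_of_lt hs)]
      ring
    refine ⟨K₁ + K₂ + K₄, by positivity, fun s hs => ⟨?_, ?_, ?_⟩⟩
    · refine (h₁ s hs).trans ?_
      gcongr
      linarith
    · have e1 : |(k : ℝ) / 2 * profile k Q s| ≤ K₂ * Real.sqrt s * Real.exp (-s / 2) := by
        refine le_trans ?_ (h₂ s hs)
        rw [abs_mul, abs_of_nonneg (by positivity)]
        gcongr
        have : (0 : ℝ) ≤ k := Nat.cast_nonneg k
        linarith
      calc _ ≤ _ := abs_add_le _ _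
        _ ≤ K₂ * Real.sqrt s * Real.exp (-s / 2) + K₄ * Real.sqrt s * Real.exp (-s / 2) :=
          add_le_add e1 (h₄ s hs)
        _ = (K₂ + K₄) * Real.sqrt s * Real.exp (-s / 2) := by ring
        _ ≤ _ := by gcongr; linarith
    · refine (h₂ s hs).trans ?_
      gcongr
      linarith
  integral_sq_le := by
    rw [← h.norm_sq]
    refine le_of_eq (setIntegral_congr_fun measurableSet_Ioi fun s hs => ?_)
    have e : Real.exp (-s) ^ 2 = Real.exp (-(2 * s)) := by
      rw [← Real.exp_nat_mul]; congr 1; push_cast; ring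
    simp only [profile, mul_pow, ← pow_mul, mul_comm k 2, e]
    rw [pow_mul, Real.sq_sqrt (le_of_lt hs)]
    ring

end HermiteWigner

/-! ### The planar eigenfunction: Laplacian, Gaussian decay, integration by parts -/

namespace HermiteWigner

open Set Filter Topology Polynomial

/-- The function `z ^ k Q(|z|²) exp(-|z|²)` on the plane. -/
noncomputable def radialForm (k : ℕ) (Q : ℝ[X]) (p : ℝ × ℝ) : ℂ :=
  ((p.1 : ℂ) + p.2 * Complex.I) ^ k *
    ((Q.eval (p.1 ^ 2 + p.2 ^ 2) * Real.exp (-(p.1 ^ 2 + p.2 ^ 2)) : ℝ) : ℂ)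

theorem contDiff_radialForm (k : ℕ) (Q : ℝ[X]) {n : WithTop ℕ∞} :
    ContDiff ℝ n (radialForm k Q) := by
  have hc : ContDiff ℝ n fun x : ℝ => (x : ℂ) := Complex.ofRealCLM.contDiff
  have hQ : ContDiff ℝ n fun s => Q.eval s := by
    simpa using Polynomial.contDiff_aeval (𝕜 := ℝ) Q n
  have h1 : ContDiff ℝ n fun p : ℝ × ℝ => (p.1 : ℂ) + p.2 * Complex.I :=
    (hc.comp contDiff_fst).add ((hc.comp contDiff_snd).mul contDiff_const)
  have h2 : ContDiff ℝ n fun p : ℝ × ℝ => p.1 ^ 2 + p.2 ^ 2 := by fun_prop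
  exact (h1.pow k).mul (hc.comp ((hQ.comp h2).mul (h2.neg.exp)))

theorem continuous_radialForm (k : ℕ) (Q : ℝ[X]) : Continuous (radialForm k Q) :=
  (contDiff_radialForm k Q (n := 0)).continuous

/-- The derivative along a fixed direction. -/
noncomputable def dirDeriv (v : ℝ × ℝ) (f : ℝ × ℝ → ℂ) (p : ℝ × ℝ) : ℂ := fderiv ℝ f p v

/-- The Laplacian of a function on the plane. -/
noncomputable def planeLaplacian (f : ℝ × ℝ → ℂ) (p : ℝ × ℝ) : ℂ :=
  dirDeriv (1, 0) (dirDeriv (1, 0) f) p + dirDeriv (0, 1) (dirDeriv (0, 1) f) p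

theorem hasDerivAt_fst_of_differentiableAt {f : ℝ × ℝ → ℂ} {p : ℝ × ℝ}
    (h : DifferentiableAt ℝ f p) :
    HasDerivAt (fun x => f (x, p.2)) (dirDeriv (1, 0) f p) p.1 := by
  have h1 : HasDerivAt (fun x : ℝ => (x, p.2)) ((1, 0) : ℝ × ℝ) p.1 :=
    (hasDerivAt_id' p.1).prodMk (hasDerivAt_const p.1 p.2)
  have := (show HasFDerivAt f (fderiv ℝ f p) (p.1, p.2) from h.hasFDerivAt).comp_hasDerivAt p.1 h1
  exact this

theorem hasDerivAt_snd_of_differentiableAt {f : ℝ × ℝ → ℂ} {p : ℝ × ℝ}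
    (h : DifferentiableAt ℝ f p) :
    HasDerivAt (fun ξ => f (p.1, ξ)) (dirDeriv (0, 1) f p) p.2 := by
  have h1 : HasDerivAt (fun ξ : ℝ => (p.1, ξ)) ((0, 1) : ℝ × ℝ) p.2 :=
    (hasDerivAt_const p.2 p.1).prodMk (hasDerivAt_id' p.2)
  have := (show HasFDerivAt f (fderiv ℝ f p) (p.1, p.2) from h.hasFDerivAt).comp_hasDerivAt p.2 h1
  exact this

theorem dirDeriv_fst_radialForm (k : ℕ) (Q : ℝ[X]) :
    dirDeriv (1, 0) (radialForm k Q) = fun p => k * radialForm (k - 1) Q p +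
      2 * p.1 * radialForm k (derivative Q - Q) p := by
  ext p
  have h := (contDiff_radialForm k Q (n := 1)).differentiable one_ne_zero p
  refine ((hasDerivAt_fst_of_differentiableAt h).unique
    (hasDerivAt_form_fst k Q p.1 p.2)).trans ?_
  simp only [radialForm]
  ring

theorem dirDeriv_snd_radialForm (k : ℕ) (Q : ℝ[X]) :
    dirDeriv (0, 1) (radialForm k Q) = fun p => Complex.I * k * radialForm (k - 1) Q p +
      2 * p.2 * radialForm k (derivative Q - Q) p := by
  ext p
  have h := (contDiff_radialForm k Q (n := 1)).differentiable one_ne_zero p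
  refine ((hasDerivAt_snd_of_differentiableAt h).unique
    (hasDerivAt_form_snd k Q p.1 p.2)).trans ?_
  simp only [radialForm]
  ring

/-- The factor `k` on both sides covers `k = 0`, where the truncated `k - 1` is `0` and the identity
without it would fail. -/
theorem mul_radialForm_pred (k : ℕ) (Q : ℝ[X]) (p : ℝ × ℝ) :
    k * (((p.1 : ℂ) + p.2 * Complex.I) * radialForm (k - 1) Q p) = k * radialForm k Q p := by
  rcases k with _ | k
  · simp
  · simp only [radialForm, Nat.add_sub_cancel, pow_succ]
    ring

theorem differentiable_dirDeriv_radialForm (v : ℝ × ℝ) (k : ℕ) (Q : ℝ[X]) :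
    Differentiable ℝ (dirDeriv v (radialForm k Q)) :=
  (((contDiff_radialForm k Q (n := 2)).fderiv_right (m := 1) (by norm_num)).differentiable
    one_ne_zero).clm_apply (differentiable_const v)

theorem dirDeriv_fst_fst_radialForm (k : ℕ) (Q : ℝ[X]) :
    dirDeriv (1, 0) (dirDeriv (1, 0) (radialForm k Q)) = fun p =>
      k * dirDeriv (1, 0) (radialForm (k - 1) Q) p +
        2 * radialForm k (derivative Q - Q) p +
        2 * (p.1 * dirDeriv (1, 0) (radialForm k (derivative Q - Q)) p) := by
  ext p
  have d1 := fun (i : ℕ) (P : ℝ[X]) => hasDerivAt_fst_of_differentiableAt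
      ((contDiff_radialForm i P (n := 1)).differentiable one_ne_zero p)
  have hx : HasDerivAt (fun x : ℝ => 2 * (x : ℂ)) 2 p.1 := by
    simpa using ((hasDerivAt_id p.1).ofReal_comp).const_mul (2 : ℂ)
  have s1 := hasDerivAt_fst_of_differentiableAt (differentiable_dirDeriv_radialForm (1, 0) k Q p)
  nth_rw 1 [dirDeriv_fst_radialForm] at s1
  refine (s1.unique (((d1 (k - 1) Q).const_mul (k : ℂ)).add
    (hx.mul (d1 k (derivative Q - Q))))).trans ?_
  ring

theorem dirDeriv_snd_snd_radialForm (k : ℕ) (Q : ℝ[X]) :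
    dirDeriv (0, 1) (dirDeriv (0, 1) (radialForm k Q)) = fun p =>
      Complex.I * k * dirDeriv (0, 1) (radialForm (k - 1) Q) p +
        2 * radialForm k (derivative Q - Q) p +
        2 * (p.2 * dirDeriv (0, 1) (radialForm k (derivative Q - Q)) p) := by
  ext p
  have d2 := fun (i : ℕ) (P : ℝ[X]) => hasDerivAt_snd_of_differentiableAt
      ((contDiff_radialForm i P (n := 1)).differentiable one_ne_zero p)
  have hx : HasDerivAt (fun x : ℝ => 2 * (x : ℂ)) 2 p.2 := by
    simpa using ((hasDerivAt_id p.2).ofReal_comp).const_mul (2 : ℂ)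
  have s1 := hasDerivAt_snd_of_differentiableAt (differentiable_dirDeriv_radialForm (0, 1) k Q p)
  nth_rw 1 [dirDeriv_snd_radialForm] at s1
  refine (s1.unique (((d2 (k - 1) Q).const_mul (Complex.I * (k : ℂ))).add
    (hx.mul (d2 k (derivative Q - Q))))).trans ?_
  ring

/-- The second derivatives of `z^k` cancel by harmonicity (`I² = -1`). The radial and cross terms
combine through Laguerre's equation. -/
theorem planeLaplacian_radialForm {j k : ℕ} {Q : ℝ[X]} (h : LaguerreForm j k Q) (p : ℝ × ℝ) :
    planeLaplacian (radialForm k Q) p =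
      4 * ((p.1 ^ 2 + p.2 ^ 2) - (2 * j + k + 1)) * radialForm k Q p := by
  rw [planeLaplacian, dirDeriv_fst_fst_radialForm, dirDeriv_snd_snd_radialForm]
  simp only [dirDeriv_fst_radialForm, dirDeriv_snd_radialForm]
  set R := derivative Q - Q with hR
  have e := congrArg (eval (p.1 ^ 2 + p.2 ^ 2)) h.ode
  simp only [eval_add, eval_mul, eval_sub, eval_X, eval_C, eval_ofNat, eval_zero] at e
  have e' := congrArg (fun t : ℝ => (t : ℂ)) e
  push_cast at e'
  have hR1 := mul_radialForm_pred k R p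
  have hcomb : ((p.1 : ℂ) ^ 2 + p.2 ^ 2) * radialForm k (derivative R - R) p +
      (k + 1) * radialForm k R p =
      ((p.1 ^ 2 + p.2 ^ 2) - (2 * j + k + 1)) * radialForm k Q p := by
    simp only [radialForm, hR, derivative_sub, eval_sub]
    push_cast
    linear_combination (((p.1 : ℂ) + p.2 * Complex.I) ^ k *
      Complex.exp (-((p.1 : ℂ) ^ 2 + p.2 ^ 2))) * e'
  linear_combination 4 * hcomb + 4 * hR1 +
    (k * ((k - 1 : ℕ) : ℂ) * radialForm (k - 1 - 1) Q p) * Complex.I_sq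

/-- Continuous functions on the plane of Gaussian decay. -/
def GaussDecay (f : ℝ × ℝ → ℂ) : Prop :=
  Continuous f ∧ ∃ (K : ℝ) (n : ℕ), ∀ p : ℝ × ℝ,
    ‖f p‖ ≤ K * (1 + (p.1 ^ 2 + p.2 ^ 2)) ^ n * Real.exp (-(p.1 ^ 2 + p.2 ^ 2))

theorem GaussDecay.add {f g : ℝ × ℝ → ℂ} (hf : GaussDecay f) (hg : GaussDecay g) :
    GaussDecay fun p => f p + g p := by
  obtain ⟨cf, K, n, hf⟩ := hf
  obtain ⟨cg, L, m, hg⟩ := hg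
  refine ⟨cf.add cg, |K| + |L|, n + m, fun p => ?_⟩
  set s := p.1 ^ 2 + p.2 ^ 2 with hs
  have hs0 : 0 ≤ s := by positivity
  have h1 : (1 + s) ^ n ≤ (1 + s) ^ (n + m) := pow_le_pow_right₀ (by linarith) (by omega)
  have h2 : (1 + s) ^ m ≤ (1 + s) ^ (n + m) := pow_le_pow_right₀ (by linarith) (by omega)
  calc ‖f p + g p‖ ≤ ‖f p‖ + ‖g p‖ := norm_add_le _ _
    _ ≤ K * (1 + s) ^ n * Real.exp (-s) + L * (1 + s) ^ m * Real.exp (-s) :=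
        add_le_add (hf p) (hg p)
    _ ≤ |K| * (1 + s) ^ (n + m) * Real.exp (-s) + |L| * (1 + s) ^ (n + m) * Real.exp (-s) := by
        gcongr <;> exact le_abs_self _
    _ = _ := by ring

theorem GaussDecay.mul_of_le {f g : ℝ × ℝ → ℂ} (hf : GaussDecay f) (cg : Continuous g) {L : ℝ}
    {m : ℕ} (hg : ∀ p, ‖g p‖ ≤ L * (1 + (p.1 ^ 2 + p.2 ^ 2)) ^ m) :
    GaussDecay fun p => g p * f p := by
  obtain ⟨cf, K, n, hf⟩ := hf
  refine ⟨cg.mul cf, L * K, m + n, fun p => ?_⟩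
  rw [norm_mul]
  calc _ ≤ (L * (1 + (p.1 ^ 2 + p.2 ^ 2)) ^ m) *
        (K * (1 + (p.1 ^ 2 + p.2 ^ 2)) ^ n * Real.exp (-(p.1 ^ 2 + p.2 ^ 2))) :=
        mul_le_mul (hg p) (hf p) (norm_nonneg _) ((norm_nonneg _).trans (hg p))
    _ = _ := by ring

theorem abs_le_one_add_sq (a b : ℝ) : |a| ≤ 1 + (a ^ 2 + b ^ 2) := by
  rw [← sq_abs a]
  nlinarith [sq_nonneg (|a| - 1), sq_nonneg b, sq_nonneg |a|]

theorem GaussDecay.const_mul {f : ℝ × ℝ → ℂ} (hf : GaussDecay f) (c : ℂ) :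
    GaussDecay fun p => c * f p :=
  hf.mul_of_le continuous_const (L := ‖c‖) (m := 0) fun p => by simp

theorem GaussDecay.fst_mul {f : ℝ × ℝ → ℂ} (hf : GaussDecay f) :
    GaussDecay fun p => (p.1 : ℂ) * f p :=
  hf.mul_of_le (by fun_prop) (L := 1) (m := 1) fun p => by
    rw [Complex.norm_real, pow_one, one_mul]; exact abs_le_one_add_sq _ _

theorem GaussDecay.snd_mul {f : ℝ × ℝ → ℂ} (hf : GaussDecay f) :
    GaussDecay fun p => (p.2 : ℂ) * f p :=
  hf.mul_of_le (by fun_prop) (L := 1) (m := 1) fun p => by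
    rw [Complex.norm_real, pow_one, one_mul, add_comm (p.1 ^ 2)]; exact abs_le_one_add_sq _ _

theorem gaussDecay_radialForm (k : ℕ) (Q : ℝ[X]) : GaussDecay (radialForm k Q) := by
  induction k with
  | zero =>
    obtain ⟨a, n, h⟩ := polyBdd_eval Q
    have h0 : ∀ s : ℝ, 0 ≤ s → |Q.eval s| ≤ (|a| + |Q.eval 0|) * (1 + s) ^ n := by
      intro s hs
      have h1 : 1 ≤ (1 + s) ^ n := one_le_pow₀ (by linarith)
      rcases hs.eq_or_lt with rfl | hs
      · simp
      · refine (h s hs).trans ?_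
        gcongr
        exact (le_abs_self a).trans (by simp)
    refine ⟨continuous_radialForm 0 Q, |a| + |Q.eval 0|, n, fun p => ?_⟩
    rw [radialForm, pow_zero, one_mul, Complex.norm_real, norm_mul, Real.norm_eq_abs,
      Real.norm_eq_abs, Real.abs_exp]
    gcongr
    exact h0 _ (by positivity)
  | succ k ih =>
    have e : radialForm (k + 1) Q = fun p => p.1 * radialForm k Q p +
        Complex.I * (p.2 * radialForm k Q p) := by
      ext p; simp only [radialForm]; ring
    rw [e]
    exact ih.fst_mul.add (ih.snd_mul.const_mul _)

theorem gaussDecay_dirDeriv_radialForm (k : ℕ) (Q : ℝ[X]) :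
    GaussDecay (dirDeriv (1, 0) (radialForm k Q)) ∧
      GaussDecay (dirDeriv (0, 1) (radialForm k Q)) := by
  rw [dirDeriv_fst_radialForm, dirDeriv_snd_radialForm]
  simp only [mul_assoc]
  have h1 := gaussDecay_radialForm (k - 1) Q
  have h2 := gaussDecay_radialForm k (derivative Q - Q)
  exact ⟨(h1.const_mul k).add (h2.fst_mul.const_mul 2),
    ((h1.const_mul k).const_mul Complex.I).add (h2.snd_mul.const_mul 2)⟩

theorem GaussDecay.integrable {f : ℝ × ℝ → ℂ} (hf : GaussDecay f) : Integrable f := by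
  obtain ⟨cf, K, n, hf⟩ := hf
  obtain ⟨C, hC, hb⟩ := one_add_pow_mul_exp_le n (c := 1 / 2) (by norm_num)
  have hi := integrable_exp_neg_mul_sq (b := 1 / 2) (by norm_num)
  have hi2 : Integrable (fun p : ℝ × ℝ => (|K| * C) *
      (Real.exp (-(1 / 2) * p.1 ^ 2) * Real.exp (-(1 / 2) * p.2 ^ 2))) := (hi.mul_prod hi).const_mul _
  refine hi2.mono' cf.aestronglyMeasurable (Eventually.of_forall fun p => (hf p).trans ?_)
  set s := p.1 ^ 2 + p.2 ^ 2 with hs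
  have e : Real.exp (-s) = Real.exp (-(1 / 2 * s)) *
      (Real.exp (-(1 / 2) * p.1 ^ 2) * Real.exp (-(1 / 2) * p.2 ^ 2)) := by
    rw [← Real.exp_add, ← Real.exp_add, hs]; ring_nf
  rw [e, ← mul_assoc]
  refine mul_le_mul_of_nonneg_right ?_ (by positivity)
  calc K * (1 + s) ^ n * Real.exp (-(1 / 2 * s)) ≤ |K| * (1 + s) ^ n * Real.exp (-(1 / 2 * s)) := by
        gcongr; exact le_abs_self K
    _ = |K| * ((1 + s) ^ n * Real.exp (-(1 / 2 * s))) := by ring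
    _ ≤ _ := by gcongr; exact hb s (by positivity)

theorem GaussDecay.bdd_mul {f g : ℝ × ℝ → ℂ} (hf : GaussDecay f) (cg : Continuous g) {L : ℝ}
    (hg : ∀ p, ‖g p‖ ≤ L) : GaussDecay fun p => g p * f p :=
  hf.mul_of_le cg (L := L) (m := 0) fun p => by simpa using hg p

/-- Integration by parts against a function of Gaussian decay. -/
theorem integral_dirDeriv_mul {f g : ℝ × ℝ → ℂ} {v : ℝ × ℝ} (hg : ContDiff ℝ 1 g)
    (hf : ContDiff ℝ 1 f) (df : GaussDecay f) (df' : GaussDecay (dirDeriv v f)) {K L : ℝ}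
    (hb : ∀ p, ‖g p‖ ≤ K) (hb' : ∀ p, ‖dirDeriv v g p‖ ≤ L) :
    ∫ p, dirDeriv v g p * f p = -∫ p, g p * dirDeriv v f p := by
  have cg' : Continuous (dirDeriv v g) := (hg.continuous_fderiv one_ne_zero).clm_apply continuous_const
  have := integral_mul_fderiv_eq_neg_fderiv_mul_of_integrable (μ := volume) (f := g) (g := f) (v := v)
    (df.bdd_mul cg' hb').integrable (df'.bdd_mul hg.continuous hb).integrable
    (df.bdd_mul hg.continuous hb).integrable
    (fun p _ => hg.differentiable one_ne_zero p) (fun p _ => hf.differentiable one_ne_zero p)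
  rw [← neg_eq_iff_eq_neg] at this
  exact this.symm

end HermiteWigner

/-! ### Self-adjointness, angular modes and reduction to the half-line -/

namespace HermiteWigner

open Set Filter Topology Polynomial

theorem gaussDecay_dirDeriv_dirDeriv_radialForm (k : ℕ) (Q : ℝ[X]) :
    GaussDecay (dirDeriv (1, 0) (dirDeriv (1, 0) (radialForm k Q))) ∧
      GaussDecay (dirDeriv (0, 1) (dirDeriv (0, 1) (radialForm k Q))) := by
  rw [dirDeriv_fst_fst_radialForm, dirDeriv_snd_snd_radialForm]
  have h1 := gaussDecay_dirDeriv_radialForm (k - 1) Q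
  have h2 := gaussDecay_radialForm k (derivative Q - Q)
  have h3 := gaussDecay_dirDeriv_radialForm k (derivative Q - Q)
  exact ⟨((h1.1.const_mul _).add (h2.const_mul 2)).add (h3.1.fst_mul.const_mul 2),
    ((h1.2.const_mul _).add (h2.const_mul 2)).add (h3.2.snd_mul.const_mul 2)⟩

theorem contDiff_dirDeriv {f : ℝ × ℝ → ℂ} {n m : WithTop ℕ∞} (hf : ContDiff ℝ n f) (v : ℝ × ℝ)
    (h : m + 1 ≤ n) : ContDiff ℝ m (dirDeriv v f) :=
  (hf.fderiv_right h).clm_apply contDiff_const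

theorem integral_dirDeriv_dirDeriv_mul {f g : ℝ × ℝ → ℂ} {v : ℝ × ℝ} (hg : ContDiff ℝ 2 g)
    (hf : ContDiff ℝ 2 f) (df : GaussDecay f) (df' : GaussDecay (dirDeriv v f))
    (df'' : GaussDecay (dirDeriv v (dirDeriv v f))) {K : ℝ}
    (hb : ∀ p, ‖g p‖ ≤ K) (hb' : ∀ p, ‖dirDeriv v g p‖ ≤ K)
    (hb'' : ∀ p, ‖dirDeriv v (dirDeriv v g) p‖ ≤ K) :
    ∫ p, dirDeriv v (dirDeriv v g) p * f p = ∫ p, g p * dirDeriv v (dirDeriv v f) p := by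
  have c1 : ContDiff ℝ 1 g := hg.of_le (by norm_num)
  have c2 : ContDiff ℝ 1 f := hf.of_le (by norm_num)
  have c3 : ContDiff ℝ 1 (dirDeriv v g) := contDiff_dirDeriv hg v (by norm_num)
  have c4 : ContDiff ℝ 1 (dirDeriv v f) := contDiff_dirDeriv hf v (by norm_num)
  rw [integral_dirDeriv_mul c3 c2 df df' hb' hb'', integral_dirDeriv_mul c1 c4 df' df'' hb hb',
    neg_neg]

/-- The operator `|z|² - Δ/4` acts on the Wigner function by multiplication with `2j + k + 1`. -/
theorem LaguerreForm.integral_mul_eq {j k : ℕ} {Q : ℝ[X]} (h : LaguerreForm j k Q) {hbar : ℝ}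
    {g : ℝ × ℝ → ℂ} (hg : ContDiff ℝ 2 g) {K : ℝ} (hb : ∀ p, ‖g p‖ ≤ K)
    (hb' : ∀ v ∈ ({(1, 0), (0, 1)} : Set (ℝ × ℝ)), ∀ p, ‖dirDeriv v g p‖ ≤ K)
    (hb'' : ∀ v ∈ ({(1, 0), (0, 1)} : Set (ℝ × ℝ)), ∀ p, ‖dirDeriv v (dirDeriv v g) p‖ ≤ K) :
    (1 + hbar * (2 * j + k + 1) : ℂ) * ∫ p, g p * radialForm k Q p =
      (∫ p, (1 + hbar * (p.1 ^ 2 + p.2 ^ 2) : ℝ) • g p * radialForm k Q p) -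
        hbar / 4 * ∫ p, planeLaplacian g p * radialForm k Q p := by
  have d := gaussDecay_radialForm k Q
  have d' := gaussDecay_dirDeriv_radialForm k Q
  have d'' := gaussDecay_dirDeriv_dirDeriv_radialForm k Q
  have cf : ContDiff ℝ 2 (radialForm k Q) := contDiff_radialForm k Q
  have c : ∀ v, Continuous (dirDeriv v (dirDeriv v g)) := fun v =>
    (contDiff_dirDeriv (n := 1) (m := 0) (contDiff_dirDeriv hg v (by norm_num)) v (by norm_num)).continuous
  have m1 : ((1 : ℝ), (0 : ℝ)) ∈ ({(1, 0), (0, 1)} : Set (ℝ × ℝ)) := by simp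
  have m2 : ((0 : ℝ), (1 : ℝ)) ∈ ({(1, 0), (0, 1)} : Set (ℝ × ℝ)) := by simp
  have i1 := integral_dirDeriv_dirDeriv_mul hg cf d d'.1 d''.1 hb (hb' _ m1) (hb'' _ m1)
  have i2 := integral_dirDeriv_dirDeriv_mul hg cf d d'.2 d''.2 hb (hb' _ m2) (hb'' _ m2)
  have key : ∫ p, planeLaplacian g p * radialForm k Q p =
      ∫ p, g p * planeLaplacian (radialForm k Q) p := by
    have e1 : ∀ p, planeLaplacian g p * radialForm k Q p =
      dirDeriv (1, 0) (dirDeriv (1, 0) g) p * radialForm k Q p +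
        dirDeriv (0, 1) (dirDeriv (0, 1) g) p * radialForm k Q p := fun p => add_mul _ _ _
    have e2 : ∀ p, g p * planeLaplacian (radialForm k Q) p =
      g p * dirDeriv (1, 0) (dirDeriv (1, 0) (radialForm k Q)) p +
        g p * dirDeriv (0, 1) (dirDeriv (0, 1) (radialForm k Q)) p := fun p => mul_add _ _ _
    simp only [e1, e2]
    rw [integral_add, integral_add, i1, i2]
    · exact (d''.1.bdd_mul hg.continuous hb).integrable
    · exact (d''.2.bdd_mul hg.continuous hb).integrable
    · exact (d.bdd_mul (c _) (hb'' _ m1)).integrable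
    · exact (d.bdd_mul (c _) (hb'' _ m2)).integrable
  have j1 := (d.bdd_mul hg.continuous hb).integrable
  have j2 : Integrable fun p : ℝ × ℝ =>
      (1 + hbar * (p.1 ^ 2 + p.2 ^ 2) : ℝ) • g p * radialForm k Q p := by
    refine (d.mul_of_le (L := (1 + |hbar|) * K) (m := 1) (by fun_prop) fun p => ?_).integrable
    rw [norm_smul, pow_one]
    have h1 : ‖(1 + hbar * (p.1 ^ 2 + p.2 ^ 2) : ℝ)‖ ≤ (1 + |hbar|) * (1 + (p.1 ^ 2 + p.2 ^ 2)) := by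
      refine (norm_add_le _ _).trans ?_
      rw [norm_mul, norm_one, Real.norm_eq_abs, Real.norm_eq_abs,
        abs_of_nonneg (by positivity : 0 ≤ p.1 ^ 2 + p.2 ^ 2)]
      nlinarith [abs_nonneg hbar, sq_nonneg p.1, sq_nonneg p.2]
    calc _ ≤ ((1 + |hbar|) * (1 + (p.1 ^ 2 + p.2 ^ 2))) * K :=
          mul_le_mul h1 (hb p) (norm_nonneg _) (by positivity)
      _ = _ := by ring
  rw [key, ← integral_const_mul, ← integral_const_mul, ← integral_sub j2]
  · congr 1
    ext p
    rw [planeLaplacian_radialForm h, Complex.real_smul]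
    push_cast
    ring
  · have e3 : ∀ p, (hbar / 4 : ℂ) * (g p * planeLaplacian (radialForm k Q) p) =
      (1 + hbar * (p.1 ^ 2 + p.2 ^ 2) : ℝ) • g p * radialForm k Q p -
        (1 + hbar * (2 * j + k + 1)) * (g p * radialForm k Q p) := fun p => by
      rw [planeLaplacian_radialForm h, Complex.real_smul]
      push_cast
      ring
    simp only [e3]
    exact j2.sub (j1.const_mul _)

/-- `g(e^{iθ} z) = e^{-ikθ} g(z)`. -/
def HasMode (k : ℤ) (g : ℝ × ℝ → ℂ) : Prop :=
  ∀ θ p, g (rot θ p) = Complex.exp (-(Complex.I * k * θ)) * g p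

theorem rot_norm_sq (θ : ℝ) (p : ℝ × ℝ) :
    (rot θ p).1 ^ 2 + (rot θ p).2 ^ 2 = p.1 ^ 2 + p.2 ^ 2 := by
  simp only [rot]
  linear_combination (p.1 ^ 2 + p.2 ^ 2) * Real.sin_sq_add_cos_sq θ

theorem rot_complex (θ : ℝ) (p : ℝ × ℝ) :
    ((rot θ p).1 : ℂ) + (rot θ p).2 * Complex.I =
      Complex.exp (Complex.I * θ) * (p.1 + p.2 * Complex.I) := by
  rw [mul_comm Complex.I, Complex.exp_mul_I]
  simp only [rot]
  push_cast
  linear_combination -(p.2 * Complex.sin θ) * Complex.I_sq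

theorem radialForm_rot (k : ℕ) (Q : ℝ[X]) (θ : ℝ) (p : ℝ × ℝ) :
    radialForm k Q (rot θ p) = Complex.exp (Complex.I * k * θ) * radialForm k Q p := by
  simp only [radialForm]
  rw [rot_norm_sq, rot_complex, mul_pow, ← Complex.exp_nat_mul]
  ring_nf

theorem radialForm_sqrt (k : ℕ) (Q : ℝ[X]) {s : ℝ} (hs : 0 ≤ s) :
    radialForm k Q (Real.sqrt s, 0) = profile k Q s := by
  simp only [radialForm, profile]
  rw [Real.sq_sqrt hs]
  push_cast
  ring_nf

/-- The opposite phases cancel, so the integrand is radial. The angle contributes `2π`, and `s = r²`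
turns `r dr` into `ds/2`. -/
theorem HasMode.integral_mul_radialForm {k : ℕ} {g : ℝ × ℝ → ℂ} (hg : HasMode k g) (Q : ℝ[X]) :
    ∫ p, g p * radialForm k Q p =
      Real.pi * ∫ s in Ioi (0 : ℝ), g (Real.sqrt s, 0) * profile k Q s := by
  rw [← integral_comp_polarCoord_symm, polarCoord_target]
  have e : ∀ p ∈ Ioi (0 : ℝ) ×ˢ Ioo (-Real.pi) Real.pi,
      p.1 • (g (polarCoord.symm p) * radialForm k Q (polarCoord.symm p)) =
        (p.1 • (g (p.1, 0) * radialForm k Q (p.1, 0))) * (fun _ => (1 : ℂ)) p.2 := by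
    intro p _
    have h1 : (polarCoord.symm p : ℝ × ℝ) = rot p.2 (p.1, 0) := by
      simp [polarCoord_symm_apply, rot]
    rw [h1, hg, radialForm_rot, mul_one]
    congr 1
    rw [mul_mul_mul_comm, ← Complex.exp_add]
    push_cast
    rw [neg_add_cancel, Complex.exp_zero, one_mul]
  rw [setIntegral_congr_fun (measurableSet_Ioi.prod measurableSet_Ioo) e, Measure.volume_eq_prod,
    setIntegral_prod_mul (fun r : ℝ => r • (g (r, 0) * radialForm k Q (r, 0))) (fun _ => (1 : ℂ))]
  have h2 := integral_comp_rpow_Ioi_of_pos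
    (g := fun s : ℝ => g (Real.sqrt s, 0) * profile k Q s) (p := 2) two_pos
  rw [← h2]
  have e2 : ∀ r ∈ Ioi (0 : ℝ), (2 * r ^ ((2 : ℝ) - 1)) •
      (g (Real.sqrt (r ^ (2 : ℝ)), 0) * (profile k Q (r ^ (2 : ℝ)) : ℂ)) =
      2 * (r • (g (r, 0) * radialForm k Q (r, 0))) := by
    intro r hr
    have hr0 : (0 : ℝ) < r := hr
    have h3 : r ^ (2 : ℝ) = r ^ 2 := by exact_mod_cast Real.rpow_natCast r 2
    have h4 := radialForm_sqrt k Q (sq_nonneg r)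
    rw [Real.sqrt_sq hr0.le] at h4
    rw [h3, Real.sqrt_sq hr0.le, h4, show (2 : ℝ) - 1 = 1 by norm_num, Real.rpow_one,
      Complex.real_smul, Complex.real_smul]
    push_cast
    ring
  rw [setIntegral_congr_fun measurableSet_Ioi e2, integral_const_mul]
  simp only [integral_const, MeasurableSet.univ, measureReal_restrict_apply, univ_inter,
    Real.volume_real_Ioo, sub_neg_eq_add]
  rw [max_eq_left (by positivity), Complex.real_smul]
  push_cast
  ring

/-- The rotation by `π/k` fixes the origin and multiplies the value there by `-1`. -/
theorem HasMode.apply_zero {k : ℤ} (hk : k ≠ 0) {g : ℝ × ℝ → ℂ} (hg : HasMode k g) :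
    g (0, 0) = 0 := by
  have h := hg (Real.pi / k) (0, 0)
  have e : rot (Real.pi / k) (0, 0) = (0, 0) := by simp [rot]
  have hk' : (k : ℂ) ≠ 0 := by exact_mod_cast hk
  have e2 : -(Complex.I * k * ((Real.pi / k : ℝ) : ℂ)) = -(Real.pi * Complex.I) := by
    push_cast; field_simp
  rw [e, e2, Complex.exp_neg, Complex.exp_pi_mul_I] at h
  norm_num at h
  linear_combination h / 2

/-- For `G(s) = g(√s, 0)` the chain rule gives `√s ‖G'‖ ≤ K/2`. The bound `‖G‖ ≤ K√s` for `k ≠ 0` is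
the mean value inequality from the origin, where `g` vanishes. -/
theorem LaguerreForm.norm_integral_mul_le {j k : ℕ} {Q : ℝ[X]} (h : LaguerreForm j k Q)
    {g : ℝ × ℝ → ℂ} (hm : HasMode k g) (hg : ContDiff ℝ 1 g) {K : ℝ} (hK : 0 < K)
    (hb : ∀ p, ‖g p‖ ≤ K) (hb' : ∀ p, ‖fderiv ℝ g p‖ ≤ K) :
    ‖∫ p, g p * radialForm k Q p‖ ≤ 4000 * Real.pi * K * (k + 1) := by
  rw [hm.integral_mul_radialForm, norm_mul, Complex.norm_real, Real.norm_of_nonneg Real.pi_pos.le]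
  have hd : ∀ s > 0, HasDerivAt (fun s => g (Real.sqrt s, 0))
      ((1 / (2 * Real.sqrt s)) • dirDeriv (1, 0) g (Real.sqrt s, 0)) s := fun s hs => by
    have h1 := hasDerivAt_fst_of_differentiableAt (f := g) (p := (Real.sqrt s, 0))
      (hg.differentiable one_ne_zero _)
    exact h1.scomp s (Real.hasDerivAt_sqrt (ne_of_gt hs))
  have hdir : ∀ p, ‖dirDeriv (1, 0) g p‖ ≤ K := fun p => by
    refine ((fderiv ℝ g p).le_opNorm _).trans ?_
    have : ‖((1, 0) : ℝ × ℝ)‖ = 1 := by simp [Prod.norm_def]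
    rw [this, mul_one]
    exact hb' p
  have := h.radialPair.norm_integral_le (G := fun s => g (Real.sqrt s, 0)) hK hd ?_
    (fun s _ => hb _) ?_ ?_
  · calc _ ≤ Real.pi * (4000 * K * (k + 1)) := by gcongr
      _ = _ := by ring
  · have c1 : Continuous (dirDeriv (1, 0) g) := (contDiff_dirDeriv (m := 0) hg (1, 0) (by norm_num)).continuous
    have c2 : Continuous fun s : ℝ => dirDeriv (1, 0) g (Real.sqrt s, 0) :=
      c1.comp (by fun_prop)
    intro s hs
    have : Real.sqrt s ≠ 0 := (Real.sqrt_pos.2 hs).ne'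
    have c3 : ContinuousAt (fun s : ℝ => 1 / (2 * Real.sqrt s)) s :=
      ContinuousAt.div continuousAt_const (by fun_prop) (by positivity)
    exact (c3.smul c2.continuousAt).continuousWithinAt
  · intro s hs
    have h0 : 0 < Real.sqrt s := Real.sqrt_pos.2 hs
    rw [norm_smul, Real.norm_of_nonneg (by positivity)]
    have := hdir (Real.sqrt s, 0)
    calc _ = 1 / 2 * ‖dirDeriv (1, 0) g (Real.sqrt s, 0)‖ := by field_simp
      _ ≤ _ := by linarith
  · intro s hs
    rcases eq_or_ne k 0 with rfl | hk
    · simp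
    · have h0 := hm.apply_zero (by exact_mod_cast hk)
      have := convex_univ.norm_image_sub_le_of_norm_fderiv_le (𝕜 := ℝ) (f := g) (C := K)
        (x := (0, 0)) (y := (Real.sqrt s, 0))
        (fun p _ => hg.differentiable one_ne_zero p) (fun p _ => hb' p) (mem_univ _) (mem_univ _)
      rw [h0, sub_zero] at this
      have e : ‖((Real.sqrt s, 0) : ℝ × ℝ) - (0, 0)‖ = Real.sqrt s := by
        simp [Prod.norm_def, abs_of_nonneg (Real.sqrt_nonneg s)]
      rw [e] at this
      gcongr

theorem LaguerreForm.norm_integral_mul_le_sqrt {j k : ℕ} {Q : ℝ[X]} (h : LaguerreForm j k Q)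
    {g : ℝ × ℝ → ℂ} (hm : HasMode k g) {K : ℝ} (hb : ∀ p, ‖g p‖ ≤ K) :
    ‖∫ p, g p * radialForm k Q p‖ ≤ 5 * Real.pi * K * Real.sqrt (2 * j + k + 1) := by
  rw [hm.integral_mul_radialForm, norm_mul, Complex.norm_real, Real.norm_of_nonneg Real.pi_pos.le]
  have := h.radialPair.norm_integral_le_abs (G := fun s => g (Real.sqrt s, 0)) (fun s _ => hb _)
  calc _ ≤ Real.pi * (K * (5 * Real.sqrt (2 * j + k + 1))) := by gcongr
    _ = _ := by ring

/-! ### Calculus of functions with pointwise bounds on all derivatives up to a given order -/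

section DBound

variable {E F : Type*} [NormedAddCommGroup E] [NormedSpace ℝ E] [NormedAddCommGroup F]
  [NormedSpace ℝ F]

/-- `f` is of class `C^n` and all its derivatives of order at most `n` are bounded by `ω`. -/
def DBound (n : ℕ) (ω : E → ℝ) (f : E → F) : Prop :=
  ContDiff ℝ n f ∧ ∀ m ≤ n, ∀ z, ‖iteratedFDeriv ℝ m f z‖ ≤ ω z

theorem DBound.norm_le {n : ℕ} {ω : E → ℝ} {f : E → F} (h : DBound n ω f) (z : E) :
    ‖f z‖ ≤ ω z := by
  have := h.2 0 (Nat.zero_le n) z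
  rwa [norm_iteratedFDeriv_zero] at this

theorem DBound.nonneg {n : ℕ} {ω : E → ℝ} {f : E → F} (h : DBound n ω f) (z : E) : 0 ≤ ω z :=
  (norm_nonneg _).trans (h.norm_le z)

theorem DBound.mono {n m : ℕ} {ω ω' : E → ℝ} {f : E → F} (h : DBound n ω f) (hm : m ≤ n)
    (hω : ∀ z, ω z ≤ ω' z) : DBound m ω' f :=
  ⟨h.1.of_le (by exact_mod_cast hm), fun i hi z => (h.2 i (hi.trans hm) z).trans (hω z)⟩

theorem DBound.fderiv {n : ℕ} {ω : E → ℝ} {f : E → F} (h : DBound (n + 1) ω f) :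
    DBound n ω (fderiv ℝ f) := by
  refine ⟨h.1.fderiv_right (by norm_cast), fun m hm z => ?_⟩
  rw [norm_iteratedFDeriv_fderiv]
  exact h.2 (m + 1) (by omega) z

theorem dBound_succ {n : ℕ} {ω : E → ℝ} {f : E → F} (hf : ContDiff ℝ (n + 1) f)
    (h0 : ∀ z, ‖f z‖ ≤ ω z) (h : DBound n ω (_root_.fderiv ℝ f)) : DBound (n + 1) ω f := by
  refine ⟨by exact_mod_cast hf, fun m hm z => ?_⟩
  rcases m with _ | m
  · rw [norm_iteratedFDeriv_zero]; exact h0 z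
  · rw [← norm_iteratedFDeriv_fderiv]; exact h.2 m (by omega) z

theorem DBound.smul {n : ℕ} {ω ω' : E → ℝ} {c : E → ℝ} {f : E → F} (hc : DBound n ω c)
    (hf : DBound n ω' f) : DBound n (fun z => 2 ^ n * (ω z * ω' z)) (fun z => c z • f z) := by
  refine ⟨hc.1.smul hf.1, fun m hm z => ?_⟩
  refine (norm_iteratedFDeriv_smul_le hc.1 hf.1 z (by exact_mod_cast hm)).trans ?_
  have h1 : ∀ i ∈ Finset.range (m + 1), (m.choose i : ℝ) * ‖iteratedFDeriv ℝ i c z‖ *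
      ‖iteratedFDeriv ℝ (m - i) f z‖ ≤ m.choose i * (ω z * ω' z) := by
    intro i hi
    rw [Finset.mem_range] at hi
    rw [mul_assoc]
    gcongr
    · exact hc.nonneg z
    · exact hc.2 i (by omega) z
    · exact hf.2 (m - i) (by omega) z
  refine (Finset.sum_le_sum h1).trans ?_
  rw [← Finset.sum_mul]
  have h2 : ∑ i ∈ Finset.range (m + 1), (m.choose i : ℝ) = 2 ^ m := by
    exact_mod_cast Nat.sum_range_choose m
  rw [h2]
  exact mul_le_mul_of_nonneg_right (pow_le_pow_right₀ one_le_two hm)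
    (mul_nonneg (hc.nonneg z) (hf.nonneg z))

theorem DBound.clm {G : Type*} [NormedAddCommGroup G] [NormedSpace ℝ G] {n : ℕ} {ω : E → ℝ}
    {f : E → F} (h : DBound n ω f) (L : F →L[ℝ] G) :
    DBound n (fun z => ‖L‖ * ω z) (fun z => L (f z)) := by
  refine ⟨L.contDiff.comp h.1, fun m hm z => ?_⟩
  refine (L.norm_iteratedFDeriv_comp_left (f := f) (x := z) h.1.contDiffAt
    (by exact_mod_cast hm)).trans ?_
  exact mul_le_mul_of_nonneg_left (h.2 m hm z) (norm_nonneg L)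

theorem DBound.add {n : ℕ} {ω ω' : E → ℝ} {f g : E → F} (hf : DBound n ω f)
    (hg : DBound n ω' g) : DBound n (fun z => ω z + ω' z) (fun z => f z + g z) := by
  refine ⟨hf.1.add hg.1, fun m hm z => ?_⟩
  have e := iteratedFDeriv_add_apply (𝕜 := ℝ) (f := f) (g := g) (x := z) (i := m)
    (hf.1.of_le (by exact_mod_cast hm)).contDiffAt (hg.1.of_le (by exact_mod_cast hm)).contDiffAt
  rw [show (fun z => f z + g z) = f + g from rfl, e]
  exact (norm_add_le _ _).trans (add_le_add (hf.2 m hm z) (hg.2 m hm z))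

theorem DBound.neg {n : ℕ} {ω : E → ℝ} {f : E → F} (hf : DBound n ω f) :
    DBound n ω (fun z => -f z) := by
  refine ⟨hf.1.neg, fun m hm z => ?_⟩
  rw [show (fun z => -f z) = -f from rfl, iteratedFDeriv_neg_apply, norm_neg]
  exact hf.2 m hm z

theorem dBound_const (n : ℕ) (c : F) : DBound n (fun _ => ‖c‖) (fun _ : E => c) := by
  refine ⟨contDiff_const, fun m _ z => ?_⟩
  rcases m with _ | m
  · rw [norm_iteratedFDeriv_zero]
  · rw [iteratedFDeriv_const_of_ne (Nat.succ_ne_zero m)]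
    simp

theorem dBound_clm (n : ℕ) (L : E →L[ℝ] F) : DBound n (fun z => ‖L z‖ + ‖L‖) L := by
  rcases n with _ | n
  · refine ⟨L.contDiff, fun m hm z => ?_⟩
    rw [Nat.le_zero.1 hm, norm_iteratedFDeriv_zero]
    linarith [norm_nonneg L]
  · refine dBound_succ L.contDiff (fun z => by linarith [norm_nonneg L]) ?_
    have e : fderiv ℝ (L : E → F) = fun _ => L := funext fun z => L.fderiv
    rw [e]
    exact (dBound_const n L).mono le_rfl fun z => by linarith [norm_nonneg (L z)]

/-- Induction through `d(1/f) = -f⁻² df`: as `df` is controlled by `f`, each derivative of `1/f` is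
again controlled by `1/f`. The constant depends on `n` and `A` only, hence not on `ħ` or `L` when
applied to weights. -/
theorem exists_dBound_inv (n : ℕ) {A : ℝ} (hA : 1 ≤ A) :
    ∃ C : ℝ, 1 ≤ C ∧ ∀ f : E → ℝ, (∀ z, 0 < f z) → DBound n (fun z => A * f z) f →
      DBound n (fun z => C * (f z)⁻¹) (fun z => (f z)⁻¹) := by
  induction n with
  | zero =>
    refine ⟨1, le_rfl, fun f hf h => ⟨h.1.inv fun z => (hf z).ne', fun m hm z => ?_⟩⟩
    rw [Nat.le_zero.1 hm, norm_iteratedFDeriv_zero, norm_inv, Real.norm_of_nonneg (hf z).le]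
    exact (one_mul _).ge
  | succ n ih =>
    obtain ⟨C, hC, ih⟩ := ih
    refine ⟨2 ^ n * (2 ^ n * (C * C)) * A, ?_, fun f hf h => ?_⟩
    · have h1 : (1 : ℝ) ≤ 2 ^ n := one_le_pow₀ (by norm_num)
      have h2 : 1 ≤ C * C := one_le_mul_of_one_le_of_one_le hC hC
      exact one_le_mul_of_one_le_of_one_le (one_le_mul_of_one_le_of_one_le h1
        (one_le_mul_of_one_le_of_one_le h1 h2)) hA
    · have hi := ih f hf (h.mono (Nat.le_succ n) fun _ => le_rfl)
      have hfd := h.fderiv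
      have hp := ((hi.smul hi).smul hfd).neg
      have hdf : Differentiable ℝ f := h.1.differentiable (by norm_cast)
      have e : fderiv ℝ (fun z => (f z)⁻¹) =
          fun z => -(((f z)⁻¹ • (f z)⁻¹) • fderiv ℝ f z) := by
        ext1 z
        have := ((hasDerivAt_inv (hf z).ne').comp_hasFDerivAt z (hdf z).hasFDerivAt).fderiv
        refine this.trans ?_
        rw [smul_eq_mul, ← neg_smul]
        congr 1
        rw [sq, mul_inv]
      refine dBound_succ (by exact_mod_cast h.1.inv fun z => (hf z).ne') (fun z => ?_) ?_
      · rw [norm_inv, Real.norm_of_nonneg (hf z).le]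
        refine le_mul_of_one_le_left (inv_nonneg.2 (hf z).le) ?_
        have h1 : (1 : ℝ) ≤ 2 ^ n := one_le_pow₀ (by norm_num)
        have h2 : 1 ≤ C * C := one_le_mul_of_one_le_of_one_le hC hC
        exact one_le_mul_of_one_le_of_one_le (one_le_mul_of_one_le_of_one_le h1
          (one_le_mul_of_one_le_of_one_le h1 h2)) hA
      · rw [e]
        refine hp.mono le_rfl fun z => le_of_eq ?_
        have := (hf z).ne'
        field_simp

end DBound

/-! ### The weight, and rotation invariance of the Laplacian -/

/-- The weight `L + hbar |z|²`. -/
def weight (hbar L : ℝ) (p : ℝ × ℝ) : ℝ := L + hbar * (p.1 ^ 2 + p.2 ^ 2)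

/-- The gradient is linear and the Hessian constant. By `2|x| ≤ 1 + x²` the gradient is at most
`ħ(2+|z|²)` and the Hessian at most `4ħ`, so `6 = 2+4` suffices because `ħ ≤ 1 ≤ L`. -/
theorem dBound_weight (n : ℕ) {hbar L : ℝ} (h0 : 0 ≤ hbar) (h1 : hbar ≤ 1) (hL : 1 ≤ L) :
    DBound n (fun p => 6 * weight hbar L p) (weight hbar L) := by
  have hw : ∀ p : ℝ × ℝ, 0 ≤ hbar * (p.1 ^ 2 + p.2 ^ 2) := fun p => by positivity
  have hd : ContDiff ℝ (⊤ : ℕ∞) (weight hbar L) := by unfold weight; fun_prop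
  have hnorm : ∀ p, ‖weight hbar L p‖ ≤ 6 * weight hbar L p := fun p => by
    have : 0 ≤ weight hbar L p := by unfold weight; linarith [hw p]
    rw [Real.norm_of_nonneg this]; linarith
  rcases n with _ | n
  · refine ⟨hd.of_le (by exact_mod_cast le_top), fun m hm z => ?_⟩
    rw [Nat.le_zero.1 hm, norm_iteratedFDeriv_zero]
    exact hnorm z
  set M : ℝ × ℝ →L[ℝ] (ℝ × ℝ →L[ℝ] ℝ) :=
    (2 * hbar) • ((ContinuousLinearMap.fst ℝ ℝ ℝ).smulRight (ContinuousLinearMap.fst ℝ ℝ ℝ) +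
      (ContinuousLinearMap.snd ℝ ℝ ℝ).smulRight (ContinuousLinearMap.snd ℝ ℝ ℝ)) with hM
  have e : fderiv ℝ (weight hbar L) = M := by
    ext1 p
    have h1 : HasFDerivAt (fun p : ℝ × ℝ => p.1) (ContinuousLinearMap.fst ℝ ℝ ℝ) p := hasFDerivAt_fst
    have h2 : HasFDerivAt (fun p : ℝ × ℝ => p.2) (ContinuousLinearMap.snd ℝ ℝ ℝ) p := hasFDerivAt_snd
    refine ((((h1.pow 2).add (h2.pow 2)).const_mul hbar).const_add L).fderiv.trans ?_
    ext <;> simp [hM] <;> ring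
  have hMz : ∀ p, ‖M p‖ ≤ 2 * hbar * (|p.1| + |p.2|) := fun p => by
    have eM : M p = (2 * hbar) • (p.1 • ContinuousLinearMap.fst ℝ ℝ ℝ +
      p.2 • ContinuousLinearMap.snd ℝ ℝ ℝ) := rfl
    rw [eM, norm_smul, Real.norm_of_nonneg (by positivity)]
    gcongr
    refine (norm_add_le _ _).trans ?_
    rw [norm_smul, norm_smul]
    have a1 := ContinuousLinearMap.norm_fst_le ℝ ℝ ℝ
    have a2 := ContinuousLinearMap.norm_snd_le ℝ ℝ ℝ
    refine add_le_add (mul_le_of_le_one_right (abs_nonneg _) a1)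
      (mul_le_of_le_one_right (abs_nonneg _) a2)
  have hMn : ‖M‖ ≤ 4 * hbar := by
    refine M.opNorm_le_bound (by positivity) fun p => (hMz p).trans ?_
    have b1 : |p.1| ≤ ‖p‖ := norm_fst_le p
    have b2 : |p.2| ≤ ‖p‖ := norm_snd_le p
    nlinarith
  refine dBound_succ (hd.of_le (by exact_mod_cast le_top)) hnorm ?_
  rw [e]
  refine (dBound_clm n M).mono le_rfl fun p => ?_
  have c1 : 2 * |p.1| ≤ 1 + p.1 ^ 2 := by rw [← sq_abs]; nlinarith [sq_nonneg (|p.1| - 1)]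
  have c2 : 2 * |p.2| ≤ 1 + p.2 ^ 2 := by rw [← sq_abs]; nlinarith [sq_nonneg (|p.2| - 1)]
  have c3 := hMz p
  have c4 := hw p
  unfold weight
  nlinarith

theorem DBound.dirDeriv {n : ℕ} {ω : ℝ × ℝ → ℝ} {f : ℝ × ℝ → ℂ} (h : DBound (n + 1) ω f)
    {v : ℝ × ℝ} (hv : ‖v‖ ≤ 1) : DBound n ω (dirDeriv v f) := by
  refine (h.fderiv.clm (ContinuousLinearMap.apply ℝ ℂ v)).mono le_rfl fun z => ?_
  refine mul_le_of_le_one_left (h.nonneg z) ?_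
  refine ContinuousLinearMap.opNorm_le_bound _ zero_le_one fun L => ?_
  rw [ContinuousLinearMap.apply_apply, one_mul]
  exact (L.le_opNorm v).trans (mul_le_of_le_one_right (norm_nonneg _) hv)

theorem DBound.planeLaplacian {n : ℕ} {ω : ℝ × ℝ → ℝ} {f : ℝ × ℝ → ℂ} (h : DBound (n + 2) ω f) :
    DBound n (fun z => 2 * ω z) (planeLaplacian f) := by
  have v1 : ‖((1, 0) : ℝ × ℝ)‖ ≤ 1 := by simp [Prod.norm_def]
  have v2 : ‖((0, 1) : ℝ × ℝ)‖ ≤ 1 := by simp [Prod.norm_def]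
  refine (((h.dirDeriv v1).dirDeriv v1).add ((h.dirDeriv v2).dirDeriv v2)).mono le_rfl fun z => ?_
  linarith

theorem HasMode.radial_smul {k : ℤ} {g : ℝ × ℝ → ℂ} (h : HasMode k g) {c : ℝ × ℝ → ℝ}
    (hc : ∀ θ p, c (rot θ p) = c p) : HasMode k (fun p => c p • g p) := fun θ p => by
  simp only [hc, h θ p, Complex.real_smul]
  ring

/-- The rotation of the plane as a continuous linear map. -/
noncomputable def rotCLM (θ : ℝ) : ℝ × ℝ →L[ℝ] ℝ × ℝ :=
  (Real.cos θ • ContinuousLinearMap.fst ℝ ℝ ℝ - Real.sin θ • ContinuousLinearMap.snd ℝ ℝ ℝ).prod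
    (Real.sin θ • ContinuousLinearMap.fst ℝ ℝ ℝ + Real.cos θ • ContinuousLinearMap.snd ℝ ℝ ℝ)

theorem rotCLM_apply (θ : ℝ) (p : ℝ × ℝ) : rotCLM θ p = rot θ p := by
  simp [rotCLM, rot, mul_comm]

theorem dirDeriv_comp_rot {g : ℝ × ℝ → ℂ} (hg : Differentiable ℝ g) (θ : ℝ) (v p : ℝ × ℝ) :
    dirDeriv v (fun p => g (rot θ p)) p = dirDeriv (rot θ v) g (rot θ p) := by
  have h1 : HasFDerivAt (rot θ) (rotCLM θ) p := by
    have e : rot θ = rotCLM θ := funext fun p => (rotCLM_apply θ p).symm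
    rw [e]
    exact (rotCLM θ).hasFDerivAt
  have := (((hg (rot θ p)).hasFDerivAt.comp p h1)).fderiv
  unfold dirDeriv
  rw [show (fun p => g (rot θ p)) = g ∘ rot θ from rfl, this, ContinuousLinearMap.comp_apply,
    rotCLM_apply]

/-- The Laplacian may be computed in the rotated orthonormal frame. The mixed terms from the two
frame vectors cancel, and the pure ones add up by `sin² + cos² = 1`. -/
theorem HasMode.planeLaplacian {k : ℤ} {g : ℝ × ℝ → ℂ} (h : HasMode k g) (hg : ContDiff ℝ 2 g) :
    HasMode k (planeLaplacian g) := by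
  intro θ p
  set χ := Complex.exp (-(Complex.I * k * θ)) with hχ
  have hg1 : Differentiable ℝ g := hg.differentiable two_ne_zero
  have hd : ∀ v, Differentiable ℝ (HermiteWigner.dirDeriv v g) := fun v =>
    (contDiff_dirDeriv (m := 1) hg v (by norm_num)).differentiable one_ne_zero
  have hfun : (fun p => g (rot θ p)) = fun p => χ * g p := funext fun p => h θ p
  have hmul : ∀ (f : ℝ × ℝ → ℂ), Differentiable ℝ f → ∀ v q,
      HermiteWigner.dirDeriv v (fun p => χ * f p) q = χ * HermiteWigner.dirDeriv v f q := by
    intro f hf v q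
    unfold HermiteWigner.dirDeriv
    rw [((hf q).hasFDerivAt.const_mul χ).fderiv]
    simp
  have h1 : ∀ v, (fun q => HermiteWigner.dirDeriv (rot θ v) g (rot θ q)) =
      fun q => χ * HermiteWigner.dirDeriv v g q := fun v => by
    ext q
    rw [← dirDeriv_comp_rot hg1, hfun, hmul g hg1]
  have h2 : ∀ v q, HermiteWigner.dirDeriv (rot θ v) (HermiteWigner.dirDeriv (rot θ v) g) (rot θ q) =
      χ * HermiteWigner.dirDeriv v (HermiteWigner.dirDeriv v g) q := fun v q => by
    rw [← dirDeriv_comp_rot (hd _), h1, hmul _ (hd v)]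
  have hlin : ∀ (f : ℝ × ℝ → ℂ) (a b : ℝ) q, HermiteWigner.dirDeriv (a, b) f q =
      a * HermiteWigner.dirDeriv (1, 0) f q + b * HermiteWigner.dirDeriv (0, 1) f q := by
    intro f a b q
    unfold HermiteWigner.dirDeriv
    have e : ((a, b) : ℝ × ℝ) = a • (1, 0) + b • (0, 1) := by simp
    rw [e, map_add, map_smul, map_smul, Complex.real_smul, Complex.real_smul]
  have hlin2 : ∀ (a b : ℝ) q,
      HermiteWigner.dirDeriv (a, b) (HermiteWigner.dirDeriv (a, b) g) q =
      a * (a * HermiteWigner.dirDeriv (1, 0) (HermiteWigner.dirDeriv (1, 0) g) q +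
          b * HermiteWigner.dirDeriv (1, 0) (HermiteWigner.dirDeriv (0, 1) g) q) +
      b * (a * HermiteWigner.dirDeriv (0, 1) (HermiteWigner.dirDeriv (1, 0) g) q +
          b * HermiteWigner.dirDeriv (0, 1) (HermiteWigner.dirDeriv (0, 1) g) q) := by
    intro a b q
    have e : HermiteWigner.dirDeriv (a, b) g = fun q => a * HermiteWigner.dirDeriv (1, 0) g q +
        b * HermiteWigner.dirDeriv (0, 1) g q := funext fun q => hlin g a b q
    have e2 : ∀ v, HermiteWigner.dirDeriv v (HermiteWigner.dirDeriv (a, b) g) q =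
        a * HermiteWigner.dirDeriv v (HermiteWigner.dirDeriv (1, 0) g) q +
          b * HermiteWigner.dirDeriv v (HermiteWigner.dirDeriv (0, 1) g) q := by
      intro v
      rw [e]
      have e3 := (((hd (1, 0) q).hasFDerivAt.const_mul (a : ℂ)).add
        ((hd (0, 1) q).hasFDerivAt.const_mul (b : ℂ))).fderiv
      refine (DFunLike.congr_fun e3 v).trans ?_
      simp [HermiteWigner.dirDeriv]
    rw [hlin, e2, e2]
  have r1 : rot θ (1, 0) = (Real.cos θ, Real.sin θ) := by simp [rot]
  have r2 : rot θ (0, 1) = (-Real.sin θ, Real.cos θ) := by simp [rot]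
  have k1 := h2 (1, 0) p
  have k2 := h2 (0, 1) p
  rw [r1, hlin2] at k1
  rw [r2, hlin2] at k2
  have hcs : (Real.sin θ : ℂ) ^ 2 + (Real.cos θ : ℂ) ^ 2 = 1 := by
    exact_mod_cast Real.sin_sq_add_cos_sq θ
  push_cast at k1 k2 hcs
  unfold HermiteWigner.planeLaplacian
  linear_combination k1 + k2 -
    (HermiteWigner.dirDeriv (1, 0) (HermiteWigner.dirDeriv (1, 0) g) (rot θ p) +
      HermiteWigner.dirDeriv (0, 1) (HermiteWigner.dirDeriv (0, 1) g) (rot θ p)) * hcs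

/-- Weighted arithmetic–geometric mean: `c^{1-E}L^E ≤ (1-E)c + EL ≤ c + L`. -/
theorem mul_rpow_neg_mul_inv_add_le {c L E : ℝ} (hc : 1 ≤ c) (hL : 1 ≤ L) (h0 : 0 ≤ E)
    (h1 : E ≤ 1) : c * c ^ (-E) * (c + L)⁻¹ ≤ L ^ (-E) := by
  have c0 : 0 < c := by linarith
  have L0 : 0 < L := by linarith
  have h := Real.geom_mean_le_arith_mean2_weighted (w₁ := 1 - E) (w₂ := E) (by linarith) h0 c0.le
    L0.le (by ring)
  have e : c * c ^ (-E) = c ^ (1 - E) := by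
    rw [sub_eq_add_neg, Real.rpow_add c0, Real.rpow_one]
  rw [e, Real.rpow_neg L0.le, mul_inv_le_iff₀ (by linarith), ← div_eq_inv_mul,
    le_div_iff₀ (Real.rpow_pos_of_pos L0 E)]
  nlinarith

theorem one_le_weight {hbar L : ℝ} (h0 : 0 ≤ hbar) (p : ℝ × ℝ) : L ≤ weight hbar L p := by
  unfold weight
  have : 0 ≤ hbar * (p.1 ^ 2 + p.2 ^ 2) := by positivity
  linarith

theorem weight_rot (hbar L θ : ℝ) (p : ℝ × ℝ) : weight hbar L (rot θ p) = weight hbar L p := by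
  rw [weight, weight, rot_norm_sq]

/-! ### Decay in the energy -/

namespace LaguerreForm

variable {j k : ℕ} {Q : Polynomial ℝ} {g : ℝ × ℝ → ℂ} {K hbar : ℝ}

theorem norm_integral_le_of_dBound (h : LaguerreForm j k Q) (hK : 0 < K) (hm : HasMode k g)
    (hg : DBound 1 (fun _ => K) g) :
    ‖∫ p, g p * radialForm k Q p‖ ≤ 4000 * Real.pi * K * (k + 1) :=
  h.norm_integral_mul_le hm (by exact_mod_cast hg.1) hK hg.norm_le
    (DBound.fderiv (n := 0) hg).norm_le

theorem integral_mul_eq_of_dBound (h : LaguerreForm j k Q) (hg : DBound 2 (fun _ => K) g) :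
    (1 + hbar * (2 * j + k + 1) : ℂ) * ∫ p, g p * radialForm k Q p =
      (∫ p, weight hbar 1 p • g p * radialForm k Q p) -
        hbar / 4 * ∫ p, planeLaplacian g p * radialForm k Q p := by
  have hv : ∀ v ∈ ({(1, 0), (0, 1)} : Set (ℝ × ℝ)), ‖v‖ ≤ 1 := by
    rintro v (rfl | rfl) <;> simp [Prod.norm_def]
  refine h.integral_mul_eq (K := K) (by exact_mod_cast hg.1) hg.norm_le (fun v hv' => ?_)
    fun v hv' => ?_
  · exact (DBound.dirDeriv (n := 1) hg (hv v hv')).norm_le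
  · exact (DBound.dirDeriv (n := 0) (DBound.dirDeriv (n := 1) hg (hv v hv')) (hv v hv')).norm_le

/-- The case of decay exponent at most one. -/
theorem exists_norm_integral_le_small (n : ℕ) (hn : 2 ≤ n) :
    ∃ C : ℝ, 0 < C ∧ ∀ {j k : ℕ} {Q : Polynomial ℝ}, LaguerreForm j k Q → ∀ {hbar : ℝ},
      0 < hbar → hbar ≤ 1 → ∀ {E : ℝ}, 0 ≤ E → E ≤ 1 → E ≤ ((n : ℝ) - 1) / 2 → ∀ {K : ℝ}, 0 < K →
      ∀ {g : ℝ × ℝ → ℂ}, HasMode k g → DBound n (fun p => K * weight hbar 1 p ^ (-E)) g →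
      ‖∫ p, g p * radialForm k Q p‖ ≤ C * K * (k + 1) * (1 + hbar * (2 * j + k + 1)) ^ (-E) := by
  obtain ⟨B, hB, hinv⟩ := exists_dBound_inv (E := ℝ × ℝ) n (A := 6) (by norm_num)
  have hB0 : 0 < B := by linarith
  refine ⟨2 * (4000 * Real.pi * (2 ^ n * (6 * (2 ^ n * B)))) +
    4000 * Real.pi * (2 * (2 ^ n * B)), by positivity, ?_⟩
  intro j k Q h hbar hb0 hb1 E hE0 hE1 hEn K hK g hm hg
  set N : ℝ := 2 * j + k + 1 with hN
  have hN1 : 1 ≤ N := h.radialPair.one_le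
  set L : ℝ := 1 + hbar * N with hL
  have hL1 : 1 ≤ L := by rw [hL]; nlinarith
  have hL0 : 0 < L := by linarith
  set c := weight hbar 1 with hc
  set f := weight hbar (1 + L) with hf
  have hfc : ∀ p, f p = c p + L := fun p => by simp only [hf, hc, weight]; ring
  have hc1 : ∀ p, 1 ≤ c p := fun p => one_le_weight hb0.le p
  have hf0 : ∀ p, 0 < f p := fun p => by rw [hfc]; linarith [hc1 p]
  have dc : DBound n (fun p => 6 * c p) c := dBound_weight n hb0.le hb1 le_rfl
  have df : DBound n (fun p => 6 * f p) f := dBound_weight n hb0.le hb1 (by linarith)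
  have dfi := hinv f hf0 df
  -- Applying the operator to `g` itself would create the possibly growing symbol `c·c^{-E}`. After
  -- division by `f = c + L`, the symbol `c g₂` is `O(L^{-E})` and `g₂` with its derivatives is
  -- `O(L^{-1})`.
  set g₂ : ℝ × ℝ → ℂ := fun p => (f p)⁻¹ • g p with hg₂
  have m₂ : HasMode k g₂ := hm.radial_smul fun θ p => by rw [hf, weight_rot]
  have d₂ : DBound n (fun p => 2 ^ n * (B * (f p)⁻¹ * (K * c p ^ (-E)))) g₂ := dfi.smul hg
  have hcE : ∀ p, c p ^ (-E) ≤ 1 := fun p =>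
    Real.rpow_le_one_of_one_le_of_nonpos (hc1 p) (by linarith)
  have d₂L : DBound n (fun _ => 2 ^ n * B * K * L⁻¹) g₂ := d₂.mono le_rfl fun p => by
    have : B * (f p)⁻¹ * (K * c p ^ (-E)) ≤ B * L⁻¹ * (K * 1) := by
      have := (Real.rpow_pos_of_pos (lt_of_lt_of_le one_pos (hc1 p)) (-E)).le
      have := (inv_pos.2 (hf0 p)).le
      gcongr
      · rw [hfc]; linarith [hc1 p]
      · exact hcE p
    calc _ ≤ 2 ^ n * (B * L⁻¹ * (K * 1)) := by gcongr
      _ = _ := by ring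
  have mc : HasMode k fun p => c p • g₂ p := m₂.radial_smul fun θ p => by rw [hc, weight_rot]
  have d₃ : DBound 1 (fun _ => 2 ^ n * (6 * (2 ^ n * B)) * K * L ^ (-E)) fun p => c p • g₂ p := by
    refine (dc.smul d₂).mono (by omega) fun p => ?_
    have := mul_rpow_neg_mul_inv_add_le (hc1 p) hL1 hE0 hE1
    rw [← hfc] at this
    calc _ = 2 ^ n * (6 * (2 ^ n * B)) * K * (c p * c p ^ (-E) * (f p)⁻¹) := by ring
      _ ≤ _ := by gcongr
  have hLE : L ^ (-(1 : ℝ)) ≤ L ^ (-E) := Real.rpow_le_rpow_of_exponent_le hL1 (by linarith)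
  rw [Real.rpow_neg_one] at hLE
  have b₃ := h.norm_integral_le_of_dBound (by positivity) mc d₃
  have b₄ : hbar / 4 * ‖∫ p, planeLaplacian g₂ p * radialForm k Q p‖ ≤
      4000 * Real.pi * (2 * (2 ^ n * B)) * K * (k + 1) * L ^ (-E) := by
    have ml : HasMode k (planeLaplacian g₂) :=
      m₂.planeLaplacian (d₂.1.of_le (by exact_mod_cast hn))
    -- For `n = 2` the Laplacian of `g₂` has no derivative left, so only the `√N` bound applies. The
    -- loss is covered by `ħ√N ≤ √L`, because then `E ≤ 1/2`.
    rcases Nat.lt_or_ge n 3 with h3 | h3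
    · obtain rfl : n = 2 := by omega
      have dl : DBound 0 (fun _ => 2 * (2 ^ 2 * B * K * L⁻¹)) (planeLaplacian g₂) :=
        DBound.planeLaplacian (n := 0) d₂L
      have b := h.norm_integral_mul_le_sqrt ml dl.norm_le
      rw [← hN] at b
      have hsq : hbar * Real.sqrt N ≤ Real.sqrt L := by
        have e1 : hbar * Real.sqrt N = Real.sqrt (hbar ^ 2 * N) := by
          rw [Real.sqrt_mul (sq_nonneg _), Real.sqrt_sq hb0.le]
        rw [e1]
        apply Real.sqrt_le_sqrt
        have : hbar ^ 2 ≤ hbar := by nlinarith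
        nlinarith
      have hLs : L⁻¹ * Real.sqrt L ≤ L ^ (-E) := by
        have e1 : L⁻¹ * Real.sqrt L = L ^ (-(1 / 2) : ℝ) := by
          rw [← Real.rpow_neg_one, Real.sqrt_eq_rpow, ← Real.rpow_add hL0]; norm_num
        rw [e1]
        refine Real.rpow_le_rpow_of_exponent_le hL1 ?_
        push_cast at hEn
        linarith
      calc hbar / 4 * ‖∫ p, planeLaplacian g₂ p * radialForm k Q p‖
          ≤ hbar / 4 * (5 * Real.pi * (2 * (2 ^ 2 * B * K * L⁻¹)) * Real.sqrt N) := by gcongr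
        _ = 5 / 4 * Real.pi * (2 * (2 ^ 2 * B)) * K * 1 * (L⁻¹ * (hbar * Real.sqrt N)) := by ring
        _ ≤ 4000 * Real.pi * (2 * (2 ^ 2 * B)) * K * (k + 1) * (L⁻¹ * Real.sqrt L) := by
          have : (0 : ℝ) ≤ k := Nat.cast_nonneg k
          gcongr
          · norm_num
          · linarith
        _ ≤ _ := by gcongr
    · have dl : DBound 1 (fun _ => 2 * (2 ^ n * B * K * L⁻¹)) (planeLaplacian g₂) :=
        DBound.planeLaplacian (n := 1) (d₂L.mono h3 fun _ => le_rfl)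
      have b := h.norm_integral_le_of_dBound (by positivity) ml dl
      calc hbar / 4 * ‖∫ p, planeLaplacian g₂ p * radialForm k Q p‖
          ≤ 1 * (4000 * Real.pi * (2 * (2 ^ n * B * K * L⁻¹)) * (k + 1)) := by
            gcongr
            linarith
        _ = 4000 * Real.pi * (2 * (2 ^ n * B)) * K * (k + 1) * L⁻¹ := by ring
        _ ≤ _ := by gcongr
  have key := h.integral_mul_eq_of_dBound (hbar := hbar) (d₂L.mono hn fun _ => le_rfl)
  have dR := gaussDecay_radialForm k Q
  have i1 : Integrable fun p => c p • g₂ p * radialForm k Q p :=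
    (dR.bdd_mul d₃.1.continuous d₃.norm_le).integrable
  have i2 : Integrable fun p => g₂ p * radialForm k Q p :=
    (dR.bdd_mul d₂.1.continuous d₂L.norm_le).integrable
  -- Since `g = c g₂ + L g₂` and the eigenvalue relation expresses `L∫g₂R` by the same `∫c g₂R`
  -- minus the Laplacian term, the first integral is counted twice.
  have split : ∫ p, g p * radialForm k Q p =
      (∫ p, c p • g₂ p * radialForm k Q p) + L * ∫ p, g₂ p * radialForm k Q p := by
    rw [← integral_const_mul, ← integral_add i1 (i2.const_mul _)]
    congr 1
    ext p
    have hne : (f p : ℂ) ≠ 0 := by exact_mod_cast (hf0 p).ne'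
    have hfc' : (f p : ℂ) = c p + L := by exact_mod_cast hfc p
    simp only [hg₂, Complex.real_smul, Complex.ofReal_inv]
    field_simp
    rw [hfc']
  have hLc : (L : ℂ) = 1 + hbar * (2 * j + k + 1) := by rw [hL, hN]; push_cast; ring
  rw [← hLc] at key
  rw [split, key]
  have n1 : ‖(hbar / 4 : ℂ) * ∫ p, planeLaplacian g₂ p * radialForm k Q p‖ =
      hbar / 4 * ‖∫ p, planeLaplacian g₂ p * radialForm k Q p‖ := by
    rw [norm_mul]
    congr 1
    rw [show (hbar / 4 : ℂ) = ((hbar / 4 : ℝ) : ℂ) by push_cast; rfl, Complex.norm_real,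
      Real.norm_of_nonneg (by positivity)]
  calc _ ≤ ‖∫ p, c p • g₂ p * radialForm k Q p‖ + (‖∫ p, c p • g₂ p * radialForm k Q p‖ +
        ‖(hbar / 4 : ℂ) * ∫ p, planeLaplacian g₂ p * radialForm k Q p‖) :=
        (norm_add_le _ _).trans (add_le_add_right (norm_sub_le _ _) _)
    _ ≤ 4000 * Real.pi * (2 ^ n * (6 * (2 ^ n * B)) * K * L ^ (-E)) * (k + 1) +
        (4000 * Real.pi * (2 ^ n * (6 * (2 ^ n * B)) * K * L ^ (-E)) * (k + 1) +
        4000 * Real.pi * (2 * (2 ^ n * B)) * K * (k + 1) * L ^ (-E)) := by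
        rw [n1]
        exact add_le_add b₃ (add_le_add b₃ b₄)
    _ = _ := by ring

/-- The integral of a symbol of order `-2E` against the Wigner function of `|h_{j+k}⟩⟨h_j|`. -/
theorem exists_norm_integral_le (n : ℕ) (hn : 1 ≤ n) :
    ∃ C : ℝ, 0 < C ∧ ∀ {j k : ℕ} {Q : Polynomial ℝ}, LaguerreForm j k Q → ∀ {hbar : ℝ},
      0 < hbar → hbar ≤ 1 → ∀ {E : ℝ}, 0 ≤ E → E ≤ ((n : ℝ) - 1) / 2 → ∀ {K : ℝ}, 0 < K →
      ∀ {g : ℝ × ℝ → ℂ}, HasMode k g → DBound n (fun p => K * weight hbar 1 p ^ (-E)) g →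
      ‖∫ p, g p * radialForm k Q p‖ ≤ C * K * (k + 1) * (1 + hbar * (2 * j + k + 1)) ^ (-E) := by
  induction n using Nat.strong_induction_on with
  | _ n ih =>
  rcases hn.eq_or_lt with rfl | h2
  · refine ⟨4000 * Real.pi, by positivity, ?_⟩
    intro j k Q h hbar hb0 hb1 E hE0 hEn K hK g hm hg
    obtain rfl : E = 0 := by norm_num at hEn; linarith
    simp only [neg_zero, Real.rpow_zero, mul_one] at hg ⊢
    exact h.norm_integral_le_of_dBound hK hm hg
  · obtain ⟨C₁, hC₁, small⟩ := exists_norm_integral_le_small n h2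
    -- The induction hypothesis at `n - 2` exists only for `n ≥ 3`; otherwise a dummy constant is
    -- taken, so that the final constant can be fixed before `E` is known.
    obtain ⟨C₂, hC₂, large⟩ : ∃ C : ℝ, 0 < C ∧ (3 ≤ n → ∀ {j k : ℕ} {Q : Polynomial ℝ},
        LaguerreForm j k Q → ∀ {hbar : ℝ},
        0 < hbar → hbar ≤ 1 → ∀ {E : ℝ}, 0 ≤ E → E ≤ (((n - 2 : ℕ) : ℝ) - 1) / 2 →
        ∀ {K : ℝ}, 0 < K →
        ∀ {g : ℝ × ℝ → ℂ}, HasMode k g → DBound (n - 2) (fun p => K * weight hbar 1 p ^ (-E)) g →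
        ‖∫ p, g p * radialForm k Q p‖ ≤
          C * K * (k + 1) * (1 + hbar * (2 * j + k + 1)) ^ (-E)) := by
      by_cases h3 : 3 ≤ n
      · obtain ⟨C, hC, hh⟩ := ih (n - 2) (by omega) (by omega)
        exact ⟨C, hC, fun _ => hh⟩
      · exact ⟨1, one_pos, fun h => absurd h h3⟩
    refine ⟨C₁ + C₂ * (2 ^ n * 6 + 2), by positivity, ?_⟩
    intro j k Q h hbar hb0 hb1 E hE0 hEn K hK g hm hg
    set N : ℝ := 2 * j + k + 1 with hN
    have hN1 : 1 ≤ N := h.radialPair.one_le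
    set L : ℝ := 1 + hbar * N with hL
    have hL1 : 1 ≤ L := by rw [hL]; nlinarith
    have hL0 : 0 < L := by linarith
    have hLE := Real.rpow_pos_of_pos hL0 (-E)
    rcases le_or_gt E 1 with hE1 | hE1
    · refine (small h hb0 hb1 hE0 hE1 hEn hK hm hg).trans ?_
      gcongr
      have : 0 ≤ C₂ * (2 ^ n * 6 + 2) := by positivity
      linarith
    -- For `E > 1` both `c g` and `Δg` are symbols of exponent `E - 1` with `n - 2` derivatives, and
    -- `E - 1 ≤ ((n-2)-1)/2`. The induction gives `L^{-(E-1)}`, and dividing by the eigenvalue `L`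
    -- restores the missing power.
    · have h3 : (3 : ℝ) < n := by linarith
      have h3' : 3 < n := by exact_mod_cast h3
      set c := weight hbar 1 with hc
      have hc1 : ∀ p, 1 ≤ c p := fun p => one_le_weight hb0.le p
      have dc : DBound n (fun p => 6 * c p) c := dBound_weight n hb0.le hb1 le_rfl
      have hcp : ∀ p, c p * c p ^ (-E) = c p ^ (-(E - 1)) := fun p => by
        rw [show -(E - 1) = 1 + -E by ring, Real.rpow_add (by linarith [hc1 p]), Real.rpow_one]
      have hcE : ∀ p, c p ^ (-E) ≤ c p ^ (-(E - 1)) := fun p =>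
        Real.rpow_le_rpow_of_exponent_le (hc1 p) (by linarith)
      have hcE1 : ∀ p, c p ^ (-E) ≤ 1 := fun p =>
        Real.rpow_le_one_of_one_le_of_nonpos (hc1 p) (by linarith)
      have hEn2 : E - 1 ≤ (((n - 2 : ℕ) : ℝ) - 1) / 2 := by
        rw [Nat.cast_sub (by omega)]; push_cast; linarith
      have key := h.integral_mul_eq_of_dBound (hbar := hbar) (K := K) (g := g)
        (hg.mono h2 fun p => mul_le_of_le_one_right hK.le (hcE1 p))
      have d1 : DBound (n - 2) (fun p => 2 ^ n * 6 * K * c p ^ (-(E - 1))) fun p => c p • g p :=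
        (dc.smul hg).mono (by omega) fun p => le_of_eq (by rw [← hcp]; ring)
      have d2 : DBound (n - 2) (fun p => 2 * K * c p ^ (-(E - 1))) (planeLaplacian g) := by
        refine (DBound.planeLaplacian (n := n - 2) (hg.mono (by omega) fun _ => le_rfl)).mono le_rfl
          fun p => ?_
        rw [mul_assoc]
        exact mul_le_mul_of_nonneg_left (mul_le_mul_of_nonneg_left (hcE p) hK.le) zero_le_two
      have b1 := large h3'.le h hb0 hb1 (by linarith) hEn2 (by positivity)
        (hm.radial_smul (c := c) fun θ p => by rw [hc, weight_rot]) d1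
      have b2 := large h3'.le h hb0 hb1 (by linarith) hEn2 (by positivity)
        (hm.planeLaplacian (hg.1.of_le (by exact_mod_cast h2))) d2
      have hLc : (L : ℂ) = 1 + hbar * (2 * j + k + 1) := by rw [hL, hN]; push_cast; ring
      rw [← hLc] at key
      rw [← hN, ← hL] at b1 b2
      have n1 : ‖(hbar / 4 : ℂ) * ∫ p, planeLaplacian g p * radialForm k Q p‖ ≤
          ‖∫ p, planeLaplacian g p * radialForm k Q p‖ := by
        rw [norm_mul]
        refine mul_le_of_le_one_left (norm_nonneg _) ?_
        rw [show (hbar / 4 : ℂ) = ((hbar / 4 : ℝ) : ℂ) by push_cast; rfl, Complex.norm_real,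
          Real.norm_of_nonneg (by positivity)]
        linarith
      have hmul : L * ‖∫ p, g p * radialForm k Q p‖ ≤
          C₂ * (2 ^ n * 6 + 2) * K * (k + 1) * L ^ (-(E - 1)) := by
        calc L * ‖∫ p, g p * radialForm k Q p‖ = ‖(L : ℂ) * ∫ p, g p * radialForm k Q p‖ := by
              rw [norm_mul, Complex.norm_real, Real.norm_of_nonneg hL0.le]
          _ ≤ _ := by rw [key]; exact norm_sub_le _ _
          _ ≤ C₂ * (2 ^ n * 6 * K) * (k + 1) * L ^ (-(E - 1)) +
              C₂ * (2 * K) * (k + 1) * L ^ (-(E - 1)) := add_le_add b1 (n1.trans b2)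
          _ = _ := by ring
      have eL : L ^ (-(E - 1)) = L * L ^ (-E) := by
        rw [show -(E - 1) = 1 + -E by ring, Real.rpow_add hL0, Real.rpow_one]
      rw [eL] at hmul
      have : ‖∫ p, g p * radialForm k Q p‖ ≤ C₂ * (2 ^ n * 6 + 2) * K * (k + 1) * L ^ (-E) := by
        refine le_of_mul_le_mul_left (hmul.trans (le_of_eq ?_)) hL0
        ring
      refine this.trans ?_
      gcongr
      linarith

end LaguerreForm

end HermiteWigner

/-! ### Matrix elements as phase-space pairings -/

namespace HermiteWigner

open Set Filter Topology Polynomial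

/-- The linear map of the plane with matrix `!![a, b; c, d]`. -/
def linPlane (a b c d : ℝ) (p : ℝ × ℝ) : ℝ × ℝ := (a * p.1 + b * p.2, c * p.1 + d * p.2)

section LinPlane

variable {a b c d : ℝ} {F : Type*} [NormedAddCommGroup F]

theorem continuous_linPlane : Continuous (linPlane a b c d) := by unfold linPlane; fun_prop

theorem map_linPlane (h : a * d - b * c ≠ 0) :
    Measure.map (linPlane a b c d) (volume : Measure (ℝ × ℝ)) =
      ENNReal.ofReal |(a * d - b * c)⁻¹| • volume := by
  set L := Matrix.toLin (Module.Basis.finTwoProd ℝ) (Module.Basis.finTwoProd ℝ) !![a, b; c, d]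
    with hL
  have hdet : LinearMap.det L = a * d - b * c := by
    rw [hL, LinearMap.det_toLin, Matrix.det_fin_two_of]
  have e : linPlane a b c d = L := funext fun p => by
    rw [hL, Matrix.toLin_finTwoProd_apply]; rfl
  rw [e, ← hdet]
  exact Measure.map_linearMap_addHaar_eq_smul_addHaar volume (by rw [hdet]; exact h)

theorem quasiMeasurePreserving_linPlane (h : a * d - b * c ≠ 0) :
    Measure.QuasiMeasurePreserving (linPlane a b c d) (volume : Measure (ℝ × ℝ)) volume :=
  ⟨continuous_linPlane.measurable, by
    rw [map_linPlane h]; exact Measure.smul_absolutelyContinuous⟩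

theorem memLp_comp_linPlane (h : a * d - b * c ≠ 0) {f : ℝ × ℝ → F} {q : ℝ≥0∞}
    (hf : MemLp f q volume) : MemLp (fun p => f (linPlane a b c d p)) q volume := by
  have h1 : MemLp f q (Measure.map (linPlane a b c d) volume) := by
    rw [map_linPlane h]; exact hf.smul_measure ENNReal.ofReal_ne_top
  exact h1.comp_of_map continuous_linPlane.aemeasurable

theorem integral_comp_linPlane [NormedSpace ℝ F] (h : a * d - b * c ≠ 0) {f : ℝ × ℝ → F}
    (hf : AEStronglyMeasurable f volume) :
    ∫ p, f (linPlane a b c d p) = |(a * d - b * c)⁻¹| • ∫ p, f p := by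
  rw [← integral_map continuous_linPlane.aemeasurable, map_linPlane h, integral_smul_measure,
    ENNReal.toReal_ofReal (abs_nonneg _)]
  rw [map_linPlane h]
  exact hf.mono_ac Measure.smul_absolutelyContinuous

end LinPlane

/-- Polynomials times a fixed Gaussian are closed under differentiation, whence the Schwartz
property. -/
theorem iteratedDeriv_gaussPoly (n : ℕ) (c : ℝ) (p : ℝ[X]) : ∃ q : ℝ[X],
    iteratedDeriv n (fun y : ℝ => ((p.eval y * Real.exp (-(c * y ^ 2)) : ℝ) : ℂ)) =
      fun y : ℝ => ((q.eval y * Real.exp (-(c * y ^ 2)) : ℝ) : ℂ) := by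
  induction n generalizing p with
  | zero => exact ⟨p, iteratedDeriv_zero⟩
  | succ n ih =>
    have e : deriv (fun y : ℝ => ((p.eval y * Real.exp (-(c * y ^ 2)) : ℝ) : ℂ)) =
        fun y : ℝ => (((derivative p - C (2 * c) * X * p).eval y * Real.exp (-(c * y ^ 2)) : ℝ) : ℂ) := by
      ext1 y
      have h1 : HasDerivAt (fun y : ℝ => -(c * y ^ 2)) (-(c * (2 * y))) y := by
        simpa using ((hasDerivAt_pow 2 y).const_mul c).fun_neg
      refine (((p.hasDerivAt y).mul h1.exp).ofReal_comp).deriv.trans ?_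
      simp only [eval_sub, eval_mul, eval_C, eval_X]
      congr 1
      ring
    rw [iteratedDeriv_succ', e]
    exact ih _

/-- A polynomial times a Gaussian, as a Schwartz function. -/
noncomputable def gaussPoly {c : ℝ} (hc : 0 < c) (p : ℝ[X]) : SchwartzMap ℝ ℂ where
  toFun y := ((p.eval y * Real.exp (-(c * y ^ 2)) : ℝ) : ℂ)
  smooth' := by
    have h1 : ContDiff ℝ (⊤ : ℕ∞) fun y => p.eval y := by
      simpa using Polynomial.contDiff_aeval (𝕜 := ℝ) p (⊤ : ℕ∞)
    exact Complex.ofRealCLM.contDiff.comp (h1.mul (by fun_prop))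
  decay' k n := by
    obtain ⟨q, hq⟩ := iteratedDeriv_gaussPoly n c p
    obtain ⟨K, _, hK⟩ := exists_eval_mul_exp_le (X ^ k * q) hc
    refine ⟨K, fun y => ?_⟩
    rw [norm_iteratedFDeriv_eq_norm_iteratedDeriv, hq]
    refine le_of_eq_of_le ?_ (hK y)
    rw [Complex.norm_real, norm_mul, Real.norm_eq_abs, Real.norm_eq_abs, Real.norm_eq_abs,
      Real.abs_exp, eval_mul, eval_pow, eval_X, abs_mul, abs_pow, mul_assoc]

theorem gaussPoly_apply {c : ℝ} (hc : 0 < c) (p : ℝ[X]) (y : ℝ) :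
    gaussPoly hc p y = ((p.eval y * Real.exp (-(c * y ^ 2)) : ℝ) : ℂ) := rfl

theorem exists_hermiteOne_eq (j : ℕ) :
    ∃ p : ℝ[X], ∀ u, hermiteOne j u = p.eval u * Real.exp (-(u ^ 2) / 2) := by
  refine ⟨C (Real.pi ^ (-(1 / 4) : ℝ) / Real.sqrt (j.factorial : ℝ)) *
    ((Polynomial.hermite j).map (Int.castRingHom ℝ)).comp (C (Real.sqrt 2) * X), fun u => ?_⟩
  rw [hermiteOne]
  simp only [eval_mul, eval_C, eval_comp, eval_X, eval_map, aeval_def]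
  rfl

theorem exists_hermitePair_eq (j m : ℕ) (x : ℝ) :
    ∃ p : ℝ[X], ∀ y, hermitePair j m x y = p.eval y * Real.exp (-(1 / 4 * y ^ 2)) := by
  obtain ⟨p, hp⟩ := exists_hermiteOne_eq j
  obtain ⟨q, hq⟩ := exists_hermiteOne_eq m
  refine ⟨C (Real.exp (-x ^ 2)) * p.comp (C x - C (1 / 2) * X) * q.comp (C x + C (1 / 2) * X),
    fun y => ?_⟩
  simp only [hermitePair, hp, hq, eval_mul, eval_C, eval_comp, eval_sub, eval_add, eval_X]
  have e : Real.exp (-((x - y / 2) ^ 2) / 2) * Real.exp (-((x + y / 2) ^ 2) / 2) =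
      Real.exp (-x ^ 2) * Real.exp (-(1 / 4 * y ^ 2)) := by
    rw [← Real.exp_add, ← Real.exp_add]; congr 1; ring
  rw [show x - 1 / 2 * y = x - y / 2 by ring, show x + 1 / 2 * y = x + y / 2 by ring]
  linear_combination (eval (x - y / 2) p * eval (x + y / 2) q) * e

/-- Parseval's identity against a Schwartz function. -/
theorem integral_mul_conj_schwartz {f : ℝ → ℂ} (hf : MemLp f 2 volume) (φ : SchwartzMap ℝ ℂ) :
    ∫ y, f y * (starRingEnd ℂ) (φ y) =
      ∫ η, (𝓕 hf.toLp : L2R) η * (starRingEnd ℂ) (𝓕 (φ : ℝ → ℂ) η) := by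
  have h := Lp.inner_fourier_eq (φ.toLp 2 : L2R) (hf.toLp : L2R)
  rw [SchwartzMap.toLp_fourier_eq, L2.inner_def, L2.inner_def] at h
  simp only [RCLike.inner_apply] at h
  have e1 : ∫ y, f y * (starRingEnd ℂ) (φ y) =
      ∫ y, (hf.toLp : L2R) y * (starRingEnd ℂ) ((φ.toLp 2 : L2R) y) := by
    refine integral_congr_ae ?_
    filter_upwards [hf.coeFn_toLp, φ.coeFn_toLp 2] with y h1 h2
    rw [h1, h2]
  have e2 : ∫ η, (𝓕 hf.toLp : L2R) η * (starRingEnd ℂ) (𝓕 (φ : ℝ → ℂ) η) =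
      ∫ η, (𝓕 hf.toLp : L2R) η * (starRingEnd ℂ) (((𝓕 φ).toLp 2 : L2R) η) := by
    refine integral_congr_ae ?_
    filter_upwards [(𝓕 φ).coeFn_toLp 2] with y h2
    rw [h2, SchwartzMap.fourier_coe]
  rw [e1, e2, h]

theorem hermiteFun_mul_hermiteFun {hbar : ℝ} (h : 0 < hbar) (j m : ℕ) (x y : ℝ) :
    hermiteFun hbar m (x + hbar * y / 2) * hermiteFun hbar j (x - hbar * y / 2) =
      ((hbar ^ (-(1 / 2) : ℝ) * hermitePair j m (x / Real.sqrt hbar) (Real.sqrt hbar * y) : ℝ) : ℂ) := by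
  rw [hermiteFun_eq h, hermiteFun_eq h, ← Complex.ofReal_mul]
  congr 1
  have h0 : 0 < Real.sqrt hbar := Real.sqrt_pos.2 h
  have h1 := Real.mul_self_sqrt h.le
  have e1 : (x + hbar * y / 2) / Real.sqrt hbar = x / Real.sqrt hbar + Real.sqrt hbar * y / 2 := by
    field_simp; linear_combination -y * h1
  have e2 : (x - hbar * y / 2) / Real.sqrt hbar = x / Real.sqrt hbar - Real.sqrt hbar * y / 2 := by
    field_simp; linear_combination y * h1
  have e3 : hbar ^ (-(1 / 2) : ℝ) = hbar ^ (-(1 / 4) : ℝ) * hbar ^ (-(1 / 4) : ℝ) := by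
    rw [← Real.rpow_add h]; norm_num
  rw [e1, e2, e3, hermitePair]
  ring

theorem exists_schwartz_pair {hbar : ℝ} (h : 0 < hbar) (j m : ℕ) (x : ℝ) :
    ∃ φ : SchwartzMap ℝ ℂ, ∀ y, φ y =
      hermiteFun hbar m (x + hbar * y / 2) * hermiteFun hbar j (x - hbar * y / 2) := by
  obtain ⟨p, hp⟩ := exists_hermitePair_eq j m (x / Real.sqrt hbar)
  refine ⟨gaussPoly (c := 1 / 4 * hbar) (by positivity)
    (C (hbar ^ (-(1 / 2) : ℝ)) * p.comp (C (Real.sqrt hbar) * X)), fun y => ?_⟩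
  rw [hermiteFun_mul_hermiteFun h, gaussPoly_apply, hp]
  simp only [eval_mul, eval_C, eval_comp, eval_X]
  rw [mul_pow, Real.sq_sqrt h.le]
  congr 1
  ring_nf

/-- Conjugation reverses the phase and fixes the real integrand. The substitution `t = √ħ y` and the
normalisation of the Hermite functions contribute `ħ^{-1/2}` each. -/
theorem conj_fourier_pair {hbar : ℝ} (h : 0 < hbar) (j m : ℕ) (x ξ : ℝ) :
    (starRingEnd ℂ) (𝓕 (fun y : ℝ => hermiteFun hbar m (x + hbar * y / 2) *
      hermiteFun hbar j (x - hbar * y / 2)) (ξ / (2 * Real.pi))) =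
      (hbar : ℂ)⁻¹ * crossWigner j m (x / Real.sqrt hbar) (ξ / Real.sqrt hbar) := by
  have h0 : 0 < Real.sqrt hbar := Real.sqrt_pos.2 h
  have hc0 : (Real.sqrt hbar : ℂ) ≠ 0 := by exact_mod_cast h0.ne'
  rw [Real.fourier_real_eq_integral_exp_smul, ← integral_conj]
  have e : ∀ y : ℝ, (starRingEnd ℂ) (Complex.exp ((-2 * Real.pi * y * (ξ / (2 * Real.pi)) : ℝ) *
      Complex.I) • (hermiteFun hbar m (x + hbar * y / 2) * hermiteFun hbar j (x - hbar * y / 2))) =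
      ((hbar ^ (-(1 / 2) : ℝ) : ℝ) : ℂ) * (fun t : ℝ => Complex.exp (Complex.I *
        ((ξ / Real.sqrt hbar : ℝ) : ℂ) * t) * (hermitePair j m (x / Real.sqrt hbar) t : ℂ))
        (Real.sqrt hbar * y) := by
    intro y
    rw [hermiteFun_mul_hermiteFun h, smul_eq_mul, map_mul, ← Complex.exp_conj, map_mul,
      Complex.conj_ofReal, Complex.conj_ofReal, Complex.conj_I]
    have e1 : (-2 * Real.pi * y * (ξ / (2 * Real.pi)) : ℝ) = -(y * ξ) := by
      have := Real.pi_ne_zero; field_simp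
    have e2 : Complex.I * ((ξ / Real.sqrt hbar : ℝ) : ℂ) * ((Real.sqrt hbar * y : ℝ) : ℂ) =
        ((-(y * ξ) : ℝ) : ℂ) * -Complex.I := by
      push_cast; field_simp
    simp only [e1, e2]
    push_cast
    ring
  simp only [e]
  have e3 := Measure.integral_comp_mul_left (fun t : ℝ => Complex.exp (Complex.I *
    ((ξ / Real.sqrt hbar : ℝ) : ℂ) * t) * (hermitePair j m (x / Real.sqrt hbar) t : ℂ))
    (Real.sqrt hbar)
  rw [integral_const_mul, e3, abs_of_pos (inv_pos.2 h0), Complex.real_smul, ← mul_assoc]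
  congr 1
  rw [← Complex.ofReal_mul, ← Complex.ofReal_inv]
  congr 1
  rw [← Real.rpow_neg_one hbar, Real.sqrt_eq_rpow, ← Real.rpow_neg_one (hbar ^ _), ← Real.rpow_mul h.le,
    ← Real.rpow_add h]
  norm_num

theorem GaussDecay.conj {f : ℝ × ℝ → ℂ} (hf : GaussDecay f) :
    GaussDecay fun p => (starRingEnd ℂ) (f p) := by
  obtain ⟨c, K, n, h⟩ := hf
  exact ⟨Complex.continuous_conj.comp c, K, n, fun p => by rw [RCLike.norm_conj]; exact h p⟩

theorem crossWigner_eq_radialForm {j k : ℕ} {Q : ℝ[X]} (h : LaguerreForm j k Q) (p : ℝ × ℝ) :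
    crossWigner j (j + k) p.1 p.2 = radialForm k Q p := h.form p.1 p.2

theorem gaussDecay_crossWigner (j m : ℕ) : GaussDecay fun p => crossWigner j m p.1 p.2 := by
  rcases le_total j m with h | h
  · obtain ⟨k, rfl⟩ := Nat.exists_eq_add_of_le h
    obtain ⟨Q, hQ⟩ := exists_laguerreForm j k
    simp only [crossWigner_eq_radialForm hQ]
    exact gaussDecay_radialForm k Q
  · obtain ⟨k, rfl⟩ := Nat.exists_eq_add_of_le h
    obtain ⟨Q, hQ⟩ := exists_laguerreForm m k
    simp only [crossWigner_conj (m + k) m, crossWigner_eq_radialForm hQ]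
    exact (gaussDecay_radialForm k Q).conj

theorem GaussDecay.memLp {f : ℝ × ℝ → ℂ} (hf : GaussDecay f) : MemLp f 2 volume := by
  rw [memLp_two_iff_integrable_sq_norm hf.1.aestronglyMeasurable]
  obtain ⟨K, n, h⟩ := hf.2
  have h2 : GaussDecay fun p => f p * f p := by
    refine hf.mul_of_le hf.1 (L := |K|) (m := n) fun p => (h p).trans ?_
    have : Real.exp (-(p.1 ^ 2 + p.2 ^ 2)) ≤ 1 := Real.exp_le_one_iff.2 (by
      have : 0 ≤ p.1 ^ 2 + p.2 ^ 2 := by positivity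
      linarith)
    refine (mul_le_mul (mul_le_mul_of_nonneg_right (le_abs_self K) (by positivity)) this
      (Real.exp_pos _).le (by positivity)).trans (by rw [mul_one])
  refine h2.integrable.norm.congr (Eventually.of_forall fun p => ?_)
  simp [sq]

theorem memLp_crossWigner_scaled {hbar : ℝ} (h : 0 < hbar) (j m : ℕ) :
    MemLp (fun p : ℝ × ℝ => crossWigner j m (p.1 / Real.sqrt hbar) (p.2 / Real.sqrt hbar)) 2
      volume := by
  have h0 : 0 < Real.sqrt hbar := Real.sqrt_pos.2 h
  have := memLp_comp_linPlane (a := 1 / Real.sqrt hbar) (b := 0) (c := 0) (d := 1 / Real.sqrt hbar)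
    (by rw [mul_zero, sub_zero]; positivity) (gaussDecay_crossWigner j m).memLp
  refine this.ae_eq (Eventually.of_forall fun p => ?_)
  simp only [linPlane, zero_mul, add_zero, zero_add]
  congr 1 <;> ring

/-- Fubini together with `u = x + ħy/2`, `v = x - ħy/2`, whose Jacobian has modulus `ħ`. -/
theorem inner_hermite_eq_integral {hbar : ℝ} (h : 0 < hbar) {A : L2R →L[ℂ] L2R}
    {r : ℝ × ℝ → ℂ} (hr : IsIntegralKernel A r) (j m : ℕ) :
    inner ℂ (hermiteL2 h m) (A (hermiteL2 h j)) =
      hbar * ∫ x, ∫ y, r (x + hbar * y / 2, x - hbar * y / 2) *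
        (hermiteFun hbar m (x + hbar * y / 2) * hermiteFun hbar j (x - hbar * y / 2)) := by
  have hm := memLp_hermiteFun h m
  have hj := memLp_hermiteFun h j
  have hprod : MemLp (fun p : ℝ × ℝ => hermiteFun hbar m p.1 * hermiteFun hbar j p.2) 2 volume := by
    have hmeas : AEStronglyMeasurable
        (fun p : ℝ × ℝ => hermiteFun hbar m p.1 * hermiteFun hbar j p.2) volume :=
      hm.aestronglyMeasurable.comp_fst.mul hj.aestronglyMeasurable.comp_snd
    rw [memLp_two_iff_integrable_sq_norm hmeas]
    have := ((memLp_two_iff_integrable_sq_norm hm.aestronglyMeasurable).1 hm).mul_prod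
      ((memLp_two_iff_integrable_sq_norm hj.aestronglyMeasurable).1 hj)
    refine this.congr (Eventually.of_forall fun p => ?_)
    simp only [norm_mul, mul_pow]
  have hF : Integrable (fun p : ℝ × ℝ => r p * (hermiteFun hbar m p.1 * hermiteFun hbar j p.2)) :=
    hr.1.integrable_mul hprod
  have hconj : ∀ u, (starRingEnd ℂ) (hermiteFun hbar m u) = hermiteFun hbar m u := fun u => by
    rw [hermiteFun, Complex.conj_ofReal]
  have e1 : inner ℂ (hermiteL2 h m) (A (hermiteL2 h j)) =
      ∫ u, ∫ v, r (u, v) * (hermiteFun hbar m u * hermiteFun hbar j v) := by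
    rw [L2.inner_def]
    refine integral_congr_ae ?_
    filter_upwards [hr.2 (hermiteL2 h j), hm.coeFn_toLp] with u h1 h2
    have h3 : (hermiteL2 h m : ℝ → ℂ) u = hermiteFun hbar m u := h2
    rw [RCLike.inner_apply, h1, h3, hconj, mul_comm, ← integral_const_mul]
    refine integral_congr_ae ?_
    filter_upwards [hj.coeFn_toLp] with v h4
    have h5 : (hermiteL2 h j : ℝ → ℂ) v = hermiteFun hbar j v := h4
    rw [h5]
    ring
  have hdet : (1 : ℝ) * -(hbar / 2) - hbar / 2 * 1 ≠ 0 := by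
    have : (1 : ℝ) * -(hbar / 2) - hbar / 2 * 1 = -hbar := by ring
    rw [this]; exact neg_ne_zero.2 h.ne'
  have hG := memLp_comp_linPlane hdet (memLp_one_iff_integrable.2 hF)
  rw [memLp_one_iff_integrable] at hG
  have e2 := integral_comp_linPlane hdet hF.aestronglyMeasurable
  have hl : ∀ p : ℝ × ℝ, linPlane 1 (hbar / 2) 1 (-(hbar / 2)) p =
      (p.1 + hbar * p.2 / 2, p.1 - hbar * p.2 / 2) := fun p => by
    simp only [linPlane]; ext <;> simp <;> ring
  simp only [hl] at hG e2
  have e3 : |((1 : ℝ) * -(hbar / 2) - hbar / 2 * 1)⁻¹| = hbar⁻¹ := by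
    rw [show (1 : ℝ) * -(hbar / 2) - hbar / 2 * 1 = -hbar by ring, abs_inv, abs_neg, abs_of_pos h]
  rw [e3, Measure.volume_eq_prod, integral_prod _ hG, integral_prod _ hF] at e2
  rw [e1, e2, Complex.real_smul]
  have : (hbar : ℂ) ≠ 0 := by exact_mod_cast h.ne'
  push_cast
  field_simp

/-- The matrix element as a phase-space pairing of Wigner functions. -/
theorem inner_hermite_eq_integral_wigner {hbar : ℝ} (h : 0 < hbar) {A : L2R →L[ℂ] L2R}
    {a : ℝ × ℝ → ℂ} (ha : IsWignerFunction hbar A a) (j m : ℕ) :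
    inner ℂ (hermiteL2 h m) (A (hermiteL2 h j)) =
      ∫ p : ℝ × ℝ, a p * crossWigner j m (p.1 / Real.sqrt hbar) (p.2 / Real.sqrt hbar) := by
  obtain ⟨ha2, r, hr, hW⟩ := ha
  have hi : Integrable fun p : ℝ × ℝ =>
      a p * crossWigner j m (p.1 / Real.sqrt hbar) (p.2 / Real.sqrt hbar) :=
    ha2.integrable_mul (memLp_crossWigner_scaled h j m)
  rw [inner_hermite_eq_integral h hr, Measure.volume_eq_prod, integral_prod _ hi,
    ← integral_const_mul]
  refine integral_congr_ae ?_
  filter_upwards [hW] with x hx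
  obtain ⟨hrx, hξ⟩ := hx
  obtain ⟨φ, hφ⟩ := exists_schwartz_pair h j m x
  have hφ' : (φ : ℝ → ℂ) = fun y => hermiteFun hbar m (x + hbar * y / 2) *
      hermiteFun hbar j (x - hbar * y / 2) := funext hφ
  have hreal : ∀ y, (starRingEnd ℂ) (φ y) = φ y := fun y => by
    rw [hφ, hermiteFun_mul_hermiteFun h, Complex.conj_ofReal]
  have e1 : ∫ y, r (x + hbar * y / 2, x - hbar * y / 2) *
      (hermiteFun hbar m (x + hbar * y / 2) * hermiteFun hbar j (x - hbar * y / 2)) =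
      ∫ y, r (x + hbar * y / 2, x - hbar * y / 2) * (starRingEnd ℂ) (φ y) := by
    simp only [hreal]
    simp only [hφ]
  -- The integrand in the frequency `η = ξ/(2π)`. The prefactor `1/(2π)` of the Wigner function
  -- cancels the Jacobian of this dilation.
  obtain ⟨G, hG⟩ : ∃ G : ℝ → ℂ, ∀ η, G η = (1 / (2 * Real.pi) : ℂ) *
      ((𝓕 hrx.toLp : L2R) η * (starRingEnd ℂ) (𝓕 (φ : ℝ → ℂ) η)) := ⟨_, fun _ => rfl⟩
  have e2 : ∫ ξ, a (x, ξ) * crossWigner j m (x / Real.sqrt hbar) (ξ / Real.sqrt hbar) =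
      hbar * ∫ ξ, G (ξ / (2 * Real.pi)) := by
    rw [← integral_const_mul]
    refine integral_congr_ae ?_
    filter_upwards [hξ] with ξ h1
    have hc : (hbar : ℂ) ≠ 0 := by exact_mod_cast h.ne'
    simp only [hG, hφ', h1]
    rw [conj_fourier_pair h]
    field_simp
  rw [e1, e2, Measure.integral_comp_div, integral_mul_conj_schwartz hrx φ]
  simp only [hG]
  rw [integral_const_mul, abs_of_pos Real.two_pi_pos, Complex.real_smul]
  have : (Real.pi : ℂ) ≠ 0 := by exact_mod_cast Real.pi_ne_zero
  push_cast
  field_simp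

/-! ### Averaging over rotations -/

theorem rot_eq_linPlane (θ : ℝ) :
    rot θ = linPlane (Real.cos θ) (-Real.sin θ) (Real.sin θ) (Real.cos θ) := by
  ext p <;> simp only [rot, linPlane] <;> ring

theorem rot_det (θ : ℝ) : Real.cos θ * Real.cos θ - -Real.sin θ * Real.sin θ = 1 := by
  linear_combination Real.sin_sq_add_cos_sq θ

theorem integral_comp_rot {F : Type*} [NormedAddCommGroup F] [NormedSpace ℝ F] (θ : ℝ)
    {f : ℝ × ℝ → F} (hf : AEStronglyMeasurable f volume) : ∫ p, f (rot θ p) = ∫ p, f p := by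
  have := integral_comp_linPlane (by rw [rot_det]; exact one_ne_zero) hf
    (a := Real.cos θ) (b := -Real.sin θ) (c := Real.sin θ) (d := Real.cos θ)
  rw [← rot_eq_linPlane, rot_det] at this
  simpa using this

theorem memLp_comp_rot {F : Type*} [NormedAddCommGroup F] (θ : ℝ) {f : ℝ × ℝ → F} {q : ℝ≥0∞}
    (hf : MemLp f q volume) : MemLp (fun p => f (rot θ p)) q volume := by
  rw [rot_eq_linPlane]
  exact memLp_comp_linPlane (by rw [rot_det]; exact one_ne_zero) hf

theorem rot_rot (θ φ : ℝ) (p : ℝ × ℝ) : rot θ (rot φ p) = rot (θ + φ) p := by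
  simp only [rot, Real.cos_add, Real.sin_add]
  ext <;> simp only <;> ring

/-- Translate `θ` by `φ` and use periodicity of the integrand. No integrability is required. -/
theorem hasMode_angularCoeff (a : ℝ × ℝ → ℂ) (k : ℤ) : HasMode k (angularCoeff a k) := by
  intro φ p
  set f : ℝ → ℂ := fun θ => a (rot θ p) * Complex.exp (Complex.I * k * θ) with hf
  have hper : Function.Periodic f (2 * Real.pi) := by
    intro θ
    simp only [hf]
    have h1 : rot (θ + 2 * Real.pi) p = rot θ p := by
      simp only [rot, Real.cos_add_two_pi, Real.sin_add_two_pi]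
    have h2 : Complex.I * k * ((θ + 2 * Real.pi : ℝ) : ℂ) =
        Complex.I * k * θ + k * (2 * Real.pi * Complex.I) := by push_cast; ring
    rw [h1, h2, Complex.exp_add, Complex.exp_int_mul_two_pi_mul_I, mul_one]
  have e : ∀ θ : ℝ, a (rot θ (rot φ p)) * Complex.exp (Complex.I * k * θ) =
      Complex.exp (-(Complex.I * k * φ)) * f (θ + φ) := by
    intro θ
    simp only [hf]
    have : Complex.exp (Complex.I * k * θ) = Complex.exp (-(Complex.I * k * φ)) *
        Complex.exp (Complex.I * k * ((θ + φ : ℝ) : ℂ)) := by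
      rw [← Complex.exp_add]; congr 1; push_cast; ring
    rw [rot_rot, this]
    ring
  simp only [angularCoeff, e]
  rw [intervalIntegral.integral_const_mul, intervalIntegral.integral_comp_add_right, zero_add,
    add_comm (2 * Real.pi) φ, hper.intervalIntegral_add_eq φ 0, zero_add]

theorem crossWigner_rot (j m : ℕ) (θ : ℝ) (p : ℝ × ℝ) :
    crossWigner j m (rot θ p).1 (rot θ p).2 =
      Complex.exp (Complex.I * ((m : ℤ) - (j : ℤ) : ℤ) * θ) * crossWigner j m p.1 p.2 := by
  rcases le_total j m with h | h
  · obtain ⟨k, rfl⟩ := Nat.exists_eq_add_of_le h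
    obtain ⟨Q, hQ⟩ := exists_laguerreForm j k
    rw [crossWigner_eq_radialForm hQ, crossWigner_eq_radialForm hQ, radialForm_rot]
    push_cast
    ring_nf
  · obtain ⟨k, rfl⟩ := Nat.exists_eq_add_of_le h
    obtain ⟨Q, hQ⟩ := exists_laguerreForm m k
    rw [crossWigner_conj, crossWigner_conj (m + k), crossWigner_eq_radialForm hQ,
      crossWigner_eq_radialForm hQ, radialForm_rot, map_mul, ← Complex.exp_conj]
    simp only [map_mul, Complex.conj_I, Complex.conj_ofReal, map_natCast]
    push_cast
    ring_nf

theorem continuous_rot : Continuous fun q : ℝ × (ℝ × ℝ) => rot q.1 q.2 := by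
  unfold rot; fun_prop

/-- As `a` is only almost everywhere strongly measurable, joint measurability of `(θ, p) ↦ a(rot θ
p)` needs preimages of null sets to be null. -/
theorem quasiMeasurePreserving_rot (s : Set ℝ) :
    Measure.QuasiMeasurePreserving (fun q : ℝ × (ℝ × ℝ) => rot q.1 q.2)
      ((volume.restrict s).prod volume) volume := by
  refine QuasiMeasurePreserving.prod_of_right continuous_rot.measurable
    (Eventually.of_forall fun θ => ?_)
  simp only [rot_eq_linPlane]
  exact quasiMeasurePreserving_linPlane (by rw [rot_det]; exact one_ne_zero)

/-- Averaging over rotations replaces a symbol by its angular Fourier coefficient. -/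
theorem integral_mul_eq_integral_angularCoeff {a W : ℝ × ℝ → ℂ} (ha : MemLp a 2 volume)
    (hW : MemLp W 2 volume) {k : ℤ}
    (hmode : ∀ θ p, W (rot θ p) = Complex.exp (Complex.I * k * θ) * W p) :
    2 * Real.pi * ∫ p, a p * W p = ∫ p, angularCoeff a k p * W p := by
  -- The phase is exactly the one `W` acquires, so `F θ` is `aW` composed with a rotation and has
  -- the same integral for every `θ`. Fubini over `[0, 2π]` does the rest.
  set F : ℝ → ℝ × ℝ → ℂ := fun θ p => a (rot θ p) * Complex.exp (Complex.I * k * θ) * W p with hF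
  have hexp : ∀ θ : ℝ, ‖Complex.exp (Complex.I * k * θ)‖ = 1 := fun θ => by
    rw [show Complex.I * (k : ℂ) * θ = ((k * θ : ℝ) : ℂ) * Complex.I by push_cast; ring]
    exact Complex.norm_exp_ofReal_mul_I _
  have hFint : ∀ θ, Integrable (F θ) := fun θ => by
    have h1 : Integrable fun p => a (rot θ p) * W p :=
      (memLp_comp_rot θ ha).integrable_mul hW
    refine (h1.const_mul (Complex.exp (Complex.I * k * θ))).congr (Eventually.of_forall fun p => ?_)
    simp only [hF]
    ring
  have hnorm : ∀ θ p, ‖F θ p‖ = ‖a (rot θ p)‖ * ‖W (rot θ p)‖ := fun θ p => by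
    simp only [hF]
    rw [norm_mul, norm_mul, hexp, mul_one, hmode, norm_mul, hexp, one_mul]
  have hnormint : ∀ θ, ∫ p, ‖F θ p‖ = ∫ p, ‖a p‖ * ‖W p‖ := fun θ => by
    simp only [hnorm]
    exact integral_comp_rot θ (f := fun p => ‖a p‖ * ‖W p‖) (ha.1.norm.mul hW.1.norm)
  have hval : ∀ θ, ∫ p, F θ p = ∫ p, a p * W p := fun θ => by
    have : ∀ p, F θ p = a (rot θ p) * W (rot θ p) := fun p => by
      simp only [hF]; rw [hmode]; ring
    simp only [this]
    exact integral_comp_rot θ (f := fun p => a p * W p) (ha.1.mul hW.1)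
  have hpi : (0 : ℝ) ≤ 2 * Real.pi := Real.two_pi_pos.le
  have hmeas : AEStronglyMeasurable (Function.uncurry F)
      ((volume.restrict (Ioc 0 (2 * Real.pi))).prod volume) := by
    refine ((ha.1.comp_quasiMeasurePreserving (quasiMeasurePreserving_rot _)).mul ?_).mul
      hW.1.comp_snd
    exact Continuous.aestronglyMeasurable (by fun_prop)
  have hint : Integrable (Function.uncurry F)
      ((volume.restrict (Ioc 0 (2 * Real.pi))).prod volume) := by
    rw [integrable_prod_iff hmeas]
    refine ⟨Eventually.of_forall fun θ => hFint θ, ?_⟩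
    simp only [Function.uncurry, hnormint]
    exact integrable_const _
  have hsw := integral_integral_swap hint
  simp only [hval] at hsw
  rw [integral_const, measureReal_restrict_apply MeasurableSet.univ, univ_inter,
    Real.volume_real_Ioc_of_le hpi, sub_zero, Complex.real_smul] at hsw
  push_cast at hsw
  rw [hsw]
  congr 1
  ext p
  rw [angularCoeff, intervalIntegral.integral_of_le hpi, ← integral_mul_const]

/-! ### From mixed partial derivatives to Fréchet derivatives -/

section MixedPartial

theorem contDiff_iterate_dirDeriv (v : ℝ × ℝ) (q m : ℕ) {f : ℝ × ℝ → ℂ}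
    (hf : ContDiff ℝ ((q + m : ℕ) : WithTop ℕ∞) f) : ContDiff ℝ m ((dirDeriv v)^[q] f) := by
  induction q generalizing f with
  | zero => simpa using hf
  | succ q ih =>
    rw [Function.iterate_succ_apply]
    refine ih (contDiff_dirDeriv hf v ?_)
    norm_cast
    omega

theorem iteratedDeriv_snd (q : ℕ) {f : ℝ × ℝ → ℂ} (hf : ContDiff ℝ q f) (x : ℝ) :
    iteratedDeriv q (fun ξ => f (x, ξ)) = fun ξ => (dirDeriv (0, 1))^[q] f (x, ξ) := by
  induction q generalizing f with
  | zero => simp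
  | succ q ih =>
    have h1 : deriv (fun ξ => f (x, ξ)) = fun ξ => dirDeriv (0, 1) f (x, ξ) := funext fun ξ =>
      (hasDerivAt_snd_of_differentiableAt (p := (x, ξ))
        (hf.differentiable (by norm_cast) (x, ξ))).deriv
    rw [iteratedDeriv_succ', h1, ih (contDiff_dirDeriv hf _ (by norm_cast))]
    simp only [Function.iterate_succ_apply]

theorem iteratedDeriv_fst (q : ℕ) {f : ℝ × ℝ → ℂ} (hf : ContDiff ℝ q f) (ξ : ℝ) :
    iteratedDeriv q (fun x => f (x, ξ)) = fun x => (dirDeriv (1, 0))^[q] f (x, ξ) := by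
  induction q generalizing f with
  | zero => simp
  | succ q ih =>
    have h1 : deriv (fun x => f (x, ξ)) = fun x => dirDeriv (1, 0) f (x, ξ) := funext fun x =>
      (hasDerivAt_fst_of_differentiableAt (p := (x, ξ))
        (hf.differentiable (by norm_cast) (x, ξ))).deriv
    rw [iteratedDeriv_succ', h1, ih (contDiff_dirDeriv hf _ (by norm_cast))]
    simp only [Function.iterate_succ_apply]

theorem mixedPartial_eq {p q : ℕ} {f : ℝ × ℝ → ℂ}
    (hf : ContDiff ℝ ((p + q : ℕ) : WithTop ℕ∞) f) (z : ℝ × ℝ) :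
    mixedPartial p q f z = (dirDeriv (1, 0))^[p] ((dirDeriv (0, 1))^[q] f) z := by
  have hq : ContDiff ℝ q f := hf.of_le (by norm_cast; omega)
  have hp : ContDiff ℝ p ((dirDeriv (0, 1))^[q] f) :=
    contDiff_iterate_dirDeriv _ q p (by rwa [add_comm])
  simp only [mixedPartial, iteratedDeriv_snd q hq]
  rw [iteratedDeriv_fst p hp]

theorem dirDeriv_comm {f : ℝ × ℝ → ℂ} (hf : ContDiff ℝ 2 f) (v w : ℝ × ℝ) :
    dirDeriv v (dirDeriv w f) = dirDeriv w (dirDeriv v f) := by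
  have hd : Differentiable ℝ (fderiv ℝ f) :=
    (hf.fderiv_right (m := 1) (by norm_num)).differentiable one_ne_zero
  have e : ∀ v w p, dirDeriv v (dirDeriv w f) p = fderiv ℝ (fderiv ℝ f) p v w := by
    intro v w p
    have := ((hd p).hasFDerivAt.clm_apply (hasFDerivAt_const w p)).fderiv
    refine (DFunLike.congr_fun this v).trans ?_
    simp
  ext p
  rw [e, e]
  exact (hf.contDiffAt.isSymmSndFDerivAt (by simp)).eq v w

theorem iterate_dirDeriv_comm (v w : ℝ × ℝ) (q : ℕ) {f : ℝ × ℝ → ℂ}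
    (hf : ContDiff ℝ ((q + 1 : ℕ) : WithTop ℕ∞) f) :
    (dirDeriv v)^[q] (dirDeriv w f) = dirDeriv w ((dirDeriv v)^[q] f) := by
  induction q generalizing f with
  | zero => rfl
  | succ q ih =>
    rw [Function.iterate_succ_apply, Function.iterate_succ_apply,
      dirDeriv_comm (hf.of_le (by norm_cast; omega)), ih (contDiff_dirDeriv hf v (by norm_cast))]

theorem fderiv_eq_dirDeriv (f : ℝ × ℝ → ℂ) : fderiv ℝ f = fun p =>
    ContinuousLinearMap.smulRightL ℝ (ℝ × ℝ) ℂ (ContinuousLinearMap.fst ℝ ℝ ℝ)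
      (dirDeriv (1, 0) f p) +
    ContinuousLinearMap.smulRightL ℝ (ℝ × ℝ) ℂ (ContinuousLinearMap.snd ℝ ℝ ℝ)
      (dirDeriv (0, 1) f p) := by
  ext1 p
  ext <;> simp [dirDeriv]

theorem norm_smulRightL_le {L : ℝ × ℝ →L[ℝ] ℝ} (hL : ‖L‖ ≤ 1) :
    ‖ContinuousLinearMap.smulRightL ℝ (ℝ × ℝ) ℂ L‖ ≤ 1 := by
  refine ContinuousLinearMap.opNorm_le_bound _ zero_le_one fun c => ?_
  have : ContinuousLinearMap.smulRightL ℝ (ℝ × ℝ) ℂ L c = L.smulRight c := rfl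
  rw [this, ContinuousLinearMap.norm_smulRight_apply]
  exact mul_le_mul_of_nonneg_right hL (norm_nonneg c)

/-- The differential is the sum of its two coordinate parts, hence a factor `2` per order. Commuting
partial derivatives restores the normal order of all `∂x` outside all `∂ξ`. -/
theorem norm_iteratedFDeriv_le_of_dirDeriv (m : ℕ) {f : ℝ × ℝ → ℂ} (hf : ContDiff ℝ m f)
    (z : ℝ × ℝ) {B : ℝ}
    (hB : ∀ p q, p + q = m → ‖(dirDeriv (1, 0))^[p] ((dirDeriv (0, 1))^[q] f) z‖ ≤ B) :
    ‖iteratedFDeriv ℝ m f z‖ ≤ 2 ^ m * B := by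
  induction m generalizing f with
  | zero =>
    rw [norm_iteratedFDeriv_zero, pow_zero, one_mul]
    exact hB 0 0 rfl
  | succ m ih =>
    have c1 : ContDiff ℝ m (dirDeriv (1, 0) f) := contDiff_dirDeriv hf _ (by norm_cast)
    have c2 : ContDiff ℝ m (dirDeriv (0, 1) f) := contDiff_dirDeriv hf _ (by norm_cast)
    have h1 := ih c1 fun p q hpq => by
      rw [iterate_dirDeriv_comm _ _ q (hf.of_le (by norm_cast; omega)),
        ← Function.iterate_succ_apply]
      exact hB (p + 1) q (by omega)
    have h2 := ih c2 fun p q hpq => by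
      rw [← Function.iterate_succ_apply]
      exact hB p (q + 1) (by omega)
    rw [← norm_iteratedFDeriv_fderiv, fderiv_eq_dirDeriv]
    set L₁ := ContinuousLinearMap.smulRightL ℝ (ℝ × ℝ) ℂ (ContinuousLinearMap.fst ℝ ℝ ℝ)
    set L₂ := ContinuousLinearMap.smulRightL ℝ (ℝ × ℝ) ℂ (ContinuousLinearMap.snd ℝ ℝ ℝ)
    have n1 : ‖L₁‖ ≤ 1 := norm_smulRightL_le (ContinuousLinearMap.norm_fst_le ℝ ℝ ℝ)
    have n2 : ‖L₂‖ ≤ 1 := norm_smulRightL_le (ContinuousLinearMap.norm_snd_le ℝ ℝ ℝ)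
    have e := iteratedFDeriv_add_apply (𝕜 := ℝ) (x := z) (i := m)
      (L₁.contDiff.comp c1).contDiffAt (L₂.contDiff.comp c2).contDiffAt
    have e' : iteratedFDeriv ℝ m (fun p => L₁ (dirDeriv (1, 0) f p) + L₂ (dirDeriv (0, 1) f p)) z =
        iteratedFDeriv ℝ m (L₁ ∘ dirDeriv (1, 0) f) z +
          iteratedFDeriv ℝ m (L₂ ∘ dirDeriv (0, 1) f) z := e
    rw [e']
    have b1 := L₁.norm_iteratedFDeriv_comp_left (f := dirDeriv (1, 0) f) (x := z) (n := m)
      c1.contDiffAt le_rfl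
    have b2 := L₂.norm_iteratedFDeriv_comp_left (f := dirDeriv (0, 1) f) (x := z) (n := m)
      c2.contDiffAt le_rfl
    have b3 := mul_le_of_le_one_left (norm_nonneg (iteratedFDeriv ℝ m (dirDeriv (1, 0) f) z)) n1
    have b4 := mul_le_of_le_one_left (norm_nonneg (iteratedFDeriv ℝ m (dirDeriv (0, 1) f) z)) n2
    refine (norm_add_le _ _).trans ?_
    rw [pow_succ]
    linarith

theorem norm_iteratedFDeriv_le_of_mixedPartial {m : ℕ} {f : ℝ × ℝ → ℂ} (hf : ContDiff ℝ m f)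
    (z : ℝ × ℝ) {B : ℝ} (hB : ∀ p q, p + q = m → ‖mixedPartial p q f z‖ ≤ B) :
    ‖iteratedFDeriv ℝ m f z‖ ≤ 2 ^ m * B := by
  refine norm_iteratedFDeriv_le_of_dirDeriv m hf z fun p q hpq => ?_
  rw [← mixedPartial_eq (by rwa [hpq])]
  exact hB p q hpq

theorem norm_iteratedFDeriv_comp_smul_le {m : ℕ} {f : ℝ × ℝ → ℂ} (hf : ContDiff ℝ m f) {c : ℝ}
    (hc : 0 ≤ c) (w : ℝ × ℝ) :
    ‖iteratedFDeriv ℝ m (fun w => f (c • w)) w‖ ≤ c ^ m * ‖iteratedFDeriv ℝ m f (c • w)‖ := by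
  have e := (c • ContinuousLinearMap.id ℝ (ℝ × ℝ)).iteratedFDeriv_comp_right hf w
    (i := m) le_rfl
  have e' : iteratedFDeriv ℝ m (fun w => f (c • w)) w =
      (iteratedFDeriv ℝ m f (c • w)).compContinuousLinearMap
        fun _ => c • ContinuousLinearMap.id ℝ (ℝ × ℝ) := e
  rw [e']
  refine (ContinuousMultilinearMap.norm_compContinuousLinearMap_le _ _).trans ?_
  rw [Finset.prod_const, Finset.card_univ, Fintype.card_fin, mul_comm]
  refine mul_le_mul_of_nonneg_right (pow_le_pow_left₀ (norm_nonneg _) ?_ m) (norm_nonneg _)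
  rw [norm_smul, Real.norm_of_nonneg hc]
  exact mul_le_of_le_one_right hc ContinuousLinearMap.norm_id_le

end MixedPartial

/-! ### Symbol estimates and conclusion -/

theorem HasMode.conj {k : ℤ} {g : ℝ × ℝ → ℂ} (h : HasMode k g) :
    HasMode (-k) fun p => (starRingEnd ℂ) (g p) := fun θ p => by
  simp only [h θ p, map_mul, ← Complex.exp_conj, map_neg, Complex.conj_I, Complex.conj_ofReal,
    map_intCast]
  congr 2
  push_cast
  ring

theorem DBound.conj {n : ℕ} {ω : ℝ × ℝ → ℝ} {g : ℝ × ℝ → ℂ} (h : DBound n ω g) :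
    DBound n ω fun p => (starRingEnd ℂ) (g p) := by
  refine (h.clm (Complex.conjCLE : ℂ →L[ℝ] ℂ)).mono le_rfl fun z => ?_
  rw [Complex.conjCLE_norm, one_mul]

/-- The integral of a symbol of angular mode `m - j` and order `-2E` against `crossWigner j m`. -/
theorem exists_norm_integral_crossWigner_le (n : ℕ) (hn : 1 ≤ n) :
    ∃ C : ℝ, 0 < C ∧ ∀ (j m : ℕ) {hbar : ℝ}, 0 < hbar → hbar ≤ 1 → ∀ {E : ℝ}, 0 ≤ E →
      E ≤ ((n : ℝ) - 1) / 2 → ∀ {K : ℝ}, 0 ≤ K → ∀ {g : ℝ × ℝ → ℂ},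
      HasMode ((m : ℤ) - (j : ℤ)) g → DBound n (fun p => K * weight hbar 1 p ^ (-E)) g →
      ‖∫ p : ℝ × ℝ, g p * crossWigner j m p.1 p.2‖ ≤
        C * K * (|(m : ℝ) - j| + 1) * (1 + hbar * (j + m + 1)) ^ (-E) := by
  obtain ⟨C, hC, hmain⟩ := LaguerreForm.exists_norm_integral_le n hn
  refine ⟨C, hC, ?_⟩
  intro j m hbar h0 h1 E hE0 hE K hK g hm hg
  have hpos : (0 : ℝ) < 1 + hbar * (j + m + 1) := by positivity
  rcases hK.eq_or_lt with rfl | hK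
  · have : ∀ p, g p = 0 := fun p => by
      have := hg.norm_le p
      rw [zero_mul] at this
      exact norm_le_zero_iff.1 this
    simp [this]
  rcases le_total j m with h | h
  · obtain ⟨k, rfl⟩ := Nat.exists_eq_add_of_le h
    obtain ⟨Q, hQ⟩ := exists_laguerreForm j k
    simp only [crossWigner_eq_radialForm hQ]
    have hm' : HasMode k g := by
      have e : ((j + k : ℕ) : ℤ) - (j : ℤ) = k := by push_cast; ring
      rwa [e] at hm
    refine (hmain hQ h0 h1 hE0 hE hK hm' hg).trans (le_of_eq ?_)
    push_cast
    rw [add_sub_cancel_left, abs_of_nonneg (Nat.cast_nonneg k)]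
    congr 2
    ring
  · obtain ⟨k, rfl⟩ := Nat.exists_eq_add_of_le h
    obtain ⟨Q, hQ⟩ := exists_laguerreForm m k
    have hm' : HasMode k fun p => (starRingEnd ℂ) (g p) := by
      have e : -((m : ℤ) - ((m + k : ℕ) : ℤ)) = k := by push_cast; ring
      have := hm.conj
      rwa [e] at this
    have e : ∀ p : ℝ × ℝ, g p * crossWigner (m + k) m p.1 p.2 =
        (starRingEnd ℂ) ((starRingEnd ℂ) (g p) * radialForm k Q p) := fun p => by
      rw [crossWigner_conj (m + k) m, crossWigner_eq_radialForm hQ, map_mul, Complex.conj_conj]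
    simp only [e]
    rw [integral_conj, RCLike.norm_conj]
    refine (hmain hQ h0 h1 hE0 hE hK hm' hg.conj).trans (le_of_eq ?_)
    push_cast
    rw [sub_add_cancel_left, abs_neg, abs_of_nonneg (Nat.cast_nonneg k)]
    congr 2
    ring

theorem symbolNorm_ne_top {hbar M K : ℝ} {N : ℕ} {a : ℝ × ℝ → ℂ} (h : symbolNorm hbar M K N a ≠ ⊤) :
    (∀ k, ContDiff ℝ N (angularCoeff a k)) ∧ ∀ (k : ℤ) (z : ℝ × ℝ) (p q : ℕ), p + q ≤ N →
      0 ≤ hbar →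
      (z.1 ^ 2 + z.2 ^ 2 + 1) ^ M * (|(k : ℝ)| + 1) ^ K * Real.sqrt hbar ^ (p + q) *
        ‖mixedPartial p q (angularCoeff a k) z‖ ≤ (symbolNorm hbar M K N a).toReal := by
  by_cases hc : ∀ k : ℤ, ContDiff ℝ N (angularCoeff a k)
  · refine ⟨hc, fun k z p q hpq h0 => ?_⟩
    have hle : ENNReal.ofReal
        ((z.1 ^ 2 + z.2 ^ 2 + 1) ^ M * (|(k : ℝ)| + 1) ^ K * Real.sqrt hbar ^ (p + q)) *
        ‖mixedPartial p q (angularCoeff a k) z‖ₑ ≤ symbolNorm hbar M K N a := by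
      rw [symbolNorm, if_pos hc]
      exact le_iSup_of_le k (le_iSup_of_le z (le_iSup_of_le p (le_iSup_of_le q
        (le_iSup_of_le hpq le_rfl))))
    have := ENNReal.toReal_mono h hle
    rwa [ENNReal.toReal_mul, ENNReal.toReal_ofReal (by positivity), toReal_enorm] at this
  · exact absurd (by rw [symbolNorm, if_neg hc]) h

/-- The rescaled angular coefficient `w ↦ a_k(√hbar w)` is a symbol with the bounds given by
`symbolNorm`. -/
theorem dBound_angularCoeff {hbar M K : ℝ} (h0 : 0 ≤ hbar) {N : ℕ} {a : ℝ × ℝ → ℂ}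
    (h : symbolNorm hbar M K N a ≠ ⊤) (k : ℤ) :
    DBound N (fun p => 2 ^ N * ((symbolNorm hbar M K N a).toReal * (|(k : ℝ)| + 1) ^ (-K)) *
      weight hbar 1 p ^ (-M)) (fun w => angularCoeff a k (Real.sqrt hbar • w)) := by
  obtain ⟨hc, hb⟩ := symbolNorm_ne_top h
  set S := (symbolNorm hbar M K N a).toReal with hS
  have hS0 : 0 ≤ S := ENNReal.toReal_nonneg
  refine ⟨(hc k).comp (contDiff_const_smul _), fun m hm w => ?_⟩
  have hcm : ContDiff ℝ m (angularCoeff a k) := (hc k).of_le (by exact_mod_cast hm)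
  refine (norm_iteratedFDeriv_comp_smul_le hcm (Real.sqrt_nonneg hbar) w).trans ?_
  set z := Real.sqrt hbar • w with hz
  have hwt : z.1 ^ 2 + z.2 ^ 2 + 1 = weight hbar 1 w := by
    simp only [hz, Prod.smul_fst, Prod.smul_snd, smul_eq_mul, mul_pow, Real.sq_sqrt h0, weight]
    ring
  have hw0 : 0 < weight hbar 1 w := lt_of_lt_of_le one_pos (one_le_weight h0 w)
  have hk0 : (0 : ℝ) < |(k : ℝ)| + 1 := by positivity
  have hX : 0 ≤ S * (|(k : ℝ)| + 1) ^ (-K) * weight hbar 1 w ^ (-M) := by positivity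
  have hpart : ∀ p q, p + q = m → Real.sqrt hbar ^ m * ‖mixedPartial p q (angularCoeff a k) z‖ ≤
      S * (|(k : ℝ)| + 1) ^ (-K) * weight hbar 1 w ^ (-M) := by
    intro p q hpq
    have := hb k z p q (by omega) h0
    rw [hwt, hpq] at this
    rw [Real.rpow_neg hk0.le, Real.rpow_neg hw0.le, ← div_eq_mul_inv, ← div_eq_mul_inv,
      le_div_iff₀ (by positivity), le_div_iff₀ (by positivity)]
    refine le_of_eq_of_le ?_ this
    ring
  have hfin : Real.sqrt hbar ^ m * ‖iteratedFDeriv ℝ m (angularCoeff a k) z‖ ≤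
      2 ^ m * (S * (|(k : ℝ)| + 1) ^ (-K) * weight hbar 1 w ^ (-M)) := by
    -- At `ħ = 0` the norm controls no derivative, but the rescaled function is constant, so only
    -- order zero matters.
    rcases (Real.sqrt_nonneg hbar).eq_or_lt with hs | hs
    · rcases m with _ | m
      · have := hpart 0 0 rfl
        rw [norm_iteratedFDeriv_zero]
        simpa [mixedPartial] using this
      · rw [← hs, zero_pow (Nat.succ_ne_zero m), zero_mul]
        positivity
    · have hsm : 0 < Real.sqrt hbar ^ m := by positivity
      have := norm_iteratedFDeriv_le_of_mixedPartial hcm z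
        (B := S * (|(k : ℝ)| + 1) ^ (-K) * weight hbar 1 w ^ (-M) / Real.sqrt hbar ^ m)
        fun p q hpq => by
          rw [le_div_iff₀ hsm, mul_comm]
          exact hpart p q hpq
      calc _ ≤ Real.sqrt hbar ^ m * (2 ^ m * (S * (|(k : ℝ)| + 1) ^ (-K) *
            weight hbar 1 w ^ (-M) / Real.sqrt hbar ^ m)) := by gcongr
        _ = _ := by field_simp
  refine hfin.trans ?_
  exact (mul_le_mul_of_nonneg_right (pow_le_pow_right₀ one_le_two hm) hX).trans
    (le_of_eq (mul_assoc _ _ _).symm)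

/-- The matrix element in terms of a single rescaled angular coefficient. -/
theorem inner_hermite_eq_integral_angularCoeff {hbar : ℝ} (h : 0 < hbar) {A : L2R →L[ℂ] L2R}
    {a : ℝ × ℝ → ℂ} (ha : IsWignerFunction hbar A a) (j m : ℕ)
    (hc : Continuous (angularCoeff a ((m : ℤ) - (j : ℤ)))) :
    2 * Real.pi * inner ℂ (hermiteL2 h m) (A (hermiteL2 h j)) =
      hbar * ∫ p : ℝ × ℝ, angularCoeff a ((m : ℤ) - (j : ℤ)) (Real.sqrt hbar • p) *
        crossWigner j m p.1 p.2 := by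
  have h0 : 0 < Real.sqrt hbar := Real.sqrt_pos.2 h
  set W : ℝ × ℝ → ℂ := fun p => crossWigner j m (p.1 / Real.sqrt hbar) (p.2 / Real.sqrt hbar)
    with hW
  have hWm : MemLp W 2 volume := memLp_crossWigner_scaled h j m
  rw [inner_hermite_eq_integral_wigner h ha j m,
    integral_mul_eq_integral_angularCoeff ha.1 hWm (k := (m : ℤ) - (j : ℤ))]
  · have hdet : Real.sqrt hbar * Real.sqrt hbar - 0 * 0 = hbar := by
      rw [Real.mul_self_sqrt h.le]; ring
    have key := integral_comp_linPlane (a := Real.sqrt hbar) (b := 0) (c := 0) (d := Real.sqrt hbar)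
      (by rw [hdet]; exact h.ne')
      (f := fun p => angularCoeff a ((m : ℤ) - (j : ℤ)) p * W p)
      (hc.aestronglyMeasurable.mul hWm.1)
    have hl : ∀ p : ℝ × ℝ, linPlane (Real.sqrt hbar) 0 0 (Real.sqrt hbar) p = Real.sqrt hbar • p :=
      fun p => by ext <;> simp [linPlane]
    have hWs : ∀ p : ℝ × ℝ, W (Real.sqrt hbar • p) = crossWigner j m p.1 p.2 := fun p => by
      simp only [hW, Prod.smul_fst, Prod.smul_snd, smul_eq_mul, mul_div_cancel_left₀ _ h0.ne']
    rw [hdet, abs_of_pos (inv_pos.2 h)] at key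
    simp only [hl, hWs] at key
    have hne : (hbar : ℂ) ≠ 0 := by exact_mod_cast h.ne'
    rw [key, Complex.real_smul]
    push_cast
    field_simp
  · intro θ p
    have := crossWigner_rot j m θ (p.1 / Real.sqrt hbar, p.2 / Real.sqrt hbar)
    simp only [hW]
    rw [← this]
    congr 1 <;> simp only [rot] <;> ring

/-- For `F ≥ 0` this is monotonicity. For `F < 0` the right side may shrink as `y` drops to `1/2`,
by a factor at most `2^{-2}`, which the `4` compensates. -/
theorem rpow_neg_le_of_le {y L E F : ℝ} (hy : 1 / 2 ≤ y) (hL : 1 ≤ L) (hyL : y ≤ L) (hE : 0 ≤ E)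
    (hFE : F ≤ E) (hF : -2 ≤ F) : L ^ (-E) ≤ 4 * y ^ (-F) := by
  have y0 : 0 < y := by linarith
  rcases le_total 0 F with h0 | h0
  · calc L ^ (-E) ≤ L ^ (-F) := Real.rpow_le_rpow_of_exponent_le hL (by linarith)
      _ ≤ y ^ (-F) := Real.rpow_le_rpow_of_nonpos y0 hyL (by linarith)
      _ ≤ 4 * y ^ (-F) := by linarith [Real.rpow_pos_of_pos y0 (-F)]
  · have h1 : L ^ (-E) ≤ 1 := Real.rpow_le_one_of_one_le_of_nonpos hL (by linarith)
    have h2 : (1 / 2 : ℝ) ^ (-F) ≤ y ^ (-F) :=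
      Real.rpow_le_rpow (by norm_num) hy (by linarith)
    have h3 : (1 / 2 : ℝ) ^ (2 : ℝ) ≤ (1 / 2 : ℝ) ^ (-F) :=
      Real.rpow_le_rpow_of_exponent_ge (by norm_num) (by norm_num) (by linarith)
    have h4 : (1 / 2 : ℝ) ^ (2 : ℝ) = 1 / 4 := by
      rw [show (2 : ℝ) = ((2 : ℕ) : ℝ) by norm_num, Real.rpow_natCast]; norm_num
    linarith

end HermiteWigner

theorem proposition6p1 (μ : ℝ) (hμ : 0 ≤ μ) (n : ℕ) (hn : 1 ≤ n) :
    ∃ D : ℝ, 0 < D ∧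
      ∀ (hbar : ℝ) (hpos : 0 < hbar), hbar ≤ 1 →
      ∀ M α τ ε : ℝ, 0 ≤ M → 0 ≤ α → α + 1 ≤ τ → 0 < ε →
      ∀ A : HermiteWigner.L2R →L[ℂ] HermiteWigner.L2R, HermiteWigner.IsHilbertSchmidt A →
      ∀ a : ℝ × ℝ → ℂ, HermiteWigner.IsWignerFunction hbar A a →
      ∀ j j' : ℕ,
        ‖inner ℂ (HermiteWigner.hermiteL2 hpos j') (A (HermiteWigner.hermiteL2 hpos j))‖ₑ ≤
          ENNReal.ofReal
            (D * (2 * Real.pi * hbar) /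
              ((|(j' : ℝ) - (j : ℝ)| + 1 / 2) ^ min (1 + α + ε) (1 + ε + τ) *
                (((j : ℝ) + 1 / 2) * hbar + 1 / 2) ^
                  min (min ((τ - α - 1) / 2) (μ - 3 / 2)) (min M (((n : ℝ) - 1) / 2)))) *
          HermiteWigner.symbolNorm hbar M (1 + ε + τ) n a := by
  obtain ⟨C, hC, hmain⟩ := HermiteWigner.exists_norm_integral_crossWigner_le n hn
  have hpi := Real.pi_pos
  -- The factor `2^n` comes from passing to Fréchet derivatives. The `4` of `rpow_neg_le_of_le`
  -- cancels against the `(2π)²` formed by the angular average and the `2πħ` in the claim.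
  refine ⟨C * 2 ^ n / Real.pi ^ 2, by positivity, ?_⟩
  intro hbar hpos hle M α τ ε hM hα hτ hε A _ a ha j j'
  have hn1 : (1 : ℝ) ≤ n := by exact_mod_cast hn
  set k : ℤ := (j' : ℤ) - (j : ℤ) with hk
  have hkr : (k : ℝ) = (j' : ℝ) - j := by rw [hk]; push_cast; ring
  rw [← hkr, min_eq_left (by linarith : 1 + α + ε ≤ 1 + ε + τ)]
  set E : ℝ := min M (((n : ℝ) - 1) / 2) with hE
  set F : ℝ := min (min ((τ - α - 1) / 2) (μ - 3 / 2)) E with hF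
  set y : ℝ := ((j : ℝ) + 1 / 2) * hbar + 1 / 2 with hy
  set L : ℝ := 1 + hbar * (j + j' + 1) with hL
  have hj0 : (0 : ℝ) ≤ j := Nat.cast_nonneg j
  have hj0' : (0 : ℝ) ≤ j' := Nat.cast_nonneg j'
  have hE0 : 0 ≤ E := le_min hM (by linarith)
  -- The exponent may be negative, but not below `-3/2`, since `μ ≥ 0`.
  have hF2 : -2 ≤ F := le_min (le_min (by linarith) (by linarith)) (by linarith)
  have hy2 : 1 / 2 ≤ y := by rw [hy]; have : 0 ≤ ((j : ℝ) + 1 / 2) * hbar := by positivity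
                             linarith
  have hL1 : 1 ≤ L := by rw [hL]; have : 0 ≤ hbar * ((j : ℝ) + j' + 1) := by positivity
                         linarith
  have hyL : y ≤ L := by rw [hy, hL]; nlinarith
  have hy0 : 0 < y := by linarith
  have hk0 : (0 : ℝ) ≤ |(k : ℝ)| := abs_nonneg _
  set c : ℝ := C * 2 ^ n / Real.pi ^ 2 * (2 * Real.pi * hbar) /
    ((|(k : ℝ)| + 1 / 2) ^ (1 + α + ε) * y ^ F) with hc
  have hc0 : 0 < c := by positivity
  by_cases htop : HermiteWigner.symbolNorm hbar M (1 + ε + τ) n a = ⊤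
  · rw [htop, ENNReal.mul_top (ENNReal.ofReal_pos.2 hc0).ne']
    exact le_top
  set S := (HermiteWigner.symbolNorm hbar M (1 + ε + τ) n a).toReal with hS
  have hS0 : 0 ≤ S := ENNReal.toReal_nonneg
  rw [← ENNReal.ofReal_toReal htop, ← hS, ← ENNReal.ofReal_mul hc0.le, ← ofReal_norm]
  refine ENNReal.ofReal_le_ofReal ?_
  have hcont : Continuous (HermiteWigner.angularCoeff a k) :=
    ((HermiteWigner.symbolNorm_ne_top htop).1 k).continuous
  have hin := HermiteWigner.inner_hermite_eq_integral_angularCoeff hpos ha j j' hcont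
  have hg := HermiteWigner.dBound_angularCoeff hpos.le htop k
  rw [← hS] at hg
  have hg' := hg.mono le_rfl (ω' := fun p => 2 ^ n * (S * (|(k : ℝ)| + 1) ^ (-(1 + ε + τ))) *
      HermiteWigner.weight hbar 1 p ^ (-E)) fun p => by
    have := Real.rpow_le_rpow_of_exponent_le (HermiteWigner.one_le_weight (L := 1) hpos.le p)
      (neg_le_neg (min_le_left M (((n : ℝ) - 1) / 2)))
    gcongr
  have hmode : HermiteWigner.HasMode k
      fun w => HermiteWigner.angularCoeff a k (Real.sqrt hbar • w) := fun θ p => by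
    have e : Real.sqrt hbar • HermiteWigner.rot θ p = HermiteWigner.rot θ (Real.sqrt hbar • p) := by
      ext <;> simp [HermiteWigner.rot] <;> ring
    simp only [e]
    exact HermiteWigner.hasMode_angularCoeff a k θ _
  have hb := hmain j j' hpos hle hE0 (min_le_right _ _) (by positivity) hmode hg'
  rw [← hkr, ← hL] at hb
  have hnorm : 2 * Real.pi * ‖inner ℂ (HermiteWigner.hermiteL2 hpos j')
      (A (HermiteWigner.hermiteL2 hpos j))‖ = hbar * ‖∫ p : ℝ × ℝ,
        HermiteWigner.angularCoeff a k (Real.sqrt hbar • p) *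
          HermiteWigner.crossWigner j j' p.1 p.2‖ := by
    have := congrArg norm hin
    rwa [norm_mul, norm_mul, norm_mul, Complex.norm_real, Complex.norm_real, Complex.norm_two,
      Real.norm_of_nonneg hpi.le, Real.norm_of_nonneg hpos.le] at this
  -- The power of `|k|+1` lost in the pairing leaves the exponent `ε + τ`, which is at least `1 + α
  -- + ε` because `τ ≥ α + 1`.
  have hkpow : (|(k : ℝ)| + 1) ^ (-(1 + ε + τ)) * (|(k : ℝ)| + 1) ≤
      (|(k : ℝ)| + 1 / 2) ^ (-(1 + α + ε)) := by
    have e : (|(k : ℝ)| + 1) ^ (-(1 + ε + τ)) * (|(k : ℝ)| + 1) = (|(k : ℝ)| + 1) ^ (-(ε + τ)) := by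
      rw [show -(ε + τ) = -(1 + ε + τ) + 1 by ring, Real.rpow_add (by positivity), Real.rpow_one]
    rw [e]
    exact (Real.rpow_le_rpow_of_exponent_le (by linarith) (by linarith)).trans
      (Real.rpow_le_rpow_of_nonpos (by positivity) (by linarith) (by linarith))
  have hLy := HermiteWigner.rpow_neg_le_of_le hy2 hL1 hyL hE0 (min_le_right _ E) hF2
  have hfin : 2 * Real.pi * ‖inner ℂ (HermiteWigner.hermiteL2 hpos j')
      (A (HermiteWigner.hermiteL2 hpos j))‖ ≤ 2 * Real.pi * (c * S) := by
    rw [hnorm]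
    calc _ ≤ hbar * (C * (2 ^ n * (S * (|(k : ℝ)| + 1) ^ (-(1 + ε + τ)))) * (|(k : ℝ)| + 1) *
          L ^ (-E)) := by gcongr
      _ = hbar * C * 2 ^ n * S * ((|(k : ℝ)| + 1) ^ (-(1 + ε + τ)) * (|(k : ℝ)| + 1)) * L ^ (-E) := by
          ring
      _ ≤ hbar * C * 2 ^ n * S * (|(k : ℝ)| + 1 / 2) ^ (-(1 + α + ε)) * (4 * y ^ (-F)) := by gcongr
      _ = 2 * Real.pi * (c * S) := by
          rw [hc, Real.rpow_neg (by positivity), Real.rpow_neg hy0.le]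
          field_simp
          norm_num
  exact le_of_mul_le_mul_left hfin (by positivity)
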